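/- Let $\mathbb T=\mathbb R/2\pi\mathbb Z$, and for $k\in\mathbb N$ let $H^k(\mathbb T)$ be the Sobolev space of real-valued functions in $L^2(\mathbb T)$ whose weak derivatives up to order $k$ belong to $L^2(\mathbb T)$, with its usual norm. Let $u_0\in H^2(\mathbb T)$ and $\rho_0\in H^3(\mathbb T)$ with $\rho_0>0$ on $\mathbb T$. Then the one-dimensional pressureless Navier–Stokes system with density-dependent viscosity $$\rho_t+(\rho u)_x=0,\qquad (\rho u)_t+(\rho u^2)_x=(\rho^2u_x)_x\qquad\text{on }\mathbb T\times[0,\infty)$$ has a global solution in the same class: there are $$u\in C\big([0,\infty);H^2(\mathbb T)\big),\qquad \rho\in C\big([0,\infty);H^3(\mathbb T)\big),$$ with $u(\cdot,0)=u_0$, $\rho(\cdot,0)=\rho_0$ and $\rho(\cdot,t)>0$ on $\mathbb T$ for every $t\ge 0$, such that $t\mapsto\rho(\cdot,t)$ and $t\mapsto(\rho u)(\cdot,t)$ are differentiable as maps $[0,\infty)\to L^2(\mathbb T)$ and both equations hold in $L^2(\mathbb T)$ for every $t\ge0$, the space derivatives being weak derivatives. -/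

import Mathlib

open MeasureTheory Set Filter Topology
open scoped ContDiff

noncomputable section

namespace PressurelessNS

instance two_pi_pos_fact : Fact (0 < 2 * Real.pi) := ⟨Real.two_pi_pos⟩

/-- The one-dimensional torus `ℝ / 2πℤ`. -/
abbrev Torus : Type := AddCircle (2 * Real.pi)

/-- Real-valued `L²` of the torus, with respect to Lebesgue measure. -/
abbrev L2 : Type := Lp ℝ 2 (volume : Measure Torus)

/-- `φ` is a smooth function on the torus, with derivative `φ'`. -/
def IsTestPair (φ φ' : Torus → ℝ) : Prop :=
  ContDiff ℝ ∞ (fun x : ℝ => φ (x : Torus)) ∧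
    ∀ x : ℝ, HasDerivAt (fun y : ℝ => φ (y : Torus)) (φ' (x : Torus)) x

/-- `g` is the weak derivative of `f` on the torus. -/
def IsWeakDeriv (f g : L2) : Prop :=
  ∀ φ φ' : Torus → ℝ, IsTestPair φ φ' →
    ∫ x : Torus, f x * φ' x = -∫ x : Torus, g x * φ x

lemma continuous_of_pullback {φ : Torus → ℝ}
    (h : Continuous (fun x : ℝ => φ (x : Torus))) : Continuous φ :=
  (QuotientAddGroup.isQuotientMap_mk
    (N := AddSubgroup.zmultiples (2 * Real.pi))).continuous_iff.2 h

lemma IsTestPair.continuous {φ φ' : Torus → ℝ} (h : IsTestPair φ φ') :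
    Continuous φ ∧ Continuous φ' := by
  refine ⟨continuous_of_pullback h.1.continuous, continuous_of_pullback ?_⟩
  have : (fun x : ℝ => φ' (x : Torus)) = deriv (fun y : ℝ => φ (y : Torus)) :=
    funext fun x => (h.2 x).deriv.symm
  rw [this]
  exact h.1.continuous_deriv (by simp)

lemma integrable_mul_continuous (f : L2) {φ : Torus → ℝ} (hφ : Continuous φ) :
    Integrable (fun x => f x * φ x) :=
  (Lp.memLp f).integrable_mul
    (hφ.memLp_of_hasCompactSupport (p := 2) (HasCompactSupport.of_compactSpace φ))

lemma IsWeakDeriv.add {f₁ g₁ f₂ g₂ : L2} (h₁ : IsWeakDeriv f₁ g₁) (h₂ : IsWeakDeriv f₂ g₂) :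
    IsWeakDeriv (f₁ + f₂) (g₁ + g₂) := by
  intro φ φ' h
  have e₁ : ∫ x : Torus, (f₁ + f₂ : L2) x * φ' x = ∫ x : Torus, (f₁ x * φ' x + f₂ x * φ' x) :=
    integral_congr_ae (by
      filter_upwards [Lp.coeFn_add f₁ f₂] with x hx
      rw [hx, Pi.add_apply, add_mul])
  have e₂ : ∫ x : Torus, (g₁ + g₂ : L2) x * φ x = ∫ x : Torus, (g₁ x * φ x + g₂ x * φ x) :=
    integral_congr_ae (by
      filter_upwards [Lp.coeFn_add g₁ g₂] with x hx
      rw [hx, Pi.add_apply, add_mul])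
  rw [e₁, e₂, integral_add (integrable_mul_continuous f₁ h.continuous.2)
      (integrable_mul_continuous f₂ h.continuous.2),
    integral_add (integrable_mul_continuous g₁ h.continuous.1)
      (integrable_mul_continuous g₂ h.continuous.1), h₁ φ φ' h, h₂ φ φ' h, neg_add]

lemma IsWeakDeriv.smul {f g : L2} (c : ℝ) (hfg : IsWeakDeriv f g) :
    IsWeakDeriv (c • f) (c • g) := by
  intro φ φ' h
  have e₁ : ∫ x : Torus, (c • f : L2) x * φ' x = ∫ x : Torus, c * (f x * φ' x) :=
    integral_congr_ae (by
      filter_upwards [Lp.coeFn_smul c f] with x hx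
      rw [hx, Pi.smul_apply, smul_eq_mul, mul_assoc])
  have e₂ : ∫ x : Torus, (c • g : L2) x * φ x = ∫ x : Torus, c * (g x * φ x) :=
    integral_congr_ae (by
      filter_upwards [Lp.coeFn_smul c g] with x hx
      rw [hx, Pi.smul_apply, smul_eq_mul, mul_assoc])
  rw [e₁, e₂, integral_const_mul, integral_const_mul, hfg φ φ' h, mul_neg]

lemma IsWeakDeriv.zero : IsWeakDeriv 0 0 := by
  intro φ φ' _
  simp

/-- The Sobolev space `H^k` of the torus. A function `f` is recorded as the tuple
`(f, f', …, f^(k))` of its weak derivatives, all in `L²`; the norm is the usual one,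
`‖f‖² = ‖f‖²_{L²} + ‖f'‖²_{L²} + ⋯ + ‖f^(k)‖²_{L²}`. -/
def Sobolev (k : ℕ) : Submodule ℝ (PiLp 2 (fun _ : Fin (k + 1) => L2)) where
  carrier := {F | ∀ i : Fin k, IsWeakDeriv (F i.castSucc) (F i.succ)}
  add_mem' ha hb i := (ha i).add (hb i)
  zero_mem' _ := IsWeakDeriv.zero
  smul_mem' c _ ha i := (ha i).smul c

/-- The `j`-th weak derivative of `f ∈ H^k`, for `j ≤ k`; `der f 0` is `f` itself. -/
def der {k : ℕ} (f : Sobolev k) (j : Fin (k + 1)) : L2 := f.1 j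

/-- Strict positivity of a function on the torus: it is bounded below, almost everywhere, by
a positive constant. For `f ∈ H^k` with `k ≥ 1`, which is continuous, and the torus being compact,
this says that `f > 0` everywhere. -/
def IsPositive (f : L2) : Prop := ∃ c : ℝ, 0 < c ∧ ∀ᵐ x : Torus, c ≤ f x

/-- `(u, ρ)`, with `u t ∈ H²` and `ρ t ∈ H³`, satisfies for all times `t ≥ 0` the system
`ρ_t + (ρ u)_x = 0`, `(ρ u)_t + (ρ u²)_x = (ρ² u_x)_x`, as equalities in `L²`: time derivatives are
limits of difference quotients in `L²` (one-sided at `t = 0`), space derivatives are weak. -/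
structure IsSolution (u : ℝ → Sobolev 2) (ρ : ℝ → Sobolev 3) : Prop where
  mass : ∃ m m_x : ℝ → L2, ∀ t : ℝ, 0 ≤ t →
    (m t =ᵐ[volume] fun x => der (ρ t) 0 x * der (u t) 0 x) ∧
    IsWeakDeriv (m t) (m_x t) ∧
    HasDerivWithinAt (fun s => der (ρ s) 0) (-m_x t) (Ici 0) t
  momentum : ∃ m p p_x q q_x : ℝ → L2, ∀ t : ℝ, 0 ≤ t →
    (m t =ᵐ[volume] fun x => der (ρ t) 0 x * der (u t) 0 x) ∧
    (p t =ᵐ[volume] fun x => der (ρ t) 0 x * der (u t) 0 x ^ 2) ∧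
    (q t =ᵐ[volume] fun x => der (ρ t) 0 x ^ 2 * der (u t) 1 x) ∧
    IsWeakDeriv (p t) (p_x t) ∧
    IsWeakDeriv (q t) (q_x t) ∧
    HasDerivWithinAt m (-p_x t + q_x t) (Ici 0) t

end PressurelessNS

end

noncomputable section

namespace PressurelessNS

/-! ### Difference calculus on a periodic lattice -/

section Lattice

variable {N : ℕ}

/-- Forward difference quotient with mesh `h`. -/
def fwd (h : ℝ) (f : ZMod N → ℝ) (i : ZMod N) : ℝ := (f (i + 1) - f i) / h

/-- Backward difference quotient with mesh `h`. -/
def bwd (h : ℝ) (f : ZMod N → ℝ) (i : ZMod N) : ℝ := (f i - f (i - 1)) / h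

/-- The discrete Laplacian with mesh `h`. -/
def lap (h : ℝ) (f : ZMod N → ℝ) (i : ZMod N) : ℝ := (f (i + 1) - 2 * f i + f (i - 1)) / h ^ 2

lemma fwd_bwd (h : ℝ) (f : ZMod N → ℝ) : fwd h (bwd h f) = lap h f := by
  ext i
  simp only [fwd, bwd, lap, add_sub_cancel_right]
  rw [← sub_div, div_div, ← pow_two]
  congr 1
  ring

lemma bwd_fwd (h : ℝ) (f : ZMod N → ℝ) : bwd h (fwd h f) = lap h f := by
  ext i
  simp only [fwd, bwd, lap, sub_add_cancel]
  rw [← sub_div, div_div, ← pow_two]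
  congr 1
  ring

lemma fwd_eq_bwd (h : ℝ) (f : ZMod N → ℝ) (i : ZMod N) : fwd h f i = bwd h f (i + 1) := by
  simp [fwd, bwd]

lemma bwd_sub (h : ℝ) (f g : ZMod N → ℝ) (i : ZMod N) :
    bwd h (fun j => f j - g j) i = bwd h f i - bwd h g i := by
  simp only [bwd]
  ring

lemma sub_eq_sum_bwd {h : ℝ} (hh : h ≠ 0) (f : ZMod N → ℝ) (i : ZMod N) (n : ℕ) :
    f (i + n) - f i = h * ∑ k ∈ Finset.range n, bwd h f (i + (k + 1 : ℕ)) := by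
  induction n with
  | zero => simp
  | succ n ih =>
    rw [Finset.sum_range_succ, mul_add, ← ih]
    simp only [bwd]
    rw [mul_div_cancel₀ _ hh]
    push_cast
    rw [show i + ((n : ZMod N) + 1) - 1 = i + n by ring]
    ring

variable [NeZero N]

/-- The square of the discrete `L²` norm. -/
def nsq (h : ℝ) (f : ZMod N → ℝ) : ℝ := h * ∑ i, f i ^ 2

lemma nsq_nonneg {h : ℝ} (hh : 0 ≤ h) (f : ZMod N → ℝ) : 0 ≤ nsq h f :=
  mul_nonneg hh (Finset.sum_nonneg fun _ _ => sq_nonneg _)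

lemma sum_shift (f : ZMod N → ℝ) : ∑ i, f (i + 1) = ∑ i, f i :=
  Equiv.sum_comp (Equiv.addRight (1 : ZMod N)) f

lemma sum_shift_sub (f : ZMod N → ℝ) : ∑ i, f (i - 1) = ∑ i, f i :=
  Equiv.sum_comp (Equiv.subRight (1 : ZMod N)) f

lemma sum_fwd (h : ℝ) (f : ZMod N → ℝ) : ∑ i, fwd h f i = 0 := by
  simp only [fwd, ← Finset.sum_div, Finset.sum_sub_distrib, sum_shift, sub_self, zero_div]

lemma sum_fwd_mul (h : ℝ) (f g : ZMod N → ℝ) :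
    ∑ i, fwd h f i * g i = -∑ i, f i * bwd h g i := by
  have h1 : ∑ i, f (i + 1) * g i = ∑ i, f i * g (i - 1) := by
    rw [← sum_shift (fun i => f i * g (i - 1))]
    simp
  have h2 : ∀ i, fwd h f i * g i = (f (i + 1) * g i - f i * g i) / h := fun i => by
    simp only [fwd]; ring
  have h3 : ∀ i, f i * bwd h g i = (f i * g i - f i * g (i - 1)) / h := fun i => by
    simp only [bwd]; ring
  simp only [h2, h3, ← Finset.sum_div, Finset.sum_sub_distrib, h1]
  ring

lemma sum_bwd_mul (h : ℝ) (f g : ZMod N → ℝ) :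
    ∑ i, bwd h f i * g i = -∑ i, f i * fwd h g i := by
  have := sum_fwd_mul h g f
  simp only [mul_comm (bwd h f _), mul_comm (f _) (fwd h g _)]
  linarith

lemma nsq_fwd (h : ℝ) (f : ZMod N → ℝ) : nsq h (fwd h f) = nsq h (bwd h f) := by
  simp only [nsq, fwd_eq_bwd]
  rw [sum_shift (fun i => bwd h f i ^ 2)]

lemma sum_range_le_sum (g : ZMod N → ℝ) (hg : ∀ i, 0 ≤ g i) (i : ZMod N) {n : ℕ} (hn : n ≤ N) :
    ∑ k ∈ Finset.range n, g (i + (k + 1 : ℕ)) ≤ ∑ j, g j := by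
  have hinj : Set.InjOn (fun k : ℕ => i + ((k + 1 : ℕ) : ZMod N)) (Finset.range n) := by
    intro a ha b hb hab
    have h1 : ((a + 1 : ℕ) : ZMod N) = ((b + 1 : ℕ) : ZMod N) := add_left_cancel hab
    push_cast at h1
    have h2 : (a : ZMod N) = b := add_right_cancel h1
    have ha' := lt_of_lt_of_le (Finset.mem_range.1 ha) hn
    have hb' := lt_of_lt_of_le (Finset.mem_range.1 hb) hn
    have := congrArg ZMod.val h2
    rwa [ZMod.val_cast_of_lt ha', ZMod.val_cast_of_lt hb'] at this
  calc ∑ k ∈ Finset.range n, g (i + (k + 1 : ℕ))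
      = ∑ j ∈ (Finset.range n).image (fun k : ℕ => i + ((k + 1 : ℕ) : ZMod N)), g j :=
        (Finset.sum_image hinj).symm
    _ ≤ ∑ j, g j := Finset.sum_le_sum_of_subset_of_nonneg (Finset.subset_univ _)
        fun j _ _ => hg j

lemma abs_sub_le_sum_bwd {h : ℝ} (hh : 0 < h) (f : ZMod N → ℝ) (i j : ZMod N) :
    |f j - f i| ≤ h * ∑ k, |bwd h f k| := by
  have hj : j = i + ((j - i).val : ℕ) := by simp
  rw [hj, sub_eq_sum_bwd hh.ne', abs_mul, abs_of_pos hh]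
  refine mul_le_mul_of_nonneg_left ?_ hh.le
  exact (Finset.abs_sum_le_sum_abs _ _).trans
    (sum_range_le_sum (fun k => |bwd h f k|) (fun _ => abs_nonneg _) i (ZMod.val_lt _).le)

lemma sq_sub_le_nsq {h : ℝ} (hh : 0 < h) (f : ZMod N → ℝ) (i : ZMod N) {n : ℕ} (hn : n ≤ N) :
    (f (i + n) - f i) ^ 2 ≤ n * h * nsq h (bwd h f) := by
  rw [sub_eq_sum_bwd hh.ne', mul_pow, nsq]
  have h1 := sq_sum_le_card_mul_sum_sq (s := Finset.range n)
    (f := fun k : ℕ => bwd h f (i + (k + 1 : ℕ)))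
  have h2 := sum_range_le_sum (fun k => bwd h f k ^ 2) (fun _ => sq_nonneg _) i hn
  rw [Finset.card_range] at h1
  calc h ^ 2 * (∑ k ∈ Finset.range n, bwd h f (i + (k + 1 : ℕ))) ^ 2
      ≤ h ^ 2 * (n * ∑ k, bwd h f k ^ 2) := by
        refine mul_le_mul_of_nonneg_left (h1.trans ?_) (sq_nonneg h)
        exact mul_le_mul_of_nonneg_left h2 (Nat.cast_nonneg n)
    _ = n * h * (h * ∑ k, bwd h f k ^ 2) := by ring

lemma sq_sub_le_length_mul_nsq {h : ℝ} (hh : 0 < h) (f : ZMod N → ℝ) (i j : ZMod N) :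
    (f j - f i) ^ 2 ≤ N * h * nsq h (bwd h f) := by
  have hj : j = i + ((j - i).val : ℕ) := by simp
  have hlt : (j - i).val ≤ N := (ZMod.val_lt _).le
  calc (f j - f i) ^ 2 = (f (i + ((j - i).val : ℕ)) - f i) ^ 2 := by rw [← hj]
    _ ≤ (j - i).val * h * nsq h (bwd h f) := sq_sub_le_nsq hh f i hlt
    _ ≤ N * h * nsq h (bwd h f) := by
      have : ((j - i).val : ℝ) ≤ N := by exact_mod_cast hlt
      exact mul_le_mul_of_nonneg_right (mul_le_mul_of_nonneg_right this hh.le)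
        (nsq_nonneg hh.le _)

lemma sum_mul_sq_le_nsq (h : ℝ) (f g : ZMod N → ℝ) :
    (h * ∑ i, |f i * g i|) ^ 2 ≤ nsq h f * nsq h g := by
  have := Finset.sum_mul_sq_le_sq_mul_sq Finset.univ (fun i => |f i|) (fun i => |g i|)
  simp only [sq_abs, ← abs_mul] at this
  calc (h * ∑ i, |f i * g i|) ^ 2 = h ^ 2 * (∑ i, |f i * g i|) ^ 2 := by ring
    _ ≤ h ^ 2 * ((∑ i, f i ^ 2) * ∑ i, g i ^ 2) := mul_le_mul_of_nonneg_left this (sq_nonneg h)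
    _ = nsq h f * nsq h g := by simp only [nsq]; ring

lemma card_zmod_univ : (Finset.univ : Finset (ZMod N)).card = N := by
  rw [Finset.card_univ, ZMod.card]

/-- A discrete interpolation inequality of Agmon type. -/
lemma sq_le_agmon {h : ℝ} (hh : 0 < h) (f : ZMod N → ℝ) (i : ZMod N) :
    f i ^ 2 ≤ nsq h f / (N * h) + 2 * √(nsq h f * nsq h (bwd h f)) := by
  have hN : (0 : ℝ) < N := by exact_mod_cast Nat.pos_of_ne_zero (NeZero.ne N)
  obtain ⟨j, -, hj⟩ : ∃ j ∈ (Finset.univ : Finset (ZMod N)), f j ^ 2 ≤ nsq h f / (N * h) := by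
    refine Finset.exists_le_of_sum_le Finset.univ_nonempty ?_
    rw [Finset.sum_const, card_zmod_univ, nsmul_eq_mul, nsq]
    apply le_of_eq
    field_simp
  have h1 := abs_sub_le_sum_bwd hh (fun k => f k ^ 2) j i
  have h2 : ∀ k, |bwd h (fun k => f k ^ 2) k| ≤ |f k * bwd h f k| + |f (k - 1) * bwd h f k| := by
    intro k
    refine le_trans (le_of_eq ?_) (abs_add_le _ _)
    congr 1
    simp only [bwd]
    ring
  have h3 : h * ∑ k, |f k * bwd h f k| ≤ √(nsq h f * nsq h (bwd h f)) :=
    Real.le_sqrt_of_sq_le (sum_mul_sq_le_nsq h _ _)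
  have h4 : h * ∑ k, |f (k - 1) * bwd h f k| ≤ √(nsq h f * nsq h (bwd h f)) := by
    refine Real.le_sqrt_of_sq_le ((sum_mul_sq_le_nsq h (fun k => f (k - 1)) _).trans ?_)
    apply le_of_eq
    congr 1
    simp only [nsq]
    rw [sum_shift_sub (fun k => f k ^ 2)]
  have h5 : h * ∑ k, |bwd h (fun k => f k ^ 2) k| ≤ 2 * √(nsq h f * nsq h (bwd h f)) := by
    calc h * ∑ k, |bwd h (fun k => f k ^ 2) k|
        ≤ h * ∑ k, (|f k * bwd h f k| + |f (k - 1) * bwd h f k|) :=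
          mul_le_mul_of_nonneg_left (Finset.sum_le_sum fun k _ => h2 k) hh.le
      _ ≤ _ := by rw [Finset.sum_add_distrib, mul_add]; linarith
  have h6 := le_abs_self (f i ^ 2 - f j ^ 2)
  linarith

/-- A lattice function taking both signs is controlled by its difference quotient. -/
lemma sq_le_of_sum_eq_zero {h : ℝ} (hh : 0 < h) (f w c : ZMod N → ℝ) (hc : ∀ i, 0 < c i)
    (hf : ∀ i, f i = c i * w i) (hw : ∑ i, w i = 0) (i : ZMod N) :
    f i ^ 2 ≤ N * h * nsq h (bwd h f) := by
  have hle : ∃ j, f j ≤ 0 := by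
    by_contra! hcon
    have : 0 < ∑ i, w i := Finset.sum_pos (fun j _ => by
      have := hcon j
      rw [hf] at this
      exact pos_of_mul_pos_right this (hc j).le) Finset.univ_nonempty
    linarith
  have hge : ∃ j, 0 ≤ f j := by
    by_contra! hcon
    have : ∑ i, w i < 0 := Finset.sum_neg (fun j _ => by
      have := hcon j
      rw [hf] at this
      by_contra! h0
      exact absurd (mul_nonneg (hc j).le h0) (not_le.2 this)) Finset.univ_nonempty
    linarith
  rcases le_total 0 (f i) with h0 | h0
  · obtain ⟨j, hj⟩ := hle
    exact le_trans (by nlinarith) (sq_sub_le_length_mul_nsq hh f j i)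
  · obtain ⟨j, hj⟩ := hge
    exact le_trans (by nlinarith) (sq_sub_le_length_mul_nsq hh f j i)

end Lattice

/-! ### The semi-discrete system -/

/-- A maximum principle for finite systems of differential inequalities. -/
lemma le_of_deriv_le_at_max {ι : Type*} [Fintype ι] [Nonempty ι] {T G C : ℝ} {x x' : ℝ → ι → ℝ}
    (hx : ∀ t ∈ Icc 0 T, ∀ i, HasDerivAt (fun s => x s i) (x' t i) t)
    (hmax : ∀ t ∈ Icc 0 T, ∀ i, (∀ j, x t j ≤ x t i) → x' t i ≤ G)
    (h0 : ∀ i, x 0 i ≤ C) : ∀ t ∈ Icc 0 T, ∀ i, x t i ≤ C + G * t := by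
  set f : ℝ → ℝ := fun t => Finset.univ.sup' Finset.univ_nonempty (x t) with hf
  have hle : ∀ t i, x t i ≤ f t := fun t i => Finset.le_sup' (x t) (Finset.mem_univ i)
  have hcont : ContinuousOn f (Icc 0 T) := by
    have : ContinuousOn (fun t => Finset.univ.sup' Finset.univ_nonempty
        (fun i => x t i)) (Icc 0 T) :=
      ContinuousOn.finset_sup'_apply _ fun i _ t ht =>
        (hx t ht i).continuousAt.continuousWithinAt
    exact this
  have key : ∀ ⦃t⦄, t ∈ Icc 0 T → f t ≤ C + G * t := by
    refine image_le_of_liminf_slope_right_le_deriv_boundary (B' := fun _ => G) hcont ?_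
      (by fun_prop) ?_ ?_
    · simp only [mul_zero, add_zero, hf]
      exact Finset.sup'_le _ _ fun i _ => h0 i
    · intro t _
      simpa using (((hasDerivAt_id t).const_mul G).const_add C).hasDerivWithinAt
    · intro t ht r hr
      have htT : t ∈ Icc 0 T := ⟨ht.1, ht.2.le⟩
      refine Eventually.frequently ?_
      have hall : ∀ᶠ z in 𝓝[>] t, ∀ i, x z i < f t + r * (z - t) := by
        rw [eventually_all]
        intro i
        rcases (hle t i).lt_or_eq with hlt | heq
        · have h1 : ContinuousAt (fun z => f t + r * (z - t) - x z i) t := by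
            have := (hx t htT i).continuousAt
            fun_prop
          have h2 : ∀ᶠ z in 𝓝 t, 0 < f t + r * (z - t) - x z i :=
            h1.eventually_const_lt (by simpa using hlt)
          filter_upwards [nhdsWithin_le_nhds h2] with z hz
          linarith
        · have hG : x' t i ≤ G := hmax t htT i fun j => heq ▸ hle t j
          have h1 := (hx t htT i).hasDerivWithinAt (s := Ioi t)
          rw [hasDerivWithinAt_iff_tendsto_slope' self_notMem_Ioi] at h1
          filter_upwards [h1.eventually_lt_const (hG.trans_lt hr), self_mem_nhdsWithin] with z hz hz'
          have hz' : t < z := hz'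
          rw [slope_def_field, div_lt_iff₀ (by linarith)] at hz
          rw [← heq]
          linarith
      filter_upwards [hall, self_mem_nhdsWithin] with z hz hz'
      have hz' : t < z := hz'
      rw [slope_def_field, div_lt_iff₀ (by linarith)]
      have : f z < f t + r * (z - t) := by
        simp only [hf]
        exact (Finset.sup'_lt_iff _).2 fun i _ => hz i
      linarith
  exact fun t ht i => (hle t i).trans (key ht)

/-- The function `x ↦ 1 / (2 x²)`, modified below `a` to be bounded and continuously
differentiable on the line. -/
def truncF (a x : ℝ) : ℝ :=
  if a ≤ x then 1 / (2 * x ^ 2) else 1 / (2 * a ^ 2) + (a - x) / (a ^ 3 * (1 + (a - x)))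

/-- Minus the derivative of `truncF a`. -/
def truncK (a x : ℝ) : ℝ :=
  if a ≤ x then 1 / x ^ 3 else 1 / (a ^ 3 * (1 + (a - x)) ^ 2)

lemma truncK_nonneg {a : ℝ} (ha : 0 < a) (x : ℝ) : 0 ≤ truncK a x := by
  unfold truncK
  split_ifs with h
  · have : 0 < x := ha.trans_le h
    positivity
  · positivity

lemma truncK_le {a : ℝ} (ha : 0 < a) (x : ℝ) : truncK a x ≤ 1 / a ^ 3 := by
  unfold truncK
  split_ifs with h
  · exact one_div_le_one_div_of_le (by positivity) (by gcongr)
  · have : 0 ≤ a - x := by linarith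
    refine one_div_le_one_div_of_le (by positivity) (le_mul_of_one_le_right (by positivity) ?_)
    nlinarith

lemma hasDerivAt_truncF {a : ℝ} (ha : 0 < a) (x : ℝ) :
    HasDerivAt (truncF a) (-truncK a x) x := by
  have hR : ∀ y, 0 < y → HasDerivAt (fun y : ℝ => 1 / (2 * y ^ 2)) (-(1 / y ^ 3)) y := by
    intro y hy
    have h1 : HasDerivAt (fun y : ℝ => 2 * y ^ 2) (2 * (2 * y)) y := by
      simpa using (hasDerivAt_pow 2 y).const_mul 2
    have h2 := h1.fun_inv (by positivity)
    simp only [one_div]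
    exact h2.congr_deriv (by field_simp)
  have hL : ∀ y, y ≤ a → HasDerivAt
      (fun y : ℝ => 1 / (2 * a ^ 2) + (a - y) / (a ^ 3 * (1 + (a - y))))
      (-(1 / (a ^ 3 * (1 + (a - y)) ^ 2))) y := by
    intro y hy
    have hy' : 0 < 1 + (a - y) := by linarith
    have h1 : HasDerivAt (fun y : ℝ => a - y) (-1) y := by
      simpa using (hasDerivAt_id y).const_sub a
    have h2 : HasDerivAt (fun y : ℝ => a ^ 3 * (1 + (a - y))) (a ^ 3 * (-1)) y :=
      (h1.const_add 1).const_mul _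
    have h3 := (h1.fun_div h2 (by positivity)).const_add (1 / (2 * a ^ 2))
    exact h3.congr_deriv (by field_simp; ring)
  rcases lt_trichotomy x a with h | h | h
  · have h1 := hL x h.le
    simp only [truncK, not_le.2 h, if_false]
    refine h1.congr_of_eventuallyEq ?_
    filter_upwards [Iio_mem_nhds h] with y hy
    have hy : y < a := hy
    simp [truncF, not_le.2 hy]
  · subst h
    have hk : truncK x x = 1 / x ^ 3 := by simp [truncK]
    rw [hk]
    have h1 : HasDerivWithinAt (truncF x) (-(1 / x ^ 3)) (Ici x) x :=
      (hR x ha).hasDerivWithinAt.congr (fun y hy => by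
        have hy : x ≤ y := hy
        simp [truncF, hy]) (by simp [truncF])
    have h2 : HasDerivWithinAt (truncF x) (-(1 / x ^ 3)) (Iic x) x := by
      have := (hL x le_rfl).hasDerivWithinAt (s := Iic x)
      simp only [sub_self, add_zero, one_pow, mul_one] at this
      refine this.congr (fun y hy => ?_) (by simp [truncF])
      rcases (show y ≤ x from hy).lt_or_eq with hlt | rfl
      · simp [truncF, not_le.2 hlt]
      · simp [truncF]
    have := h2.union h1
    rwa [Iic_union_Ici, hasDerivWithinAt_univ] at this
  · simp only [truncK, h.le, if_true]
    refine (hR x (ha.trans h)).congr_of_eventuallyEq ?_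
    filter_upwards [Ioi_mem_nhds h] with y hy
    have hy : a < y := hy
    simp [truncF, hy.le]

lemma antitone_truncF {a : ℝ} (ha : 0 < a) : Antitone (truncF a) :=
  antitone_of_deriv_nonpos (fun x => (hasDerivAt_truncF ha x).differentiableAt) fun x => by
    rw [(hasDerivAt_truncF ha x).deriv]
    linarith [truncK_nonneg ha x]

lemma abs_truncF_sub_le {a : ℝ} (ha : 0 < a) (x y : ℝ) :
    |truncF a x - truncF a y| ≤ 1 / a ^ 3 * |x - y| := by
  have := Convex.norm_image_sub_le_of_norm_hasDerivWithin_le (f := truncF a)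
    (f' := fun x => -truncK a x) (C := 1 / a ^ 3) (s := univ) (x := y) (y := x)
    (fun x _ => (hasDerivAt_truncF ha x).hasDerivWithinAt) (fun x _ => by
      rw [norm_neg, Real.norm_eq_abs, abs_of_nonneg (truncK_nonneg ha x)]
      exact truncK_le ha x) convex_univ (mem_univ _) (mem_univ _)
  simpa using this

lemma abs_truncF_le {a : ℝ} (ha : 0 < a) (x : ℝ) :
    |truncF a x| ≤ 1 / (2 * a ^ 2) + 1 / a ^ 3 := by
  unfold truncF
  split_ifs with h
  · have hx : 0 < x := ha.trans_le h
    rw [abs_of_pos (by positivity)]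
    have : 1 / (2 * x ^ 2) ≤ 1 / (2 * a ^ 2) :=
      one_div_le_one_div_of_le (by positivity) (by gcongr)
    have : 0 < 1 / a ^ 3 := by positivity
    linarith
  · have hx : 0 < a - x := by linarith
    rw [abs_of_pos (by positivity)]
    refine add_le_add_right ?_ _
    rw [div_le_div_iff₀ (by positivity) (by positivity)]
    nlinarith [pow_pos ha 3]

lemma le_of_truncF_le {a x : ℝ} (ha : 0 < a) (h : truncF a x ≤ 1 / (2 * a ^ 2)) : a ≤ x := by
  by_contra hx
  have hx' : 0 < a - x := by linarith
  simp only [truncF, hx, if_false] at h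
  have : 0 < (a - x) / (a ^ 3 * (1 + (a - x))) := by positivity
  linarith

variable {N : ℕ}

/-- The semi-discrete system in mass coordinates, on the time interval `[0, T]`. -/
structure IsLatticeFlow (h T : ℝ) (V : ZMod N → ℝ) (τ u : ℝ → ZMod N → ℝ) : Prop where
  pos : ∀ t ∈ Icc 0 T, ∀ i, 0 < τ t i
  vel : ∀ t ∈ Icc 0 T, ∀ i, u t i = V i - bwd h (fun j => 1 / (2 * τ t j ^ 2)) i
  dτ : ∀ t ∈ Icc 0 T, ∀ i, HasDerivAt (fun s => τ s i) (fwd h (u t) i) t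
  du : ∀ t ∈ Icc 0 T, ∀ i,
    HasDerivAt (fun s => u s i) (bwd h (fun j => fwd h (u t) j / τ t j ^ 3) i) t

lemma abs_lap_le {h C : ℝ} (f : ZMod N → ℝ) (hf : ∀ i, |f i| ≤ C) (i : ZMod N) :
    |lap h f i| ≤ 4 * C / h ^ 2 := by
  rw [lap, abs_div, abs_of_nonneg (sq_nonneg h)]
  refine div_le_div_of_nonneg_right ?_ (sq_nonneg h)
  have h1 := abs_le.1 (hf (i + 1))
  have h2 := abs_le.1 (hf i)
  have h3 := abs_le.1 (hf (i - 1))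
  rw [abs_le]
  constructor <;> linarith

lemma fwd_sub_bwd (h : ℝ) (V f : ZMod N → ℝ) (i : ZMod N) :
    fwd h (fun j => V j - bwd h f j) i = fwd h V i - lap h f i := by
  rw [← fwd_bwd]
  simp only [fwd]
  ring

variable [NeZero N]

lemma exists_truncated_flow {h T a : ℝ} (hT : 0 ≤ T) (ha : 0 < a)
    (V τ₀ : ZMod N → ℝ) :
    ∃ τ : ℝ → ZMod N → ℝ, τ 0 = τ₀ ∧ ∀ t ∈ Icc 0 T, ∀ i, HasDerivAt (fun s => τ s i)
      (fwd h V i - lap h (fun j => truncF a (τ t j)) i) t := by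
  set Φ : (ZMod N → ℝ) → ZMod N → ℝ :=
    fun x i => fwd h V i - lap h (fun j => truncF a (x j)) i with hΦ
  set Bd : ℝ := ‖fwd h V‖ + 4 * (1 / (2 * a ^ 2) + 1 / a ^ 3) / h ^ 2 with hBd
  have hBd0 : 0 ≤ Bd := by positivity
  have hb : ∀ x, ‖Φ x‖ ≤ Bd := by
    intro x
    rw [pi_norm_le_iff_of_nonneg hBd0]
    intro i
    calc ‖Φ x i‖ ≤ ‖fwd h V i‖ + ‖lap h (fun j => truncF a (x j)) i‖ := norm_sub_le _ _
      _ ≤ Bd := add_le_add (norm_le_pi_norm _ i)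
          (abs_lap_le _ (fun j => abs_truncF_le ha (x j)) i)
  have hlip : LipschitzWith (Real.toNNReal (4 * (1 / a ^ 3) / h ^ 2)) Φ := by
    refine LipschitzWith.of_dist_le_mul fun x y => ?_
    rw [Real.coe_toNNReal _ (by positivity)]
    rw [dist_eq_norm, pi_norm_le_iff_of_nonneg (by positivity)]
    intro i
    have h1 : (Φ x - Φ y) i = -lap h (fun j => truncF a (x j) - truncF a (y j)) i := by
      simp only [hΦ, Pi.sub_apply, lap]
      ring
    rw [h1, norm_neg]
    refine (abs_lap_le (C := 1 / a ^ 3 * dist x y) _ (fun j => ?_) i).trans (le_of_eq (by ring))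
    refine (abs_truncF_sub_le ha _ _).trans ?_
    have : |x j - y j| ≤ dist x y := by
      rw [← Real.dist_eq]
      exact dist_le_pi_dist x y j
    gcongr
  have hpl : IsPicardLindelof (fun _ => Φ) (tmin := -1) (tmax := T + 1)
      ⟨0, by constructor <;> linarith⟩ τ₀ (Real.toNNReal (Bd * (T + 1))) 0 (Real.toNNReal Bd)
      (Real.toNNReal (4 * (1 / a ^ 3) / h ^ 2)) := by
    refine IsPicardLindelof.of_time_independent (fun x _ => ?_) hlip.lipschitzOnWith ?_
    · rw [Real.coe_toNNReal _ hBd0]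
      exact hb x
    · rw [Real.coe_toNNReal _ hBd0, Real.coe_toNNReal _ (by positivity)]
      simp only [sub_zero, zero_sub, neg_neg, NNReal.coe_zero]
      rw [max_eq_left (by linarith)]
  obtain ⟨α, hα0, hα⟩ := hpl.exists_eq_forall_mem_Icc_hasDerivWithinAt₀
  refine ⟨α, hα0, fun t ht i => ?_⟩
  have h1 := (hα t ⟨by linarith [ht.1], by linarith [ht.2]⟩).hasDerivAt
    (Icc_mem_nhds (by linarith [ht.1]) (by linarith [ht.2]))
  exact (hasDerivAt_pi.1 h1) i

/-- Global solvability of the semi-discrete system, with pointwise bounds. -/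
theorem exists_latticeFlow {h T a b m K U G : ℝ} (hh : 0 < h) (hT : 0 ≤ T) (ha : 0 < a)
    (ham : a ≤ m) (V τ₀ u₀ : ZMod N → ℝ)
    (hV : ∀ i, u₀ i = V i - bwd h (fun j => 1 / (2 * τ₀ j ^ 2)) i)
    (hK : ∀ i, |V i| + U ≤ K) (haK : 1 / (2 * m ^ 2) + N * h * K ≤ 1 / (2 * a ^ 2))
    (hm : ∀ i, m ≤ τ₀ i) (hb : ∀ i, τ₀ i ≤ b) (hU : ∀ i, |u₀ i| ≤ U)
    (hG : ∀ i, fwd h V i ≤ G) :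
    ∃ τ u : ℝ → ZMod N → ℝ, IsLatticeFlow h T V τ u ∧ τ 0 = τ₀ ∧ u 0 = u₀ ∧
      ∀ t ∈ Icc 0 T, ∀ i, a ≤ τ t i ∧ τ t i ≤ b + G * t ∧ |u t i| ≤ U := by
  obtain ⟨τ, hτ0, hτ⟩ := exists_truncated_flow (h := h) hT ha V τ₀
  set F : ℝ → ZMod N → ℝ := fun t j => truncF a (τ t j) with hF
  set u : ℝ → ZMod N → ℝ := fun t i => V i - bwd h (F t) i with hu
  have hdτ : ∀ t ∈ Icc 0 T, ∀ i, HasDerivAt (fun s => τ s i) (fwd h (u t) i) t := by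
    intro t ht i
    rw [hu, fwd_sub_bwd]
    exact hτ t ht i
  have hdF : ∀ t ∈ Icc 0 T, ∀ i,
      HasDerivAt (fun s => F s i) (-(truncK a (τ t i) * fwd h (u t) i)) t := by
    intro t ht i
    rw [← neg_mul]
    exact (hasDerivAt_truncF ha (τ t i)).comp t (hdτ t ht i)
  have hdu : ∀ t ∈ Icc 0 T, ∀ i, HasDerivAt (fun s => u s i)
      (bwd h (fun j => truncK a (τ t j) * fwd h (u t) j) i) t := by
    intro t ht i
    have h1 := (((hdF t ht i).fun_sub (hdF t ht (i - 1))).div_const h).const_sub (V i)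
    exact h1.congr_deriv (by simp only [bwd]; ring)
  have hF0 : F 0 = fun j => 1 / (2 * τ₀ j ^ 2) := by
    ext j
    simp [hF, hτ0, truncF, ham.trans (hm j)]
  have hu0 : u 0 = u₀ := by
    ext i
    rw [hV i, ← hF0]
  have hu_le : ∀ t ∈ Icc 0 T, ∀ i, u t i ≤ U + 0 * t := by
    refine le_of_deriv_le_at_max hdu (fun t ht i hi => ?_) fun i => ?_
    · have h1 : fwd h (u t) i ≤ 0 := div_nonpos_of_nonpos_of_nonneg (by linarith [hi (i + 1)]) hh.le
      have h2 : 0 ≤ fwd h (u t) (i - 1) := by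
        refine div_nonneg ?_ hh.le
        rw [sub_add_cancel]
        linarith [hi (i - 1)]
      refine div_nonpos_of_nonpos_of_nonneg ?_ hh.le
      have h3 := mul_nonneg (truncK_nonneg ha (τ t (i - 1))) h2
      have h4 := mul_nonpos_of_nonneg_of_nonpos (truncK_nonneg ha (τ t i)) h1
      linarith
    · rw [hu0]
      exact (abs_le.1 (hU i)).2
  have hu_ge : ∀ t ∈ Icc 0 T, ∀ i, -u t i ≤ U + 0 * t := by
    refine le_of_deriv_le_at_max (x := fun t i => -u t i) (fun t ht i => (hdu t ht i).neg)
      (fun t ht i hi => ?_) fun i => ?_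
    · have h1 : 0 ≤ fwd h (u t) i := div_nonneg (by linarith [hi (i + 1)]) hh.le
      have h2 : fwd h (u t) (i - 1) ≤ 0 := by
        refine div_nonpos_of_nonpos_of_nonneg ?_ hh.le
        rw [sub_add_cancel]
        linarith [hi (i - 1)]
      refine neg_nonpos.2 (div_nonneg ?_ hh.le)
      have h3 := mul_nonneg (truncK_nonneg ha (τ t i)) h1
      have h4 := mul_nonpos_of_nonneg_of_nonpos (truncK_nonneg ha (τ t (i - 1))) h2
      linarith
    · simp only [hu0]
      linarith [(abs_le.1 (hU i)).1]
  have huU : ∀ t ∈ Icc 0 T, ∀ i, |u t i| ≤ U := by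
    intro t ht i
    have h1 := hu_le t ht i
    have h2 := hu_ge t ht i
    rw [abs_le]
    constructor <;> linarith
  have hmean : ∀ t ∈ Icc 0 T, ∑ i, τ t i = ∑ i, τ₀ i := by
    have hd : ∀ t ∈ Icc 0 T, HasDerivAt (fun s => ∑ i, τ s i) 0 t := by
      intro t ht
      have := HasDerivAt.fun_sum (u := Finset.univ) fun i _ => hdτ t ht i
      rwa [sum_fwd] at this
    intro t ht
    have := constant_of_has_deriv_right_zero (a := 0) (b := T) (f := fun s => ∑ i, τ s i)
      (fun s hs => (hd s hs).continuousAt.continuousWithinAt)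
      (fun s hs => (hd s ⟨hs.1, hs.2.le⟩).hasDerivWithinAt) t ht
    simpa [hτ0] using this
  have hlow : ∀ t ∈ Icc 0 T, ∀ i, a ≤ τ t i := by
    intro t ht i
    obtain ⟨j, -, hj⟩ : ∃ j ∈ (Finset.univ : Finset (ZMod N)), m ≤ τ t j := by
      refine Finset.exists_le_of_sum_le (f := fun _ => m) Finset.univ_nonempty ?_
      rw [hmean t ht]
      exact Finset.sum_le_sum fun i _ => hm i
    have h1 := abs_sub_le_sum_bwd hh (F t) j i
    have h2 : ∑ k, |bwd h (F t) k| ≤ N * K := by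
      calc ∑ k, |bwd h (F t) k| ≤ ∑ _k : ZMod N, K := by
            refine Finset.sum_le_sum fun k _ => ?_
            have : bwd h (F t) k = V k - u t k := by simp [hu]
            rw [this]
            exact ((abs_sub _ _).trans (add_le_add_right (huU t ht k) _)).trans (hK k)
        _ = N * K := by rw [Finset.sum_const, card_zmod_univ, nsmul_eq_mul]
    have h3 : F t j ≤ 1 / (2 * m ^ 2) := by
      refine (antitone_truncF ha hj).trans (le_of_eq ?_)
      simp [truncF, ham]
    have h4 := mul_le_mul_of_nonneg_left h2 hh.le
    refine le_of_truncF_le ha ?_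
    have h5 := (abs_le.1 h1).2
    have : F t i ≤ 1 / (2 * a ^ 2) := by nlinarith
    exact this
  have hup : ∀ t ∈ Icc 0 T, ∀ i, τ t i ≤ b + G * t := by
    refine le_of_deriv_le_at_max hτ (fun t ht i hi => ?_) fun i => by rw [hτ0]; exact hb i
    have h1 : 0 ≤ lap h (fun j => truncF a (τ t j)) i := by
      refine div_nonneg ?_ (sq_nonneg h)
      have h1 := antitone_truncF ha (hi (i + 1))
      have h2 := antitone_truncF ha (hi (i - 1))
      linarith
    linarith [hG i]
  have hFeq : ∀ t ∈ Icc 0 T, F t = fun j => 1 / (2 * τ t j ^ 2) := by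
    intro t ht
    ext j
    simp [hF, truncF, hlow t ht j]
  refine ⟨τ, u, ⟨fun t ht i => ha.trans_le (hlow t ht i), fun t ht i => ?_, hdτ,
    fun t ht i => ?_⟩, hτ0, hu0, fun t ht i => ⟨hlow t ht i, hup t ht i, huU t ht i⟩⟩
  · rw [← hFeq t ht]
  · have h1 := hdu t ht i
    convert h1 using 3 with j
    simp only [truncK, hlow t ht j, if_true]
    ring

/-! ### Uniform estimates for the semi-discrete system -/

variable {N : ℕ}

/-- The flux `u_y / τ³` of the semi-discrete system. -/
def flux (h : ℝ) (τ u : ℝ → ZMod N → ℝ) (t : ℝ) (i : ZMod N) : ℝ := fwd h (u t) i / τ t i ^ 3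

lemma lap_mul {h : ℝ} (f g : ZMod N → ℝ) (i : ZMod N) :
    lap h (fun j => f j * g j) i =
      f i * lap h g i + g i * lap h f i + fwd h f i * fwd h g i + bwd h f i * bwd h g i := by
  simp only [lap, fwd, bwd]
  ring

/-- Difference quotients of the specific volume are controlled by those of `1 / (2 τ²)`. -/
lemma abs_bwd_le {h a b K : ℝ} (hh : 0 < h) (ha : 0 < a) (r : ZMod N → ℝ)
    (hr : ∀ i, a ≤ r i ∧ r i ≤ b) (i : ZMod N) (hK : |bwd h (fun j => 1 / (2 * r j ^ 2)) i| ≤ K) :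
    |bwd h r i| ≤ b ^ 3 * K := by
  have hx : 0 < r i := ha.trans_le (hr i).1
  have hy : 0 < r (i - 1) := ha.trans_le (hr (i - 1)).1
  set x := r i
  set y := r (i - 1)
  have hb : 0 < b := hx.trans_le (hr i).2
  have e : bwd h (fun j => 1 / (2 * r j ^ 2)) i =
      -(bwd h r i * ((1 / (x * y ^ 2) + 1 / (x ^ 2 * y)) / 2)) := by
    change (1 / (2 * x ^ 2) - 1 / (2 * y ^ 2)) / h = -((x - y) / h * _)
    field_simp
    ring
  have hxy : 1 / b ^ 3 ≤ (1 / (x * y ^ 2) + 1 / (x ^ 2 * y)) / 2 := by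
    have hxb := (hr i).2
    have hyb := (hr (i - 1)).2
    have h1 : 1 / b ^ 3 ≤ 1 / (x * y ^ 2) := by
      refine one_div_le_one_div_of_le (by positivity) ?_
      calc x * y ^ 2 ≤ b * b ^ 2 := by gcongr
        _ = b ^ 3 := by ring
    have h2 : 1 / b ^ 3 ≤ 1 / (x ^ 2 * y) := by
      refine one_div_le_one_div_of_le (by positivity) ?_
      calc x ^ 2 * y ≤ b ^ 2 * b := by gcongr
        _ = b ^ 3 := by ring
    linarith
  rw [e, abs_neg, abs_mul, abs_of_nonneg (by positivity : 0 ≤ (1 / (x * y ^ 2) + 1 / (x ^ 2 * y)) / 2)]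
    at hK
  have h3 : |bwd h r i| * (1 / b ^ 3) ≤ K := (mul_le_mul_of_nonneg_left hxy (abs_nonneg _)).trans hK
  rw [mul_one_div, div_le_iff₀ (by positivity)] at h3
  linarith

lemma abs_lap_le_of_inv_sq {h a b L G : ℝ} (hh : 0 < h) (ha : 0 < a) (r : ZMod N → ℝ)
    (hr : ∀ i, a ≤ r i ∧ r i ≤ b) (hL : ∀ i, |bwd h r i| ≤ L) (i : ZMod N)
    (hG : |lap h (fun j => 1 / (2 * r j ^ 2)) i| ≤ G) :
    |lap h r i| ≤ b ^ 3 * (G + 3 * b * L ^ 2 / a ^ 5) := by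
  have hx : 0 < r i := ha.trans_le (hr i).1
  have hp : 0 < r (i + 1) := ha.trans_le (hr (i + 1)).1
  have hm : 0 < r (i - 1) := ha.trans_le (hr (i - 1)).1
  have hb : 0 < b := hx.trans_le (hr i).2
  have hbd : ∀ s d : ℝ, a ≤ s → s ≤ b → |d| ≤ L →
      |d ^ 2 * (r i + 2 * s) / (2 * r i ^ 3 * s ^ 2)| ≤ 3 * b * L ^ 2 / a ^ 5 / 2 := by
    intro s d h1 h2 h3
    have hs : 0 < s := ha.trans_le h1
    rw [abs_of_nonneg (by positivity)]
    have e1 : d ^ 2 ≤ L ^ 2 := sq_le_sq' (by linarith [(abs_le.1 h3).1]) (abs_le.1 h3).2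
    calc d ^ 2 * (r i + 2 * s) / (2 * r i ^ 3 * s ^ 2)
        ≤ L ^ 2 * (b + 2 * b) / (2 * a ^ 3 * a ^ 2) := by
          have := hr i
          gcongr
          · exact this.2
          · exact this.1
      _ = 3 * b * L ^ 2 / a ^ 5 / 2 := by field_simp; ring
  have e : lap h r i = r i ^ 3 * (-lap h (fun j => 1 / (2 * r j ^ 2)) i +
      fwd h r i ^ 2 * (r i + 2 * r (i + 1)) / (2 * r i ^ 3 * r (i + 1) ^ 2) +
      bwd h r i ^ 2 * (r i + 2 * r (i - 1)) / (2 * r i ^ 3 * r (i - 1) ^ 2)) := by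
    simp only [lap, fwd, bwd]
    field_simp
    ring
  have h1 := hbd (r (i + 1)) (fwd h r i) (hr (i + 1)).1 (hr (i + 1)).2
    (by rw [fwd_eq_bwd]; exact hL _)
  have h2 := hbd (r (i - 1)) (bwd h r i) (hr (i - 1)).1 (hr (i - 1)).2 (hL _)
  rw [e, abs_mul, abs_of_pos (by positivity : 0 < r i ^ 3)]
  have h3 := (hr i).2
  have h4 : |-lap h (fun j => 1 / (2 * r j ^ 2)) i +
      fwd h r i ^ 2 * (r i + 2 * r (i + 1)) / (2 * r i ^ 3 * r (i + 1) ^ 2) +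
      bwd h r i ^ 2 * (r i + 2 * r (i - 1)) / (2 * r i ^ 3 * r (i - 1) ^ 2)| ≤
      G + 3 * b * L ^ 2 / a ^ 5 := by
    refine (abs_add_three _ _ _).trans ?_
    rw [abs_neg]
    linarith
  gcongr

/-- Bounds on the difference quotients of a product. -/
lemma abs_diff_mul_le {h A B A₁ B₁ A₂ B₂ : ℝ} (f g : ZMod N → ℝ)
    (hf : ∀ i, |f i| ≤ A) (hg : ∀ i, |g i| ≤ B) (hf₁ : ∀ i, |bwd h f i| ≤ A₁)
    (hg₁ : ∀ i, |bwd h g i| ≤ B₁) (hf₂ : ∀ i, |lap h f i| ≤ A₂) (hg₂ : ∀ i, |lap h g i| ≤ B₂) :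
    (∀ i, |bwd h (fun j => f j * g j) i| ≤ A * B₁ + B * A₁) ∧
      ∀ i, |lap h (fun j => f j * g j) i| ≤ A * B₂ + B * A₂ + 2 * (A₁ * B₁) := by
  have hA : 0 ≤ A := (abs_nonneg _).trans (hf 0)
  have hB : 0 ≤ B := (abs_nonneg _).trans (hg 0)
  have hA₁ : 0 ≤ A₁ := (abs_nonneg _).trans (hf₁ 0)
  constructor
  · intro i
    have e : bwd h (fun j => f j * g j) i = f i * bwd h g i + g (i - 1) * bwd h f i := by
      simp only [bwd]
      ring
    rw [e]
    refine (abs_add_le _ _).trans ?_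
    rw [abs_mul, abs_mul]
    gcongr
    exacts [hf _, hg₁ _, hg _, hf₁ _]
  · intro i
    rw [lap_mul, two_mul, fwd_eq_bwd, fwd_eq_bwd, ← add_assoc]
    refine (abs_add_le _ _).trans (add_le_add ((abs_add_three _ _ _).trans ?_) ?_)
    · simp only [abs_mul]
      gcongr
      exacts [hf _, hg₂ _, hg _, hf₂ _, hf₁ _, hg₁ _]
    · rw [abs_mul]
      gcongr
      exacts [hf₁ _, hg₁ _]

section Flow

variable {h T : ℝ} {V : ZMod N → ℝ} {τ u : ℝ → ZMod N → ℝ}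

lemma IsLatticeFlow.fwd_eq (H : IsLatticeFlow h T V τ u) {t : ℝ} (ht : t ∈ Icc 0 T) (i : ZMod N) :
    fwd h (u t) i = τ t i ^ 3 * flux h τ u t i := by
  have := H.pos t ht i
  rw [flux]
  field_simp

lemma IsLatticeFlow.hasDerivAt_u (H : IsLatticeFlow h T V τ u) {t : ℝ} (ht : t ∈ Icc 0 T)
    (i : ZMod N) : HasDerivAt (fun s => u s i) (bwd h (flux h τ u t) i) t :=
  H.du t ht i

lemma IsLatticeFlow.hasDerivAt_flux (H : IsLatticeFlow h T V τ u) {t : ℝ} (ht : t ∈ Icc 0 T)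
    (i : ZMod N) : HasDerivAt (fun s => flux h τ u s i)
      (lap h (flux h τ u t) i / τ t i ^ 3 - 3 * τ t i ^ 2 * flux h τ u t i ^ 2) t := by
  have hpos := H.pos t ht i
  have hw : HasDerivAt (fun s => fwd h (u s) i) (lap h (flux h τ u t) i) t := by
    have h1 := ((H.hasDerivAt_u ht (i + 1)).fun_sub (H.hasDerivAt_u ht i)).div_const h
    rw [← fwd_bwd]
    exact h1
  have hp := (H.dτ t ht i).fun_pow 3
  have := hw.fun_div hp (by positivity)
  refine this.congr_deriv ?_
  rw [H.fwd_eq ht]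
  push_cast
  field_simp

lemma IsLatticeFlow.continuousOn_flux (H : IsLatticeFlow h T V τ u) (i : ZMod N) :
    ContinuousOn (fun s => flux h τ u s i) (Icc 0 T) :=
  fun _ ht => (H.hasDerivAt_flux ht i).continuousAt.continuousWithinAt

lemma IsLatticeFlow.continuousOn_u (H : IsLatticeFlow h T V τ u) (i : ZMod N) :
    ContinuousOn (fun s => u s i) (Icc 0 T) :=
  fun _ ht => (H.du _ ht i).continuousAt.continuousWithinAt

lemma IsLatticeFlow.continuousOn_τ (H : IsLatticeFlow h T V τ u) (i : ZMod N) :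
    ContinuousOn (fun s => τ s i) (Icc 0 T) :=
  fun _ ht => (H.dτ _ ht i).continuousAt.continuousWithinAt

lemma continuousOn_lap {f : ℝ → ZMod N → ℝ} {s : Set ℝ}
    (hf : ∀ i, ContinuousOn (fun t => f t i) s) (i : ZMod N) :
    ContinuousOn (fun t => lap h (f t) i) s :=
  (((hf (i + 1)).sub ((hf i).const_mul 2)).add (hf (i - 1))).div_const _

lemma continuousOn_fwd {f : ℝ → ZMod N → ℝ} {s : Set ℝ}
    (hf : ∀ i, ContinuousOn (fun t => f t i) s) (i : ZMod N) :
    ContinuousOn (fun t => fwd h (f t) i) s :=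
  ((hf (i + 1)).sub (hf i)).div_const _

lemma continuousOn_bwd {f : ℝ → ZMod N → ℝ} {s : Set ℝ}
    (hf : ∀ i, ContinuousOn (fun t => f t i) s) (i : ZMod N) :
    ContinuousOn (fun t => bwd h (f t) i) s :=
  ((hf i).sub (hf (i - 1))).div_const _

variable [NeZero N]

lemma continuousOn_nsq {f : ℝ → ZMod N → ℝ} {s : Set ℝ}
    (hf : ∀ i, ContinuousOn (fun t => f t i) s) : ContinuousOn (fun t => nsq h (f t)) s :=
  continuousOn_const.mul (continuousOn_finsetSum _ fun i _ => (hf i).pow 2)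

lemma hasDerivAt_nsq {f : ℝ → ZMod N → ℝ} {f' : ZMod N → ℝ} {t : ℝ}
    (hf : ∀ i, HasDerivAt (fun s => f s i) (f' i) t) :
    HasDerivAt (fun s => nsq h (f s)) (h * ∑ i, 2 * f t i * f' i) t := by
  have : ∀ i ∈ (Finset.univ : Finset (ZMod N)),
      HasDerivAt (fun s => f s i ^ 2) (2 * f t i * f' i) t := fun i _ =>
    ((hf i).fun_pow 2).congr_deriv (by simp)
  exact (HasDerivAt.fun_sum this).const_mul h

/-- The weighted energy `|σ_y|² exp (c |u|²)` dissipates `|σ_yy|²`. -/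
lemma IsLatticeFlow.energy (H : IsLatticeFlow h T V τ u) {a b M c : ℝ} (hh : 0 < h)
    (ha : 0 < a) (hM : N * h = M) (hab : ∀ t ∈ Icc 0 T, ∀ i, a ≤ τ t i ∧ τ t i ≤ b)
    (hc : c = 9 * b ^ 7 * M / (2 * a ^ 3)) {t : ℝ} (ht : t ∈ Icc 0 T) :
    ∃ E', HasDerivAt (fun s => nsq h (bwd h (flux h τ u s)) * Real.exp (c * nsq h (u s))) E' t ∧
      E' ≤ -(nsq h (lap h (flux h τ u t)) / b ^ 3) := by
  set σ := flux h τ u with hσ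
  have hM0 : 0 ≤ M := hM ▸ by positivity
  have hb : 0 < b := ha.trans_le ((hab t ht 0).1.trans (hab t ht 0).2)
  set σ' : ZMod N → ℝ := fun i => lap h (σ t) i / τ t i ^ 3 - 3 * τ t i ^ 2 * σ t i ^ 2 with hσ'
  have hZ := hasDerivAt_nsq (h := h) (f := fun s => bwd h (σ s)) (f' := bwd h σ') (t := t)
    fun i => ((H.hasDerivAt_flux ht i).fun_sub (H.hasDerivAt_flux ht (i - 1))).div_const h
  have hq := hasDerivAt_nsq (h := h) (f := u) (t := t) fun i => H.hasDerivAt_u ht i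
  have hE := hZ.fun_mul ((hq.const_mul c).exp)
  refine ⟨_, hE, ?_⟩
  set Z := nsq h (bwd h (σ t)) with hZdef
  set S := nsq h (σ t) with hS
  set B := nsq h (lap h (σ t)) with hB
  have hZ0 : 0 ≤ Z := nsq_nonneg hh.le _
  have hS0 : 0 ≤ S := nsq_nonneg hh.le _
  have hB0 : 0 ≤ B := nsq_nonneg hh.le _
  have hsup : ∀ i, σ t i ^ 2 ≤ M * Z := by
    intro i
    rw [← hM]
    refine sq_le_of_sum_eq_zero hh (σ t) (fwd h (u t)) (fun i => 1 / τ t i ^ 3) (fun i => ?_)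
      (fun i => ?_) (sum_fwd h _) i
    · have := H.pos t ht i
      positivity
    · simp only [hσ, flux]
      ring
  have hZ' : h * ∑ i, 2 * bwd h (σ t) i * bwd h σ' i ≤
      -(B / b ^ 3) + 9 * b ^ 7 * M * Z * S := by
    have h1 : ∑ i, 2 * bwd h (σ t) i * bwd h σ' i = -∑ i, 2 * σ' i * lap h (σ t) i := by
      have h2 := sum_bwd_mul h σ' (bwd h (σ t))
      rw [fwd_bwd] at h2
      have h3 : ∀ i, 2 * bwd h (σ t) i * bwd h σ' i = 2 * (bwd h σ' i * bwd h (σ t) i) :=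
        fun i => by ring
      have h4 : ∀ i, 2 * σ' i * lap h (σ t) i = 2 * (σ' i * lap h (σ t) i) := fun i => by ring
      simp only [h3, h4, ← Finset.mul_sum, h2]
      ring
    have h5 : ∀ i, -(2 * σ' i * lap h (σ t) i) ≤
        -(lap h (σ t) i ^ 2 / b ^ 3) + 9 * b ^ 7 * M * Z * σ t i ^ 2 := by
      intro i
      obtain ⟨hai, hbi⟩ := hab t ht i
      have hτ : 0 < τ t i := ha.trans_le hai
      set x := lap h (σ t) i
      set y := σ t i
      set r := τ t i
      have e1 : -(2 * σ' i * x) = -(2 * (x ^ 2 / r ^ 3)) + 6 * r ^ 2 * y ^ 2 * x := by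
        simp only [hσ']
        ring
      have e2 : 6 * r ^ 2 * y ^ 2 * x ≤ x ^ 2 / r ^ 3 + 9 * r ^ 7 * y ^ 4 := by
        have : 0 ≤ (x - 3 * r ^ 5 * y ^ 2) ^ 2 / r ^ 3 := by positivity
        have e : (x - 3 * r ^ 5 * y ^ 2) ^ 2 / r ^ 3 =
            x ^ 2 / r ^ 3 + 9 * r ^ 7 * y ^ 4 - 6 * r ^ 2 * y ^ 2 * x := by
          field_simp
          ring
        linarith
      have e3 : x ^ 2 / b ^ 3 ≤ x ^ 2 / r ^ 3 := by gcongr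
      have e4 : 9 * r ^ 7 * y ^ 4 ≤ 9 * b ^ 7 * (M * Z * y ^ 2) := by
        have : y ^ 4 ≤ M * Z * y ^ 2 := by
          have := mul_le_mul_of_nonneg_right (hsup i) (sq_nonneg y)
          calc y ^ 4 = y ^ 2 * y ^ 2 := by ring
            _ ≤ _ := this
        gcongr
      rw [e1]
      linarith
    rw [h1, ← Finset.sum_neg_distrib]
    calc h * ∑ i, -(2 * σ' i * lap h (σ t) i)
        ≤ h * ∑ i, (-(lap h (σ t) i ^ 2 / b ^ 3) + 9 * b ^ 7 * M * Z * σ t i ^ 2) :=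
          mul_le_mul_of_nonneg_left (Finset.sum_le_sum fun i _ => h5 i) hh.le
      _ = -(B / b ^ 3) + 9 * b ^ 7 * M * Z * S := by
          rw [Finset.sum_add_distrib, Finset.sum_neg_distrib, ← Finset.sum_div, ← Finset.mul_sum,
            hB, hS, nsq, nsq]
          ring
  have hq' : h * ∑ i, 2 * u t i * bwd h (σ t) i ≤ -(2 * a ^ 3 * S) := by
    have h1 : ∑ i, 2 * u t i * bwd h (σ t) i = -∑ i, 2 * (τ t i ^ 3 * σ t i ^ 2) := by
      have h2 := sum_fwd_mul h (u t) (σ t)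
      have h3 : ∀ i, 2 * u t i * bwd h (σ t) i = 2 * (u t i * bwd h (σ t) i) := fun i => by ring
      have h4 : ∀ i, τ t i ^ 3 * σ t i ^ 2 = fwd h (u t) i * σ t i := fun i => by
        rw [H.fwd_eq ht]
        ring
      simp only [h3, h4, ← Finset.mul_sum, h2]
      ring
    have h5 : ∀ i, a ^ 3 * σ t i ^ 2 ≤ τ t i ^ 3 * σ t i ^ 2 := fun i => by
      have := (hab t ht i).1
      gcongr
    have h6 := Finset.sum_le_sum fun i (_ : i ∈ (Finset.univ : Finset (ZMod N))) => h5 i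
    rw [h1, ← Finset.mul_sum, hS, nsq]
    rw [← Finset.mul_sum] at h6
    nlinarith
  have hc0 : 0 ≤ c := by rw [hc]; positivity
  set e := Real.exp (c * nsq h (u t)) with he
  have he1 : 1 ≤ e := Real.one_le_exp (mul_nonneg hc0 (nsq_nonneg hh.le _))
  have hc1 : c * (2 * a ^ 3) = 9 * b ^ 7 * M := by rw [hc]; field_simp
  have e1 : Z * (e * (c * (h * ∑ i, 2 * u t i * bwd h (σ t) i))) ≤
      Z * (e * (c * (-(2 * a ^ 3 * S)))) := by gcongr
  have e2 : (h * ∑ i, 2 * bwd h (σ t) i * bwd h σ' i) * e ≤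
      (-(B / b ^ 3) + 9 * b ^ 7 * M * Z * S) * e := by gcongr
  have e3 : Z * (e * (c * (-(2 * a ^ 3 * S)))) = -(9 * b ^ 7 * M * Z * S) * e := by
    rw [← hc1]; ring
  have e4 : B / b ^ 3 ≤ B / b ^ 3 * e := le_mul_of_one_le_right (by positivity) he1
  linarith

/-- Uniform bounds on the flux. -/
lemma IsLatticeFlow.flux_bound (H : IsLatticeFlow h T V τ u) {a b M c Z₀ Q : ℝ} (hh : 0 < h)
    (ha : 0 < a) (hT : 0 ≤ T) (hM : N * h = M) (hab : ∀ t ∈ Icc 0 T, ∀ i, a ≤ τ t i ∧ τ t i ≤ b)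
    (hc : c = 9 * b ^ 7 * M / (2 * a ^ 3)) (hZ₀ : nsq h (bwd h (flux h τ u 0)) ≤ Z₀)
    (hQ : nsq h (u 0) ≤ Q) :
    (∀ t ∈ Icc 0 T, nsq h (bwd h (flux h τ u t)) ≤ Z₀ * Real.exp (c * Q)) ∧
      ∫ t in (0 : ℝ)..T, nsq h (lap h (flux h τ u t)) ≤ b ^ 3 * (Z₀ * Real.exp (c * Q)) := by
  have hM0 : 0 ≤ M := hM ▸ by positivity
  have h0 : (0 : ℝ) ∈ Icc 0 T := ⟨le_rfl, hT⟩
  have hb : 0 < b := ha.trans_le ((hab 0 h0 0).1.trans (hab 0 h0 0).2)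
  have hc0 : 0 ≤ c := by rw [hc]; positivity
  set E : ℝ → ℝ := fun s => nsq h (bwd h (flux h τ u s)) * Real.exp (c * nsq h (u s)) with hE
  choose! E' hE' hE'le using fun t (ht : t ∈ Icc 0 T) => H.energy hh ha hM hab hc ht
  have hcont : ContinuousOn (fun t => nsq h (lap h (flux h τ u t))) (Icc 0 T) :=
    continuousOn_nsq (continuousOn_lap H.continuousOn_flux)
  have hE0 : E 0 ≤ Z₀ * Real.exp (c * Q) := by
    have : 0 ≤ nsq h (bwd h (flux h τ u 0)) := nsq_nonneg hh.le _
    have : 0 ≤ Z₀ := this.trans hZ₀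
    simp only [hE]
    gcongr
  have key : ∀ t ∈ Icc 0 T,
      E t + (∫ s in (0 : ℝ)..t, nsq h (lap h (flux h τ u s))) / b ^ 3 ≤
        Z₀ * Real.exp (c * Q) := by
    intro t ht
    have hsub : Icc 0 t ⊆ Icc 0 T := Icc_subset_Icc_right ht.2
    have := intervalIntegral.sub_le_integral_of_hasDeriv_right_of_le (a := 0) (b := t) (g := E)
      (g' := E') (φ := fun s => -(nsq h (lap h (flux h τ u s)) / b ^ 3)) ht.1
      (fun s hs => (hE' s (hsub hs)).continuousAt.continuousWithinAt)
      (fun s hs => (hE' s (hsub (Ioo_subset_Icc_self hs))).hasDerivWithinAt)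
      (((hcont.mono hsub).div_const _).neg.integrableOn_Icc)
      (fun s hs => hE'le s (hsub (Ioo_subset_Icc_self hs)))
    rw [intervalIntegral.integral_neg, intervalIntegral.integral_div] at this
    linarith
  refine ⟨fun t ht => ?_, ?_⟩
  · have h1 := key t ht
    have h2 : 0 ≤ (∫ s in (0 : ℝ)..t, nsq h (lap h (flux h τ u s))) / b ^ 3 :=
      div_nonneg (intervalIntegral.integral_nonneg ht.1 fun s _ => nsq_nonneg hh.le _)
        (by positivity)
    have h3 : nsq h (bwd h (flux h τ u t)) ≤ E t :=
      le_mul_of_one_le_right (nsq_nonneg hh.le _)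
        (Real.one_le_exp (mul_nonneg hc0 (nsq_nonneg hh.le _)))
    linarith
  · have h1 := key T ⟨hT, le_rfl⟩
    have h2 : 0 ≤ E T := mul_nonneg (nsq_nonneg hh.le _) (Real.exp_pos _).le
    rw [← div_le_iff₀' (by positivity)]
    linarith

end Flow

variable {N : ℕ} [NeZero N]

lemma sq_intervalIntegral_le_of_integrable {f : ℝ → ℝ} {s t : ℝ} (hst : s ≤ t)
    (hf : IntervalIntegrable f volume s t) (hf2 : IntervalIntegrable (fun x => f x ^ 2) volume s t) :
    (∫ x in s..t, f x) ^ 2 ≤ (t - s) * ∫ x in s..t, f x ^ 2 := by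
  rcases hst.eq_or_lt with rfl | hlt
  · simp
  set m := (∫ x in s..t, f x) / (t - s) with hm
  have hts : 0 < t - s := by linarith
  have h1 : 0 ≤ ∫ x in s..t, (f x - m) ^ 2 :=
    intervalIntegral.integral_nonneg hst fun x _ => sq_nonneg _
  have h2 : ∫ x in s..t, (f x - m) ^ 2 =
      (∫ x in s..t, f x ^ 2) - (2 * m * (∫ x in s..t, f x) - (t - s) * m ^ 2) := by
    have e : ∀ x, (f x - m) ^ 2 = f x ^ 2 - (2 * m * f x - m ^ 2) := fun x => by ring
    simp only [e]
    have i2 : IntervalIntegrable (fun x => 2 * m * f x) volume s t := hf.const_mul (2 * m)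
    rw [intervalIntegral.integral_sub hf2 (i2.sub intervalIntegrable_const),
      intervalIntegral.integral_sub i2 intervalIntegrable_const,
      intervalIntegral.integral_const_mul,
      intervalIntegral.integral_const, smul_eq_mul]
  rw [h2] at h1
  have h3 : ∫ x in s..t, f x = m * (t - s) := by rw [hm]; field_simp
  rw [h3] at h1 ⊢
  nlinarith

lemma sq_intervalIntegral_le {f : ℝ → ℝ} {s t : ℝ} (hst : s ≤ t) (hf : ContinuousOn f (Icc s t)) :
    (∫ x in s..t, f x) ^ 2 ≤ (t - s) * ∫ x in s..t, f x ^ 2 := by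
  rw [← uIcc_of_le hst] at hf
  exact sq_intervalIntegral_le_of_integrable hst hf.intervalIntegrable
    (hf.pow 2).intervalIntegrable

lemma nsq_le {h C : ℝ} (hh : 0 ≤ h) {f : ZMod N → ℝ} (hf : ∀ i, |f i| ≤ C) :
    nsq h f ≤ N * h * C ^ 2 := by
  have : ∑ i, f i ^ 2 ≤ ∑ _i : ZMod N, C ^ 2 := Finset.sum_le_sum fun i _ =>
    sq_le_sq' (by linarith [(abs_le.1 (hf i)).1]) (abs_le.1 (hf i)).2
  rw [Finset.sum_const, card_zmod_univ, nsmul_eq_mul] at this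
  calc nsq h f ≤ h * (N * C ^ 2) := mul_le_mul_of_nonneg_left this hh
    _ = _ := by ring

/-- Uniform regularity of a family of lattice functions on `[0, T]`. -/
structure LatticeReg (h T C : ℝ) (f : ℝ → ZMod N → ℝ) : Prop where
  bound : ∀ t ∈ Icc 0 T, ∀ i, |f t i| ≤ C
  space : ∀ t ∈ Icc 0 T, nsq h (bwd h (f t)) ≤ C
  time : ∀ s ∈ Icc 0 T, ∀ t ∈ Icc 0 T, ∀ i, (f t i - f s i) ^ 2 ≤ C * √|t - s|

lemma sq_sub_le_of_hasDerivAt {h T A B M : ℝ} (hh : 0 < h) (hM : N * h = M)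
    {f f' : ℝ → ZMod N → ℝ} (hd : ∀ t ∈ Icc 0 T, ∀ i, HasDerivAt (fun s => f s i) (f' t i) t)
    (hc : ∀ i, ContinuousOn (fun t => f' t i) (Icc 0 T))
    (hA : ∫ t in (0 : ℝ)..T, nsq h (f' t) ≤ A) (hB : ∀ t ∈ Icc 0 T, nsq h (bwd h (f t)) ≤ B)
    {s t : ℝ} (hs : s ∈ Icc 0 T) (ht : t ∈ Icc 0 T) (i : ZMod N) :
    (f t i - f s i) ^ 2 ≤ (√T * A / M + 4 * √(A * B)) * √|t - s| := by
  wlog hst : s ≤ t generalizing s t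
  · have := this ht hs (le_of_not_ge hst)
    rwa [abs_sub_comm, ← neg_sub, neg_sq] at this
  have hN : (0 : ℝ) < N := by exact_mod_cast Nat.pos_of_ne_zero (NeZero.ne N)
  have hM0 : 0 < M := hM ▸ by positivity
  have hsub : Icc s t ⊆ Icc 0 T := Icc_subset_Icc hs.1 ht.2
  have hcn : ContinuousOn (fun t => nsq h (f' t)) (Icc 0 T) := continuousOn_nsq hc
  have hA0 : 0 ≤ A := le_trans (intervalIntegral.integral_nonneg (hs.1.trans hs.2) fun x _ =>
    nsq_nonneg hh.le _) hA
  have hB0 : 0 ≤ B := (nsq_nonneg hh.le _).trans (hB s hs)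
  have hint : ∫ x in s..t, nsq h (f' x) ≤ A := by
    refine le_trans ?_ hA
    refine intervalIntegral.integral_mono_interval hs.1 hst ht.2 ?_ ?_
    · exact Eventually.of_forall fun x => nsq_nonneg hh.le _
    · rw [← uIcc_of_le (hs.1.trans hs.2)] at hcn
      exact hcn.intervalIntegrable
  set g : ZMod N → ℝ := fun i => f t i - f s i with hg
  have hgi : ∀ i, g i = ∫ x in s..t, f' x i := fun i => by
    rw [intervalIntegral.integral_eq_sub_of_hasDerivAt (f := fun x => f x i)]
    · intro x hx
      rw [uIcc_of_le hst] at hx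
      exact hd x (hsub hx) i
    · refine ContinuousOn.intervalIntegrable ?_
      rw [uIcc_of_le hst]
      exact (hc i).mono hsub
  have h1 : nsq h g ≤ (t - s) * A := by
    have e1 : ∀ i, g i ^ 2 ≤ (t - s) * ∫ x in s..t, f' x i ^ 2 := fun i => by
      rw [hgi]
      exact sq_intervalIntegral_le hst ((hc i).mono hsub)
    calc nsq h g ≤ h * ∑ i, (t - s) * ∫ x in s..t, f' x i ^ 2 :=
          mul_le_mul_of_nonneg_left (Finset.sum_le_sum fun i _ => e1 i) hh.le
      _ = (t - s) * ∫ x in s..t, nsq h (f' x) := by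
          simp only [nsq]
          rw [intervalIntegral.integral_const_mul, intervalIntegral.integral_finsetSum,
            ← Finset.mul_sum]
          · ring
          · intro i _
            refine ContinuousOn.intervalIntegrable ?_
            rw [uIcc_of_le hst]
            exact ((hc i).mono hsub).pow 2
      _ ≤ (t - s) * A := mul_le_mul_of_nonneg_left hint (by linarith)
  have h2 : nsq h (bwd h g) ≤ 4 * B := by
    have e : ∀ i, bwd h g i ^ 2 ≤ 2 * bwd h (f t) i ^ 2 + 2 * bwd h (f s) i ^ 2 := fun i => by
      rw [hg, bwd_sub]
      nlinarith [sq_nonneg (bwd h (f t) i + bwd h (f s) i)]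
    have e2 : nsq h (bwd h g) ≤ 2 * nsq h (bwd h (f t)) + 2 * nsq h (bwd h (f s)) := by
      calc nsq h (bwd h g) ≤ h * ∑ i, (2 * bwd h (f t) i ^ 2 + 2 * bwd h (f s) i ^ 2) :=
            mul_le_mul_of_nonneg_left (Finset.sum_le_sum fun i _ => e i) hh.le
        _ = _ := by
          simp only [nsq, Finset.sum_add_distrib, ← Finset.mul_sum]
          ring
    linarith [hB t ht, hB s hs]
  have h3 := sq_le_agmon hh g i
  rw [hM] at h3
  have hts : 0 ≤ t - s := by linarith
  have hr : √|t - s| = √(t - s) := by rw [abs_of_nonneg hts]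
  have h4 : √(nsq h g * nsq h (bwd h g)) ≤ 2 * √(A * B) * √(t - s) := by
    calc √(nsq h g * nsq h (bwd h g)) ≤ √((t - s) * A * (4 * B)) := by
          refine Real.sqrt_le_sqrt ?_
          exact mul_le_mul h1 h2 (nsq_nonneg hh.le _) (by positivity)
      _ = √(2 ^ 2 * ((A * B) * (t - s))) := by congr 1; ring
      _ = 2 * √(A * B) * √(t - s) := by
          rw [Real.sqrt_mul (by positivity), Real.sqrt_mul (by positivity),
            Real.sqrt_sq (by norm_num)]
          ring
  have h5 : t - s ≤ √T * √(t - s) := by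
    calc t - s = √(t - s) * √(t - s) := (Real.mul_self_sqrt hts).symm
      _ ≤ √T * √(t - s) := by
        refine mul_le_mul_of_nonneg_right (Real.sqrt_le_sqrt ?_) (Real.sqrt_nonneg _)
        linarith [ht.2, hs.1]
  have h6 : nsq h g / M ≤ √T * √(t - s) * A / M := by
    refine div_le_div_of_nonneg_right (h1.trans ?_) hM0.le
    exact mul_le_mul_of_nonneg_right h5 hA0
  rw [hr]
  calc g i ^ 2 ≤ √T * √(t - s) * A / M + 2 * (2 * √(A * B) * √(t - s)) := by linarith
    _ = (√T * A / M + 4 * √(A * B)) * √(t - s) := by ring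

lemma nsq_flux_deriv_le {h a b s : ℝ} (hh : 0 ≤ h) (ha : 0 < a) {r σ : ZMod N → ℝ}
    (hr : ∀ i, a ≤ r i ∧ r i ≤ b) (hσ : ∀ i, |σ i| ≤ s) :
    nsq h (fun i => lap h σ i / r i ^ 3 - 3 * r i ^ 2 * σ i ^ 2) ≤
      2 / a ^ 6 * nsq h (lap h σ) + 2 * (N * h) * (3 * b ^ 2 * s ^ 2) ^ 2 := by
  have e : ∀ i, (lap h σ i / r i ^ 3 - 3 * r i ^ 2 * σ i ^ 2) ^ 2 ≤
      2 / a ^ 6 * lap h σ i ^ 2 + 2 * (3 * b ^ 2 * s ^ 2) ^ 2 := by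
    intro i
    obtain ⟨h1, h2⟩ := hr i
    have h3 : 0 < r i := ha.trans_le h1
    have e1 : (lap h σ i / r i ^ 3) ^ 2 ≤ 1 / a ^ 6 * lap h σ i ^ 2 := by
      rw [div_pow, ← pow_mul, one_div_mul_eq_div]
      gcongr
    have e2 : (3 * r i ^ 2 * σ i ^ 2) ^ 2 ≤ (3 * b ^ 2 * s ^ 2) ^ 2 := by
      have : σ i ^ 2 ≤ s ^ 2 := sq_le_sq' (abs_le.1 (hσ i)).1 (abs_le.1 (hσ i)).2
      gcongr
    have e3 : ∀ x y : ℝ, (x - y) ^ 2 ≤ 2 * x ^ 2 + 2 * y ^ 2 := fun x y => by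
      nlinarith [sq_nonneg (x + y)]
    have e4 : 2 / a ^ 6 * lap h σ i ^ 2 = 2 * (1 / a ^ 6 * lap h σ i ^ 2) := by ring
    refine (e3 _ _).trans ?_
    linarith
  calc _ ≤ h * ∑ i : ZMod N, (2 / a ^ 6 * lap h σ i ^ 2 + 2 * (3 * b ^ 2 * s ^ 2) ^ 2) :=
        mul_le_mul_of_nonneg_left (Finset.sum_le_sum fun i _ => e i) hh
    _ = _ := by
      rw [Finset.sum_add_distrib, ← Finset.mul_sum, Finset.sum_const, card_zmod_univ,
        nsmul_eq_mul, nsq]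
      ring

lemma nsq_lap_mul_le {h s p₀ p₁ p₂ : ℝ} (hh : 0 ≤ h) {P σ : ZMod N → ℝ}
    (hP : ∀ i, |P i| ≤ p₀) (hP₁ : ∀ i, |bwd h P i| ≤ p₁) (hP₂ : ∀ i, |lap h P i| ≤ p₂)
    (hσ : ∀ i, |σ i| ≤ s) :
    nsq h (lap h (fun j => P j * σ j)) ≤ 4 * p₀ ^ 2 * nsq h (lap h σ) +
      (4 * (N * h) * (s * p₂) ^ 2 + 8 * p₁ ^ 2 * nsq h (bwd h σ)) := by
  have e : ∀ i, lap h (fun j => P j * σ j) i ^ 2 ≤ 4 * p₀ ^ 2 * lap h σ i ^ 2 +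
      4 * (s * p₂) ^ 2 + 4 * p₁ ^ 2 * bwd h σ (i + 1) ^ 2 + 4 * p₁ ^ 2 * bwd h σ i ^ 2 := by
    intro i
    rw [lap_mul, fwd_eq_bwd, fwd_eq_bwd]
    have sqb : ∀ {x y z w : ℝ}, |x| ≤ y → |z| ≤ w → (x * z) ^ 2 ≤ (y * w) ^ 2 := by
      intro x y z w h1 h2
      have h3 : 0 ≤ y := (abs_nonneg x).trans h1
      rw [← sq_abs, abs_mul]
      gcongr
    have e1 := sqb (hP i) (le_refl |lap h σ i|)
    have e2 := sqb (hσ i) (hP₂ i)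
    have e3 := sqb (hP₁ (i + 1)) (le_refl |bwd h σ (i + 1)|)
    have e4 := sqb (hP₁ i) (le_refl |bwd h σ i|)
    rw [mul_pow _ |_|, sq_abs] at e1 e3 e4
    have four : ∀ x y z w : ℝ, (x + y + z + w) ^ 2 ≤ 4 * x ^ 2 + 4 * y ^ 2 + 4 * z ^ 2 +
        4 * w ^ 2 := by
      intro x y z w
      nlinarith [sq_nonneg (x - y), sq_nonneg (x - z), sq_nonneg (x - w), sq_nonneg (y - z),
        sq_nonneg (y - w), sq_nonneg (z - w)]
    refine (four _ _ _ _).trans ?_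
    linarith
  calc nsq h (lap h (fun j => P j * σ j)) ≤ h * ∑ i : ZMod N, (4 * p₀ ^ 2 * lap h σ i ^ 2 +
      4 * (s * p₂) ^ 2 + 4 * p₁ ^ 2 * bwd h σ (i + 1) ^ 2 + 4 * p₁ ^ 2 * bwd h σ i ^ 2) :=
        mul_le_mul_of_nonneg_left (Finset.sum_le_sum fun i _ => e i) hh
    _ = _ := by
      simp only [Finset.sum_add_distrib, ← Finset.mul_sum]
      rw [sum_shift (fun i => bwd h σ i ^ 2), Finset.sum_const, card_zmod_univ,
        nsmul_eq_mul, nsq, nsq]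
      ring

set_option maxHeartbeats 1000000 in
/-- Bounds for the semi-discrete flow, uniform in the mesh. -/
theorem exists_lattice_bounds {M a b K G Z₀ U T : ℝ} (hM : 0 < M) (ha : 0 < a) (hT : 0 ≤ T)
    (hZ₀ : 0 ≤ Z₀) (hK0 : 0 ≤ K) (hG0 : 0 ≤ G) (hb : 0 < b) :
    ∃ C, ∀ (N : ℕ) [NeZero N] (h : ℝ) (V : ZMod N → ℝ) (τ u : ℝ → ZMod N → ℝ), 0 < h →
      N * h = M → IsLatticeFlow h T V τ u → (∀ t ∈ Icc 0 T, ∀ i, a ≤ τ t i ∧ τ t i ≤ b) →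
      (∀ t ∈ Icc 0 T, ∀ i, |u t i| ≤ U) → (∀ t ∈ Icc 0 T, ∀ i, |V i - u t i| ≤ K) →
      (∀ i, |fwd h V i| ≤ G) → nsq h (bwd h (flux h τ u 0)) ≤ Z₀ →
      LatticeReg h T C τ ∧ LatticeReg h T C u ∧ LatticeReg h T C (flux h τ u) ∧
      (∀ t ∈ Icc 0 T, ∀ i, |fwd h (u t) i| ≤ C) ∧
      (∫ t in (0 : ℝ)..T, nsq h (lap h (flux h τ u t)) ≤ C) ∧
      (∫ t in (0 : ℝ)..T, nsq h (lap h (fwd h (u t))) ≤ C) := by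
  set c := 9 * b ^ 7 * M / (2 * a ^ 3) with hc
  set C₁ := Z₀ * Real.exp (c * (M * U ^ 2)) with hC₁
  set s := √(M * C₁) with hs
  set W := b ^ 3 * s with hW
  set L₁ := b ^ 3 * K with hL₁
  set L₂ := b ^ 3 * (G + W + 3 * b * L₁ ^ 2 / a ^ 5) with hL₂
  set q₁ := b * L₁ + b * L₁ with hq₁
  set q₂ := b * L₂ + b * L₂ + 2 * (L₁ * L₁) with hq₂
  set p₁ := b * q₁ + b * b * L₁ with hp₁
  set p₂ := b * q₂ + b * b * L₂ + 2 * (L₁ * q₁) with hp₂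
  set A₁ := 2 / a ^ 6 * (b ^ 3 * C₁) + T * (2 * M * (3 * b ^ 2 * s ^ 2) ^ 2) with hA₁
  set I₁ := 4 * (b ^ 3) ^ 2 * (b ^ 3 * C₁) + T * (4 * M * (s * p₂) ^ 2 + 8 * p₁ ^ 2 * C₁) with hI₁
  set D₁ := √T * (T * (M * W ^ 2)) / M + 4 * √(T * (M * W ^ 2) * (M * L₁ ^ 2)) with hD₁
  set D₂ := √T * (T * C₁) / M + 4 * √(T * C₁ * (M * W ^ 2)) with hD₂
  set D₃ := √T * A₁ / M + 4 * √(A₁ * C₁) with hD₃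
  have hC₁0 : 0 ≤ C₁ := by positivity
  have hs0 : 0 ≤ s := by positivity
  have hW0 : 0 ≤ W := by positivity
  have hL₁0 : 0 ≤ L₁ := by positivity
  have hL₂0 : 0 ≤ L₂ := by positivity
  have hA₁0 : 0 ≤ A₁ := by positivity
  have hI₁0 : 0 ≤ I₁ := by positivity
  have hD₁0 : 0 ≤ D₁ := by positivity
  have hD₂0 : 0 ≤ D₂ := by positivity
  have hD₃0 : 0 ≤ D₃ := by positivity
  have hX : 0 ≤ M * L₁ ^ 2 + M * W ^ 2 + b ^ 3 * C₁ := by positivity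
  have hX₁ : 0 ≤ M * L₁ ^ 2 := by positivity
  have hX₂ : 0 ≤ M * W ^ 2 := by positivity
  have hX₃ : 0 ≤ b ^ 3 * C₁ := by positivity
  refine ⟨b + |U| + s + W + M * L₁ ^ 2 + M * W ^ 2 + b ^ 3 * C₁ + C₁ + I₁ + D₁ + D₂ + D₃, ?_⟩
  have hU0 := abs_nonneg U
  have hUle := le_abs_self U
  clear_value c C₁ W L₁ L₂ q₁ q₂ p₁ p₂ A₁ I₁ D₁ D₂ D₃
  intro N _ h V τ u hh hNh H hab hU hVu hG hZ
  have h0 : (0 : ℝ) ∈ Icc 0 T := ⟨le_rfl, hT⟩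
  obtain ⟨hσ1, hσ2⟩ := H.flux_bound hh ha hT hNh hab hc hZ
    (hNh ▸ nsq_le hh.le (hU 0 h0) : nsq h (u 0) ≤ M * U ^ 2)
  rw [← hC₁] at hσ1 hσ2
  set σ := flux h τ u with hσ
  have hσs : ∀ t ∈ Icc 0 T, ∀ i, |σ t i| ≤ s := by
    intro t ht i
    have h1 : σ t i ^ 2 ≤ M * nsq h (bwd h (σ t)) := by
      rw [← hNh]
      refine sq_le_of_sum_eq_zero hh (σ t) (fwd h (u t)) (fun i => 1 / τ t i ^ 3) (fun i => ?_)
        (fun i => ?_) (sum_fwd h _) i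
      · have := H.pos t ht i
        positivity
      · simp only [hσ, flux]
        ring
    exact Real.abs_le_sqrt (h1.trans (mul_le_mul_of_nonneg_left (hσ1 t ht) hM.le))
  have hw : ∀ t ∈ Icc 0 T, ∀ i, |fwd h (u t) i| ≤ W := by
    intro t ht i
    rw [H.fwd_eq ht, abs_mul, hW, abs_of_nonneg (pow_nonneg (H.pos t ht i).le 3)]
    have h1 := (hab t ht i).2
    have h2 := hσs t ht i
    have h3 := (H.pos t ht i).le
    gcongr
  have hτ1 : ∀ t ∈ Icc 0 T, ∀ i, |bwd h (τ t) i| ≤ L₁ := by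
    intro t ht i
    rw [hL₁]
    refine abs_bwd_le hh ha (τ t) (hab t ht) i ?_
    have : bwd h (fun j => 1 / (2 * τ t j ^ 2)) i = V i - u t i := by
      rw [H.vel t ht i]; ring
    rw [this]
    exact hVu t ht i
  have hτ2 : ∀ t ∈ Icc 0 T, ∀ i, |lap h (τ t) i| ≤ L₂ := by
    intro t ht i
    rw [hL₂]
    refine abs_lap_le_of_inv_sq hh ha (τ t) (hab t ht) (hτ1 t ht) i ?_
    have : lap h (fun j => 1 / (2 * τ t j ^ 2)) i = fwd h V i - fwd h (u t) i := by
      have e : u t = fun j => V j - bwd h (fun j => 1 / (2 * τ t j ^ 2)) j :=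
        funext (H.vel t ht)
      rw [e, fwd_sub_bwd]
      ring
    rw [this]
    exact (abs_sub _ _).trans (add_le_add (hG i) (hw t ht i))
  have hu1 : ∀ t ∈ Icc 0 T, nsq h (bwd h (u t)) ≤ M * W ^ 2 := by
    intro t ht
    rw [← nsq_fwd, ← hNh]
    exact nsq_le hh.le (hw t ht)
  have hlapσ : ContinuousOn (fun t => nsq h (lap h (σ t))) (Icc 0 T) :=
    continuousOn_nsq (continuousOn_lap H.continuousOn_flux)
  have hcst : ∀ {f : ℝ → ℝ} {D : ℝ}, ContinuousOn f (Icc 0 T) → (∀ t ∈ Icc 0 T, f t ≤ D) →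
      ∫ t in (0 : ℝ)..T, f t ≤ T * D := by
    intro f D hf hD
    have := intervalIntegral.integral_mono_on (μ := volume) (g := fun _ => D) hT
      (by rw [← uIcc_of_le hT] at hf; exact hf.intervalIntegrable)
      intervalIntegrable_const hD
    simpa using this
  have hlin : ∀ {f : ℝ → ℝ} {α β : ℝ}, 0 ≤ α → ContinuousOn f (Icc 0 T) →
      (∀ t ∈ Icc 0 T, f t ≤ α * nsq h (lap h (σ t)) + β) →
      ∫ t in (0 : ℝ)..T, f t ≤ α * (b ^ 3 * C₁) + T * β := by
    intro f α β hα hf hD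
    have hi : IntervalIntegrable (fun t => nsq h (lap h (σ t))) volume 0 T := by
      rw [← uIcc_of_le hT] at hlapσ
      exact hlapσ.intervalIntegrable
    have := intervalIntegral.integral_mono_on (μ := volume) hT
      (by rw [← uIcc_of_le hT] at hf; exact hf.intervalIntegrable)
      ((hi.const_mul α).add intervalIntegrable_const) hD
    rw [intervalIntegral.integral_add (hi.const_mul α) intervalIntegrable_const,
      intervalIntegral.integral_const_mul, intervalIntegral.integral_const] at this
    simp only [sub_zero, smul_eq_mul] at this
    have h2 := mul_le_mul_of_nonneg_left hσ2 hα
    linarith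
  have hτA : ∫ t in (0 : ℝ)..T, nsq h (fwd h (u t)) ≤ T * (M * W ^ 2) :=
    hcst (continuousOn_nsq (continuousOn_fwd H.continuousOn_u)) fun t ht =>
      hNh ▸ nsq_le hh.le (hw t ht)
  have huA : ∫ t in (0 : ℝ)..T, nsq h (bwd h (σ t)) ≤ T * C₁ :=
    hcst (continuousOn_nsq (continuousOn_bwd H.continuousOn_flux)) hσ1
  set σ' : ℝ → ZMod N → ℝ :=
    fun t i => lap h (σ t) i / τ t i ^ 3 - 3 * τ t i ^ 2 * σ t i ^ 2 with hσ'
  have hσ'c : ∀ i, ContinuousOn (fun t => σ' t i) (Icc 0 T) := fun i =>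
    ((continuousOn_lap H.continuousOn_flux i).div ((H.continuousOn_τ i).pow 3) fun t ht =>
      (pow_pos (H.pos t ht i) 3).ne').sub
      ((((H.continuousOn_τ i).pow 2).const_mul 3).mul ((H.continuousOn_flux i).pow 2))
  have hσA : ∫ t in (0 : ℝ)..T, nsq h (σ' t) ≤ A₁ := by
    rw [hA₁]
    refine hlin (by positivity) (continuousOn_nsq hσ'c) fun t ht => ?_
    rw [← hNh]
    exact nsq_flux_deriv_le hh.le ha (hab t ht) (hσs t ht)
  have hwI : ∫ t in (0 : ℝ)..T, nsq h (lap h (fwd h (u t))) ≤ I₁ := by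
    rw [hI₁]
    refine hlin (by positivity)
      (continuousOn_nsq (continuousOn_lap (continuousOn_fwd H.continuousOn_u))) fun t ht => ?_
    have hτb : ∀ i, |τ t i| ≤ b := fun i => by
      rw [abs_of_pos (H.pos t ht i)]
      exact (hab t ht i).2
    obtain ⟨f1, f2⟩ := abs_diff_mul_le (τ t) (τ t) hτb hτb (hτ1 t ht) (hτ1 t ht) (hτ2 t ht)
      (hτ2 t ht)
    rw [← hq₁] at f1
    rw [← hq₂] at f2
    obtain ⟨g1, g2⟩ := abs_diff_mul_le (B := b * b) (τ t) (fun j => τ t j * τ t j) hτb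
      (fun i => by rw [abs_mul]; exact mul_le_mul (hτb i) (hτb i) (abs_nonneg _) hb.le)
      (hτ1 t ht) f1 (hτ2 t ht) f2
    rw [← hp₁] at g1
    rw [← hp₂] at g2
    set P : ZMod N → ℝ := fun j => τ t j * (τ t j * τ t j) with hP
    have hPb : ∀ i, |P i| ≤ b ^ 3 := fun i => by
      rw [hP, show b ^ 3 = b * (b * b) by ring]
      simp only [abs_mul]
      have := hτb i
      gcongr
    have hPe : fwd h (u t) = fun j => P j * σ t j := by
      ext j
      rw [H.fwd_eq ht, hP]
      ring
    rw [hPe]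
    refine (nsq_lap_mul_le hh.le hPb g1 g2 (hσs t ht)).trans ?_
    rw [hNh]
    have := hσ1 t ht
    gcongr
  have T1 := fun r hr t ht i => sq_sub_le_of_hasDerivAt hh hNh H.dτ
    (continuousOn_fwd H.continuousOn_u) hτA
    (fun t ht => (hNh ▸ nsq_le hh.le (hτ1 t ht) : nsq h (bwd h (τ t)) ≤ M * L₁ ^ 2))
    (s := r) (t := t) hr ht i
  have T2 := fun r hr t ht i => sq_sub_le_of_hasDerivAt hh hNh (f := u)
    (fun t ht i => H.hasDerivAt_u ht i) (continuousOn_bwd H.continuousOn_flux) huA hu1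
    (s := r) (t := t) hr ht i
  have T3 := fun r hr t ht i => sq_sub_le_of_hasDerivAt hh hNh (f := σ) (f' := σ')
    (fun t ht i => H.hasDerivAt_flux ht i) hσ'c hσA hσ1 (s := r) (t := t) hr ht i
  rw [← hD₁] at T1
  rw [← hD₂] at T2
  rw [← hD₃] at T3
  refine ⟨⟨fun t ht i => ?_, fun t ht => ?_, fun r hr t ht i => (T1 r hr t ht i).trans ?_⟩,
    ⟨fun t ht i => ?_, fun t ht => ?_, fun r hr t ht i => (T2 r hr t ht i).trans ?_⟩,
    ⟨fun t ht i => ?_, fun t ht => ?_, fun r hr t ht i => (T3 r hr t ht i).trans ?_⟩,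
    fun t ht i => ?_, ?_, ?_⟩
  · rw [abs_of_pos (H.pos t ht i)]
    linarith [(hab t ht i).2]
  · have : nsq h (bwd h (τ t)) ≤ M * L₁ ^ 2 := hNh ▸ nsq_le hh.le (hτ1 t ht)
    linarith
  · exact mul_le_mul_of_nonneg_right (by linarith) (Real.sqrt_nonneg _)
  · linarith [hU t ht i]
  · linarith [hu1 t ht]
  · exact mul_le_mul_of_nonneg_right (by linarith) (Real.sqrt_nonneg _)
  · linarith [hσs t ht i]
  · linarith [hσ1 t ht]
  · exact mul_le_mul_of_nonneg_right (by linarith) (Real.sqrt_nonneg _)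
  · linarith [hw t ht i]
  · linarith
  · linarith

/-! ### Compactness and passage to the limit -/

/-- A pointwise bounded and asymptotically equicontinuous sequence of functions on a separable
space has a subsequence that converges at every point. -/
lemma exists_subseq_forall_tendsto {ι P : Type*} [Countable ι] [TopologicalSpace P]
    [TopologicalSpace.SeparableSpace P] [Nonempty P] (f : ℕ → ι → P → ℝ)
    (hb : ∀ i p, ∃ C, ∀ᶠ n in atTop, |f n i p| ≤ C)
    (he : ∀ i p, ∀ ε > 0, ∃ U ∈ 𝓝 p, ∀ᶠ n in atTop, ∀ q ∈ U, |f n i q - f n i p| ≤ ε) :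
    ∃ φ : ℕ → ℕ, StrictMono φ ∧ ∃ g : ι → P → ℝ,
      ∀ i p, Tendsto (fun n => f (φ n) i p) atTop (𝓝 (g i p)) := by
  have hb' : ∀ i p, ∃ C, ∀ n, |f n i p| ≤ C := by
    intro i p
    obtain ⟨C, hC⟩ := hb i p
    have : IsBoundedUnder (· ≤ ·) atTop fun n => |f n i p| := ⟨C, by simpa using hC⟩
    obtain ⟨D, hD⟩ := this.bddAbove_range
    exact ⟨D, fun n => hD (mem_range_self n)⟩
  choose C hC using hb'
  set d := TopologicalSpace.denseSeq P
  have hK : IsCompact (Set.pi univ fun x : ι × ℕ => Icc (-C x.1 (d x.2)) (C x.1 (d x.2))) :=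
    isCompact_univ_pi fun _ => isCompact_Icc
  obtain ⟨g, -, φ, hφ, hg⟩ := hK.tendsto_subseq (x := fun n (x : ι × ℕ) => f n x.1 (d x.2))
    fun n x _ => abs_le.1 (hC x.1 (d x.2) n)
  rw [tendsto_pi_nhds] at hg
  have hcau : ∀ i p, CauchySeq fun n => f (φ n) i p := by
    intro i p
    rw [Metric.cauchySeq_iff']
    intro ε hε
    obtain ⟨W, hW, hWn⟩ := he i p (ε / 4) (by positivity)
    obtain ⟨q, ⟨k, rfl⟩, hqW⟩ :=
      (TopologicalSpace.denseRange_denseSeq P).inter_nhds_nonempty hW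
    have h1 := hφ.tendsto_atTop.eventually hWn
    have h2 := (hg (i, k)).cauchySeq
    rw [Metric.cauchySeq_iff'] at h2
    obtain ⟨n₂, hn₂⟩ := h2 (ε / 4) (by positivity)
    obtain ⟨n₁, hn₁⟩ := eventually_atTop.1 h1
    refine ⟨max n₁ n₂, fun n hn => ?_⟩
    have e1 := hn₁ n ((le_max_left _ _).trans hn) _ hqW
    have e2 := hn₁ (max n₁ n₂) (le_max_left _ _) _ hqW
    have e3 := hn₂ n ((le_max_right _ _).trans hn)
    have e4 := hn₂ (max n₁ n₂) (le_max_right _ _)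
    simp only [Function.comp_apply, Real.dist_eq] at e3 e4
    rw [Real.dist_eq, abs_lt]
    rw [abs_le] at e1 e2
    rw [abs_lt] at e3 e4
    constructor <;> linarith
  choose g' hg' using fun i p => cauchySeq_tendsto_of_complete (hcau i p)
  exact ⟨φ, hφ, g', hg'⟩

section Step

variable {N : ℕ}

/-- The step function on the line attached to a lattice function. -/
def step (h : ℝ) (f : ZMod N → ℝ) (y : ℝ) : ℝ := f (⌊y / h⌋ : ℤ)

lemma measurable_floor_comp {E : Type*} [MeasurableSpace E] (h : ℝ) (g : ℤ → E) :
    Measurable fun y : ℝ => g ⌊y / h⌋ :=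
  measurable_from_top.comp (Int.measurable_floor.comp (measurable_id.div_const h))

lemma measurable_step (h : ℝ) (f : ZMod N → ℝ) : Measurable (step h f) :=
  measurable_floor_comp h fun k : ℤ => f k

lemma floor_add_mesh {h : ℝ} (hh : h ≠ 0) (y : ℝ) : ⌊(y + h) / h⌋ = ⌊y / h⌋ + 1 := by
  rw [add_div, div_self hh, Int.floor_add_one]

lemma step_add_mesh {h : ℝ} (hh : h ≠ 0) (f : ZMod N → ℝ) (y : ℝ) :
    step h f (y + h) = f ((⌊y / h⌋ : ℤ) + 1) := by
  rw [step, floor_add_mesh hh]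
  push_cast
  rfl

lemma periodic_step {h M : ℝ} (hh : 0 < h) (hM : N * h = M) (f : ZMod N → ℝ) :
    Function.Periodic (step h f) M := by
  intro y
  rw [step, step, ← hM, add_div, mul_div_cancel_right₀ _ hh.ne', ← Int.cast_natCast,
    Int.floor_add_intCast]
  simp

lemma abs_floor_mul_sub_le {h : ℝ} (hh : 0 < h) (y : ℝ) : |⌊y / h⌋ * h - y| ≤ h := by
  have h1 := Int.floor_le (y / h)
  have h2 := Int.lt_floor_add_one (y / h)
  rw [le_div_iff₀ hh] at h1
  rw [div_lt_iff₀ hh] at h2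
  rw [abs_le]
  constructor <;> linarith

lemma integral_floor_comp {E : Type*} [NormedAddCommGroup E] [NormedSpace ℝ E]
    [CompleteSpace E] {h : ℝ} (hh : 0 < h) (g : ℤ → E) (m : ℕ) :
    IntervalIntegrable (fun y => g ⌊y / h⌋) volume 0 (m * h) ∧
    ∫ y in (0 : ℝ)..m * h, g ⌊y / h⌋ = h • ∑ k ∈ Finset.range m, g k := by
  induction m with
  | zero => simp
  | succ m ih =>
    have hle : (m : ℝ) * h ≤ (m + 1 : ℕ) * h := by
      push_cast
      nlinarith
    have heq : ∀ y ∈ Ioo ((m : ℝ) * h) ((m + 1 : ℕ) * h), g ⌊y / h⌋ = g m := by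
      intro y hy
      congr 1
      rw [Int.floor_eq_iff, le_div_iff₀ hh, div_lt_iff₀ hh]
      have := hy.2
      push_cast at this ⊢
      exact ⟨hy.1.le, this⟩
    have hii : IntervalIntegrable (fun y => g ⌊y / h⌋) volume (m * h) ((m + 1 : ℕ) * h) := by
      have h1 : IntervalIntegrable (fun _ : ℝ => g m) volume (m * h) ((m + 1 : ℕ) * h) :=
        intervalIntegrable_const
      refine h1.congr_ae ?_
      rw [uIoc_of_le hle, ← restrict_Ioo_eq_restrict_Ioc]
      filter_upwards [ae_restrict_mem measurableSet_Ioo] with y hy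
      exact (heq y hy).symm
    refine ⟨ih.1.trans hii, ?_⟩
    rw [← intervalIntegral.integral_add_adjacent_intervals ih.1 hii, ih.2, Finset.sum_range_succ,
      smul_add]
    congr 1
    rw [intervalIntegral.integral_congr_Ioo_of_le hle heq, intervalIntegral.integral_const]
    congr 1
    push_cast
    ring

lemma sum_val_eq_sum_range [NeZero N] {E : Type*} [AddCommMonoid E] (g : ZMod N → E) :
    ∑ i, g i = ∑ k ∈ Finset.range N, g (k : ℕ) := by
  refine Finset.sum_nbij' (fun i => i.val) (fun k => (k : ZMod N)) ?_ ?_ ?_ ?_ ?_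
  · intro i _
    exact Finset.mem_range.2 (ZMod.val_lt i)
  · intro k _
    exact Finset.mem_univ _
  · intro i _
    simp
  · intro k hk
    exact ZMod.val_cast_of_lt (Finset.mem_range.1 hk)
  · intro i _
    simp

/-- The spatial modulus of continuity of a step function. -/
lemma sq_step_sub_le [NeZero N] {h M C : ℝ} (hh : 0 < h) (hM : N * h = M) (f : ZMod N → ℝ)
    (hC : nsq h (bwd h f) ≤ C) {y z : ℝ} (hyz : |z - y| + h ≤ M) :
    (step h f z - step h f y) ^ 2 ≤ (|z - y| + h) * C := by
  wlog hle : y ≤ z generalizing y z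
  · have := this (y := z) (z := y) (by rwa [abs_sub_comm]) (le_of_not_ge hle)
    rw [abs_sub_comm, ← neg_sub, neg_sq]
    exact this
  rw [abs_of_nonneg (by linarith)] at hyz ⊢
  have hfl : ⌊y / h⌋ ≤ ⌊z / h⌋ := Int.floor_mono (by gcongr)
  obtain ⟨k, hk⟩ := Int.eq_ofNat_of_zero_le (sub_nonneg.2 hfl)
  have hk' : ((k : ℝ)) * h ≤ z - y + h := by
    have h1 := Int.floor_le (z / h)
    have h2 := Int.lt_floor_add_one (y / h)
    rw [le_div_iff₀ hh] at h1
    rw [div_lt_iff₀ hh] at h2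
    have h3 : (k : ℝ) = ⌊z / h⌋ - ⌊y / h⌋ := by
      have : ((⌊z / h⌋ - ⌊y / h⌋ : ℤ) : ℝ) = ((k : ℤ) : ℝ) := by rw [hk]
      push_cast at this
      exact this.symm
    rw [h3]
    nlinarith
  have hkN : k ≤ N := by
    have : (k : ℝ) * h ≤ N * h := by linarith
    exact_mod_cast le_of_mul_le_mul_right this hh
  have he : step h f z = f ((⌊y / h⌋ : ℤ) + (k : ℕ)) := by
    rw [step, show ⌊z / h⌋ = ⌊y / h⌋ + k by linarith]
    push_cast
    rfl
  rw [he]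
  calc (f ((⌊y / h⌋ : ℤ) + (k : ℕ)) - step h f y) ^ 2 ≤ k * h * nsq h (bwd h f) :=
        sq_sub_le_nsq hh f _ hkN
    _ ≤ (z - y + h) * C := mul_le_mul hk' hC (nsq_nonneg hh.le _) (by linarith)

lemma sub_eq_sum_fwd {h : ℝ} (hh : h ≠ 0) (g : ZMod N → ℝ) (m : ℕ) :
    g m - g 0 = h * ∑ k ∈ Finset.range m, fwd h g k := by
  have := sub_eq_sum_bwd hh g 0 m
  simp only [zero_add] at this
  rw [this]
  congr 1
  refine Finset.sum_congr rfl fun k _ => ?_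
  rw [fwd_eq_bwd]
  push_cast
  rfl

/-- Discrete primitives converge to primitives. -/
lemma sub_eq_integral_of_step_tendsto {h : ℕ → ℝ} (hh : ∀ n, 0 < h n)
    (h0 : Tendsto h atTop (𝓝 0)) {N : ℕ → ℕ} {g f : ∀ n, ZMod (N n) → ℝ} {G F : ℝ → ℝ} {C : ℝ}
    (hgf : ∀ᶠ n in atTop, fwd (h n) (g n) = f n) (hC : ∀ᶠ n in atTop, ∀ i, |f n i| ≤ C)
    (hg : ∀ y, Tendsto (fun n => step (h n) (g n) y) atTop (𝓝 (G y)))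
    (hf : ∀ y, Tendsto (fun n => step (h n) (f n) y) atTop (𝓝 (F y))) {y : ℝ} (hy : 0 ≤ y) :
    G y - G 0 = ∫ z in (0 : ℝ)..y, F z := by
  have h1 : Tendsto (fun n => ∫ z in (0 : ℝ)..y, step (h n) (f n) z) atTop
      (𝓝 (∫ z in (0 : ℝ)..y, F z)) := by
    refine intervalIntegral.tendsto_integral_filter_of_dominated_convergence (fun _ => C) ?_ ?_
      intervalIntegrable_const ?_
    · exact Eventually.of_forall fun n => (measurable_step _ _).aestronglyMeasurable
    · filter_upwards [hC] with n hn
      exact Eventually.of_forall fun z _ => hn _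
    · exact Eventually.of_forall fun z _ => hf z
  have h2 : Tendsto (fun n => step (h n) (g n) y - step (h n) (g n) 0) atTop (𝓝 (G y - G 0)) :=
    (hg y).sub (hg 0)
  have h3 : Tendsto (fun n => (step (h n) (g n) y - step (h n) (g n) 0) -
      ∫ z in (0 : ℝ)..y, step (h n) (f n) z) atTop (𝓝 0) := by
    refine squeeze_zero_norm' (a := fun n => C * h n) ?_ (by simpa using h0.const_mul C)
    filter_upwards [hgf, hC] with n hn hCn
    obtain ⟨m, hm⟩ := Int.eq_ofNat_of_zero_le (Int.floor_nonneg.2 (div_nonneg hy (hh n).le))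
    have e1 : step (h n) (g n) y - step (h n) (g n) 0 =
        ∫ z in (0 : ℝ)..m * h n, step (h n) (f n) z := by
      have e := (integral_floor_comp (hh n) (fun k : ℤ => f n k) m).2
      rw [← hn] at e ⊢
      simp only [step]
      rw [e, hm, smul_eq_mul]
      have := sub_eq_sum_fwd (hh n).ne' (g n) m
      simpa using this
    have hii : ∀ a b, IntervalIntegrable (step (h n) (f n)) volume a b := fun a b =>
      (intervalIntegrable_const (c := C)).mono_fun (measurable_step _ _).aestronglyMeasurable
        (Eventually.of_forall fun z => by
          simp only [Real.norm_eq_abs]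
          exact (hCn _).trans (le_abs_self C))
    rw [e1, intervalIntegral.integral_interval_sub_left (hii _ _) (hii _ _)]
    refine (intervalIntegral.norm_integral_le_of_norm_le_const (C := C) fun z _ => hCn _).trans ?_
    have h5 := abs_floor_mul_sub_le (hh n) y
    rw [hm] at h5
    have hC0 : 0 ≤ C := (abs_nonneg _).trans (hCn 0)
    exact mul_le_mul_of_nonneg_left (by simpa using h5) hC0
  have h4 := h3.add h1
  simp only [sub_add_cancel, zero_add] at h4
  exact tendsto_nhds_unique h2 h4

end Step

/-! ### Initial data in mass coordinates -/

/-- `A` is a primitive of the locally integrable function `B`. -/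
def IsPrim (A B : ℝ → ℝ) : Prop :=
  (∀ a b, IntervalIntegrable B volume a b) ∧ ∀ a b, A b - A a = ∫ x in a..b, B x

lemma IsPrim.of_hasDerivAt {A B : ℝ → ℝ} (h : ∀ x, HasDerivAt A (B x) x) (hB : Continuous B) :
    IsPrim A B :=
  ⟨fun _ _ => hB.intervalIntegrable _ _, fun _ _ =>
    (intervalIntegral.integral_eq_sub_of_hasDerivAt (fun x _ => h x)
      (hB.intervalIntegrable _ _)).symm⟩

/-- A square integrable periodic function on the line. -/
structure PerL2 (L : ℝ) (g : ℝ → ℝ) : Prop where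
  periodic : Function.Periodic g L
  int : ∀ a b, IntervalIntegrable g volume a b
  sq : ∀ a b, IntervalIntegrable (fun x => g x ^ 2) volume a b

/-- Initial data in mass coordinates: the specific volume `τ₀`, the velocity `U₀`, and the
derivatives of `τ₀`, `1 / (2 τ₀²)` and `U₀`. -/
structure IsLagData (M : ℝ) (τ₀ τ₁ F₁ F₂ U₀ U₁ U₂ : ℝ → ℝ) : Prop where
  mass_pos : 0 < M
  pos : ∀ y, 0 < τ₀ y
  periodic_τ : Function.Periodic τ₀ M
  periodic_U : Function.Periodic U₀ M
  dτ : ∀ y, HasDerivAt τ₀ (τ₁ y) y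
  cτ : Continuous τ₁
  dF : ∀ y, HasDerivAt (fun z => 1 / (2 * τ₀ z ^ 2)) (F₁ y) y
  dF₁ : ∀ y, HasDerivAt F₁ (F₂ y) y
  cF₂ : Continuous F₂
  dU : ∀ y, HasDerivAt U₀ (U₁ y) y
  cU : Continuous U₁
  dU₁ : IsPrim U₁ U₂
  sqU : PerL2 M U₂

lemma exists_abs_le_of_periodic {f : ℝ → ℝ} {L : ℝ} (hc : Continuous f)
    (hp : Function.Periodic f L) (hL : 0 < L) : ∃ C, 0 ≤ C ∧ ∀ y, |f y| ≤ C := by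
  obtain ⟨C, hC⟩ := (hp.isBounded_of_continuous hL.ne' hc).exists_norm_le
  exact ⟨C, (norm_nonneg _).trans (hC _ (mem_range_self 0)), fun y => hC _ (mem_range_self y)⟩

lemma periodic_of_hasDerivAt {f f' : ℝ → ℝ} {L : ℝ} (hp : Function.Periodic f L)
    (hf : ∀ y, HasDerivAt f (f' y) y) : Function.Periodic f' L := by
  intro y
  have h1 : HasDerivAt (fun z => f (z + L)) (f' (y + L)) y := (hf (y + L)).comp_add_const y L
  have h2 : (fun z => f (z + L)) = f := funext hp
  rw [h2] at h1
  exact h1.unique (hf y)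

lemma abs_sub_le_of_hasDerivAt {f f' : ℝ → ℝ} {C : ℝ} (hf : ∀ y, HasDerivAt f (f' y) y)
    (hC : ∀ y, |f' y| ≤ C) (x y : ℝ) : |f x - f y| ≤ C * |x - y| :=
  Convex.norm_image_sub_le_of_norm_hasDerivWithin_le (f := f) (f' := f') (s := univ)
    (fun x _ => (hf x).hasDerivWithinAt) (fun x _ => hC x) convex_univ (mem_univ y) (mem_univ x)

section Sample

variable {N : ℕ} [NeZero N]

/-- Sampling of a function on the line at the lattice points. -/
def samp (h : ℝ) (f : ℝ → ℝ) (i : ZMod N) : ℝ := f (i.val * h)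

lemma samp_intCast {h : ℝ} {f : ℝ → ℝ} (hf : Function.Periodic f (N * h)) (k : ℤ) :
    samp h f (k : ZMod N) = f (k * h) := by
  have h1 : (((k : ZMod N).val : ℤ)) = k % N := ZMod.val_intCast k
  have h2 : (((k : ZMod N).val : ℝ)) = k - N * (k / N : ℤ) := by
    have e : (((k : ZMod N).val : ℤ)) = k - N * (k / N) := by rw [h1, Int.emod_def]
    exact_mod_cast congrArg (Int.cast : ℤ → ℝ) e
  rw [samp, h2, show ((k : ℝ) - N * (k / N : ℤ)) * h = k * h - (k / N : ℤ) * (N * h) by ring]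
  exact hf.sub_int_mul_eq _

lemma samp_add_one {h : ℝ} {f : ℝ → ℝ} (hf : Function.Periodic f (N * h)) (i : ZMod N) :
    samp h f (i + 1) = f (i.val * h + h) := by
  have : i + 1 = (((i.val : ℤ) + 1 : ℤ) : ZMod N) := by simp
  rw [this, samp_intCast hf]
  push_cast
  congr 1
  ring

lemma samp_sub_one {h : ℝ} {f : ℝ → ℝ} (hf : Function.Periodic f (N * h)) (i : ZMod N) :
    samp h f (i - 1) = f (i.val * h - h) := by
  have : i - 1 = (((i.val : ℤ) - 1 : ℤ) : ZMod N) := by simp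
  rw [this, samp_intCast hf]
  push_cast
  congr 1
  ring

lemma step_samp {h : ℝ} {f : ℝ → ℝ} (hf : Function.Periodic f (N * h)) (y : ℝ) :
    step h (samp (N := N) h f) y = f (⌊y / h⌋ * h) :=
  samp_intCast hf _

lemma fwd_samp {h : ℝ} {f : ℝ → ℝ} (hf : Function.Periodic f (N * h)) :
    fwd h (samp (N := N) h f) = samp h fun x => (f (x + h) - f x) / h := by
  ext i
  rw [fwd, samp_add_one hf]
  rfl

lemma bwd_samp {h : ℝ} {f : ℝ → ℝ} (hf : Function.Periodic f (N * h)) :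
    bwd h (samp (N := N) h f) = samp h fun x => (f x - f (x - h)) / h := by
  ext i
  rw [bwd, samp_sub_one hf]
  rfl

lemma abs_bwd_samp_le {h C : ℝ} (hh : 0 < h) {f : ℝ → ℝ} (hf : Function.Periodic f (N * h))
    (hC : ∀ x y, |f x - f y| ≤ C * |x - y|) (i : ZMod N) : |bwd h (samp h f) i| ≤ C := by
  rw [bwd_samp hf, samp, abs_div, abs_of_pos hh, div_le_iff₀ hh]
  have := hC (i.val * h) (i.val * h - h)
  rwa [sub_sub_cancel, abs_of_pos hh] at this

lemma abs_lap_samp_le {h C : ℝ} (hh : 0 < h) {f f' f'' : ℝ → ℝ}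
    (hf : Function.Periodic f (N * h)) (hd : ∀ y, HasDerivAt f (f' y) y)
    (hd' : ∀ y, HasDerivAt f' (f'' y) y) (hC : ∀ y, |f'' y| ≤ C) (i : ZMod N) :
    |lap h (samp h f) i| ≤ C := by
  rw [← bwd_fwd, fwd_samp hf]
  refine abs_bwd_samp_le hh (fun x => ?_) ?_ i
  · simp only [add_right_comm x, hf x, hf (x + h)]
  · refine abs_sub_le_of_hasDerivAt (f' := fun x => (f' (x + h) - f' x) / h) (fun y => ?_)
      fun y => ?_
    · exact (((hd (y + h)).comp_add_const y h).sub (hd y)).div_const h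
    · rw [abs_div, abs_of_pos hh, div_le_iff₀ hh]
      have := abs_sub_le_of_hasDerivAt hd' hC (y + h) y
      rwa [add_sub_cancel_left, abs_of_pos hh] at this

/-- The discrete second derivative is bounded in `L²` by the second derivative. -/
lemma nsq_lap_samp_le {h M : ℝ} (hh : 0 < h) (hM : N * h = M) {U₀ U₁ U₂ : ℝ → ℝ}
    (hp : Function.Periodic U₀ M) (dU : ∀ y, HasDerivAt U₀ (U₁ y) y)
    (dU₁ : IsPrim U₁ U₂) (sqU : PerL2 M U₂) :
    nsq h (lap h (samp (N := N) h U₀)) ≤ 4 * ∫ x in (0 : ℝ)..M, U₂ x ^ 2 := by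
  have hp' : Function.Periodic U₀ (N * h) := hM ▸ hp
  have hpt : ∀ x : ℝ, h * ((U₀ (x + h) - 2 * U₀ x + U₀ (x - h)) / h ^ 2) ^ 2 ≤
      2 * ∫ z in (x - h)..(x + h), U₂ z ^ 2 := by
    intro x
    set J := ∫ z in (x - h)..(x + h), |U₂ z| with hJ
    have habs : ∀ a b, IntervalIntegrable (fun z => |U₂ z|) volume a b := fun a b =>
      (sqU.int a b).abs
    have hle : x - h ≤ x + h := by linarith
    have h1 : |(U₀ (x + h) - U₀ x) - (U₀ x - U₀ (x - h))| ≤ J * h := by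
      have hder : ∀ z ∈ Icc (x - h) x, HasDerivWithinAt (fun z => U₀ (z + h) - U₀ z)
          (U₁ (z + h) - U₁ z) (Icc (x - h) x) z := fun z _ =>
        (((dU (z + h)).comp_add_const z h).fun_sub (dU z)).hasDerivWithinAt
      have hbd : ∀ z ∈ Icc (x - h) x, ‖U₁ (z + h) - U₁ z‖ ≤ J := by
        intro z hz
        rw [dU₁.2 z (z + h)]
        refine (intervalIntegral.norm_integral_le_integral_norm (by linarith)).trans ?_
        simp only [Real.norm_eq_abs]
        exact intervalIntegral.integral_mono_interval hz.1 (by linarith) (by linarith [hz.2])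
          (Eventually.of_forall fun z => abs_nonneg _) (habs _ _)
      have := Convex.norm_image_sub_le_of_norm_hasDerivWithin_le hder hbd (convex_Icc _ _)
        (left_mem_Icc.2 (by linarith)) (right_mem_Icc.2 (by linarith))
      simpa [abs_of_pos hh] using this
    have h2 : J ^ 2 ≤ (x + h - (x - h)) * ∫ z in (x - h)..(x + h), U₂ z ^ 2 := by
      have := sq_intervalIntegral_le_of_integrable hle (habs _ _)
        (by simpa only [sq_abs] using sqU.sq _ _)
      simpa only [sq_abs] using this
    have h3 : (U₀ (x + h) - 2 * U₀ x + U₀ (x - h)) ^ 2 ≤ J ^ 2 * h ^ 2 := by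
      rw [← mul_pow, ← sq_abs, show U₀ (x + h) - 2 * U₀ x + U₀ (x - h) =
        (U₀ (x + h) - U₀ x) - (U₀ x - U₀ (x - h)) by ring]
      gcongr
    calc h * ((U₀ (x + h) - 2 * U₀ x + U₀ (x - h)) / h ^ 2) ^ 2
        = (U₀ (x + h) - 2 * U₀ x + U₀ (x - h)) ^ 2 / h ^ 3 := by field_simp
      _ ≤ J ^ 2 * h ^ 2 / h ^ 3 := by gcongr
      _ = J ^ 2 / h := by field_simp
      _ ≤ (x + h - (x - h)) * (∫ z in (x - h)..(x + h), U₂ z ^ 2) / h := by gcongr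
      _ = 2 * ∫ z in (x - h)..(x + h), U₂ z ^ 2 := by field_simp; ring
  have hsum : ∀ c : ℝ, ∑ k ∈ Finset.range N, ∫ z in (c + k * h)..(c + (k + 1 : ℕ) * h), U₂ z ^ 2 =
      ∫ x in (0 : ℝ)..M, U₂ x ^ 2 := by
    intro c
    have := intervalIntegral.sum_integral_adjacent_intervals (μ := volume) (n := N)
      (f := fun z => U₂ z ^ 2) (a := fun k : ℕ => c + k * h) fun k _ => sqU.sq _ _
    rw [this, hM]
    have hper : Function.Periodic (fun z => U₂ z ^ 2) M := fun z => by
      simp only [sqU.periodic z]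
    simpa using hper.intervalIntegral_add_eq c 0
  calc nsq h (lap h (samp (N := N) h U₀))
      = ∑ i : ZMod N, h * ((U₀ (i.val * h + h) - 2 * U₀ (i.val * h) + U₀ (i.val * h - h)) /
          h ^ 2) ^ 2 := by
        rw [nsq, Finset.mul_sum]
        refine Finset.sum_congr rfl fun i _ => ?_
        rw [lap, samp_add_one hp', samp_sub_one hp']
        rfl
    _ ≤ ∑ i : ZMod N, 2 * ∫ z in (i.val * h - h)..(i.val * h + h), U₂ z ^ 2 :=
        Finset.sum_le_sum fun i _ => hpt _
    _ = ∑ k ∈ Finset.range N, 2 * ∫ z in (k * h - h)..(k * h + h), U₂ z ^ 2 := by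
        rw [sum_val_eq_sum_range]
        refine Finset.sum_congr rfl fun k hk => ?_
        rw [ZMod.val_cast_of_lt (Finset.mem_range.1 hk)]
    _ = 2 * ((∑ k ∈ Finset.range N, ∫ z in (-h + k * h)..(-h + (k + 1 : ℕ) * h), U₂ z ^ 2) +
          ∑ k ∈ Finset.range N, ∫ z in (0 + k * h)..(0 + (k + 1 : ℕ) * h), U₂ z ^ 2) := by
        rw [← Finset.sum_add_distrib, Finset.mul_sum]
        refine Finset.sum_congr rfl fun k _ => ?_
        rw [← intervalIntegral.integral_add_adjacent_intervals (b := k * h) (sqU.sq _ _)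
          (sqU.sq _ _)]
        rw [show -h + (k : ℝ) * h = k * h - h by ring,
          show -h + ((k + 1 : ℕ) : ℝ) * h = k * h by push_cast; ring, zero_add, zero_add,
          show ((k + 1 : ℕ) : ℝ) * h = k * h + h by push_cast; ring]
    _ = 4 * ∫ x in (0 : ℝ)..M, U₂ x ^ 2 := by rw [hsum, hsum]; ring

/-- The discrete potential velocity attached to the initial data. -/
def sampV (h : ℝ) (τ₀ U₀ : ℝ → ℝ) (i : ZMod N) : ℝ :=
  samp h U₀ i + bwd h (samp h fun z => 1 / (2 * τ₀ z ^ 2)) i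

end Sample

/-- Mesh-independent bounds for sampled initial data. -/
lemma IsLagData.exists_bounds {M : ℝ} {τ₀ τ₁ F₁ F₂ U₀ U₁ U₂ : ℝ → ℝ}
    (H : IsLagData M τ₀ τ₁ F₁ F₂ U₀ U₁ U₂) :
    ∃ m b U K G Z₀ : ℝ, 0 < m ∧ 0 < b ∧ 0 ≤ U ∧ 0 ≤ K ∧ 0 ≤ G ∧ 0 ≤ Z₀ ∧
      (∀ y, m ≤ τ₀ y ∧ τ₀ y ≤ b ∧ |U₀ y| ≤ U) ∧
      ∀ (N : ℕ) [NeZero N] (h : ℝ), 0 < h → N * h = M → ∀ i : ZMod N,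
        |sampV h τ₀ U₀ i| ≤ K ∧ |fwd h (sampV h τ₀ U₀) i| ≤ G ∧
        nsq h (bwd h fun j : ZMod N => fwd h (samp h U₀) j / samp h τ₀ j ^ 3) ≤ Z₀ := by
  have hM := H.mass_pos
  have cτ₀ : Continuous τ₀ := continuous_iff_continuousAt.2 fun y => (H.dτ y).continuousAt
  have cU₀ : Continuous U₀ := continuous_iff_continuousAt.2 fun y => (H.dU y).continuousAt
  have cF₁ : Continuous F₁ := continuous_iff_continuousAt.2 fun y => (H.dF₁ y).continuousAt
  set P : ℝ → ℝ := fun y => 1 / τ₀ y ^ 3 with hP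
  set P' : ℝ → ℝ := fun y => -(3 * τ₁ y / τ₀ y ^ 4) with hP'
  have dP : ∀ y, HasDerivAt P (P' y) y := by
    intro y
    have hpos := H.pos y
    have h1 := ((H.dτ y).fun_pow 3).fun_inv (by positivity)
    simp only [hP, one_div]
    refine h1.congr_deriv ?_
    simp only [hP']
    push_cast
    field_simp
  have cP' : Continuous P' :=
    ((continuous_const.mul H.cτ).div (cτ₀.pow 4) fun y => (pow_pos (H.pos y) 4).ne').neg
  have pP : Function.Periodic P M := fun y => by simp only [hP, H.periodic_τ y]
  have pF : Function.Periodic (fun z => 1 / (2 * τ₀ z ^ 2)) M := fun y => by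
    simp only [H.periodic_τ y]
  have pF₁ := periodic_of_hasDerivAt pF H.dF
  have cP : Continuous P := continuous_iff_continuousAt.2 fun y => (dP y).continuousAt
  have cI : Continuous fun y => 1 / τ₀ y :=
    continuous_const.div cτ₀ fun y => (H.pos y).ne'
  obtain ⟨I, hI0, hI⟩ := exists_abs_le_of_periodic cI
    (fun y => by simp only [H.periodic_τ y]) hM
  obtain ⟨b, hb0, hb⟩ := exists_abs_le_of_periodic cτ₀ H.periodic_τ hM
  obtain ⟨U, hU0, hU⟩ := exists_abs_le_of_periodic cU₀ H.periodic_U hM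
  obtain ⟨u₁, hu₁0, hu₁⟩ := exists_abs_le_of_periodic H.cU (periodic_of_hasDerivAt H.periodic_U H.dU) hM
  obtain ⟨f₁, hf₁0, hf₁⟩ := exists_abs_le_of_periodic cF₁ pF₁ hM
  obtain ⟨f₂, hf₂0, hf₂⟩ := exists_abs_le_of_periodic H.cF₂ (periodic_of_hasDerivAt pF₁ H.dF₁) hM
  obtain ⟨p, hp0, hp⟩ := exists_abs_le_of_periodic cP pP hM
  obtain ⟨p', hp'0, hp'⟩ := exists_abs_le_of_periodic cP' (periodic_of_hasDerivAt pP dP) hM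
  have hJ : 0 ≤ ∫ x in (0 : ℝ)..M, U₂ x ^ 2 :=
    intervalIntegral.integral_nonneg hM.le fun x _ => sq_nonneg _
  refine ⟨1 / (I + 1), b + 1, U, U + f₁, u₁ + f₂,
    2 * (M * (u₁ * p') ^ 2) + 2 * p ^ 2 * (4 * ∫ x in (0 : ℝ)..M, U₂ x ^ 2), by positivity,
    by positivity, hU0, by positivity, by positivity, by positivity, fun y => ⟨?_, ?_, hU y⟩, ?_⟩
  · have h1 := hI y
    rw [abs_of_pos (by have := H.pos y; positivity), div_le_iff₀ (H.pos y)] at h1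
    rw [div_le_iff₀ (by positivity)]
    nlinarith [H.pos y]
  · linarith [le_abs_self (τ₀ y), hb y]
  · intro N _ h hh hNh i
    have hper : ∀ {f : ℝ → ℝ}, Function.Periodic f M → Function.Periodic f (N * h) :=
      fun hf => hNh ▸ hf
    have bU : ∀ j : ZMod N, |bwd h (samp h U₀) j| ≤ u₁ := abs_bwd_samp_le hh (hper H.periodic_U)
      (abs_sub_le_of_hasDerivAt H.dU hu₁)
    have bF : ∀ j : ZMod N, |bwd h (samp h fun z => 1 / (2 * τ₀ z ^ 2)) j| ≤ f₁ :=
      abs_bwd_samp_le hh (hper pF) (abs_sub_le_of_hasDerivAt H.dF hf₁)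
    have bP : ∀ j : ZMod N, |bwd h (samp h P) j| ≤ p' := abs_bwd_samp_le hh (hper pP)
      (abs_sub_le_of_hasDerivAt dP hp')
    refine ⟨(abs_add_le _ _).trans (add_le_add (hU _) (bF i)), ?_, ?_⟩
    · have e : fwd h (sampV h τ₀ U₀) i =
          bwd h (samp h U₀) (i + 1) + lap h (samp h fun z => 1 / (2 * τ₀ z ^ 2)) i := by
        rw [← fwd_eq_bwd, ← fwd_bwd]
        simp only [fwd, sampV]
        ring
      rw [e]
      exact (abs_add_le _ _).trans (add_le_add (bU _)
        (abs_lap_samp_le hh (hper pF) H.dF H.dF₁ hf₂ i))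
    · have e : (fun j : ZMod N => fwd h (samp h U₀) j / samp h τ₀ j ^ 3) =
          fun j => fwd h (samp h U₀) j * samp h P j := by
        ext j
        simp only [samp, hP]
        ring
      rw [e]
      have e2 : ∀ j : ZMod N, bwd h (fun j => fwd h (samp h U₀) j * samp h P j) j ^ 2 ≤
          2 * (u₁ * p') ^ 2 + 2 * p ^ 2 * lap h (samp h U₀) j ^ 2 := by
        intro j
        have e3 : bwd h (fun j => fwd h (samp h U₀) j * samp h P j) j =
            fwd h (samp h U₀) j * bwd h (samp h P) j + samp h P (j - 1) * lap h (samp h U₀) j := by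
          rw [← bwd_fwd]
          simp only [bwd]
          ring
        have e4 : (fwd h (samp h U₀) j * bwd h (samp h P) j) ^ 2 ≤ (u₁ * p') ^ 2 := by
          rw [← sq_abs, abs_mul, fwd_eq_bwd]
          have := bU (j + 1)
          have := bP j
          gcongr
        have e5 : (samp h P (j - 1) * lap h (samp h U₀) j) ^ 2 ≤
            p ^ 2 * lap h (samp h U₀) j ^ 2 := by
          rw [mul_pow, ← sq_abs (samp h P (j - 1))]
          have : |samp h P (j - 1)| ≤ p := hp _
          gcongr
        have e6 : ∀ x y : ℝ, (x + y) ^ 2 ≤ 2 * x ^ 2 + 2 * y ^ 2 := fun x y => by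
          nlinarith [sq_nonneg (x - y)]
        rw [e3]
        refine (e6 _ _).trans ?_
        linarith
      calc nsq h (bwd h fun j : ZMod N => fwd h (samp h U₀) j * samp h P j)
          ≤ h * ∑ j : ZMod N, (2 * (u₁ * p') ^ 2 + 2 * p ^ 2 * lap h (samp h U₀) j ^ 2) :=
            mul_le_mul_of_nonneg_left (Finset.sum_le_sum fun j _ => e2 j) hh.le
        _ = 2 * (M * (u₁ * p') ^ 2) + 2 * p ^ 2 * nsq h (lap h (samp (N := N) h U₀)) := by
            simp only [Finset.sum_add_distrib, ← Finset.mul_sum]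
            rw [Finset.sum_const, card_zmod_univ, nsmul_eq_mul, nsq, ← hNh]
            ring
        _ ≤ _ := by
            have := nsq_lap_samp_le (N := N) hh hNh H.periodic_U H.dU H.dU₁ H.sqU
            gcongr

/-! ### Approximate solutions and their limits -/

lemma IsLatticeFlow.mono {N : ℕ} {h T T' : ℝ} {V : ZMod N → ℝ} {τ u : ℝ → ZMod N → ℝ}
    (H : IsLatticeFlow h T V τ u) (hT : T' ≤ T) : IsLatticeFlow h T' V τ u :=
  have hs : Icc 0 T' ⊆ Icc 0 T := Icc_subset_Icc_right hT
  ⟨fun t ht => H.pos t (hs ht), fun t ht => H.vel t (hs ht), fun t ht => H.dτ t (hs ht),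
    fun t ht => H.du t (hs ht)⟩

/-- All the mesh-independent bounds on a lattice flow over `[0, T]`. -/
structure LatticeBounds {N : ℕ} [NeZero N] (h T C : ℝ) (τ u : ℝ → ZMod N → ℝ) : Prop where
  regτ : LatticeReg h T C τ
  regu : LatticeReg h T C u
  regσ : LatticeReg h T C (flux h τ u)
  fwdu : ∀ t ∈ Icc 0 T, ∀ i, |fwd h (u t) i| ≤ C
  lapσ : ∫ t in (0 : ℝ)..T, nsq h (lap h (flux h τ u t)) ≤ C
  lapw : ∫ t in (0 : ℝ)..T, nsq h (lap h (fwd h (u t))) ≤ C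

/-- A sequence of lattice flows with mesh tending to zero and initial data sampled from
`τ₀`, `U₀`. -/
structure IsApprox (M a U : ℝ) (τ₀ U₀ : ℝ → ℝ) (N : ℕ → ℕ) [∀ n, NeZero (N n)]
    (τ u : ∀ n, ℝ → ZMod (N n) → ℝ) : Prop where
  mesh : Tendsto (fun n => M / N n) atTop (𝓝 0)
  flow : ∀ T : ℕ, ∀ᶠ n in atTop, IsLatticeFlow (M / N n) T (sampV (M / N n) τ₀ U₀) (τ n) (u n)
  initτ : ∀ n, τ n 0 = samp (M / N n) τ₀
  initu : ∀ n, u n 0 = samp (M / N n) U₀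
  low : ∀ T : ℕ, ∀ᶠ n in atTop, ∀ t ∈ Icc (0 : ℝ) T, ∀ i, a ≤ τ n t i ∧ |u n t i| ≤ U
  reg : ∀ T : ℕ, ∃ C, ∀ᶠ n in atTop, LatticeBounds (M / N n) T C (τ n) (u n)

lemma IsApprox.comp {M a U : ℝ} {τ₀ U₀ : ℝ → ℝ} {N : ℕ → ℕ} [∀ n, NeZero (N n)]
    {τ u : ∀ n, ℝ → ZMod (N n) → ℝ} (H : IsApprox M a U τ₀ U₀ N τ u) {φ : ℕ → ℕ}
    (hφ : StrictMono φ) :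
    IsApprox M a U τ₀ U₀ (fun n => N (φ n)) (fun n => τ (φ n)) (fun n => u (φ n)) :=
  ⟨H.mesh.comp hφ.tendsto_atTop, fun T => hφ.tendsto_atTop.eventually (H.flow T),
    fun _ => H.initτ _, fun _ => H.initu _, fun T => hφ.tendsto_atTop.eventually (H.low T),
    fun T => let ⟨C, hC⟩ := H.reg T; ⟨C, hφ.tendsto_atTop.eventually hC⟩⟩

theorem IsLagData.exists_approx {M : ℝ} {τ₀ τ₁ F₁ F₂ U₀ U₁ U₂ : ℝ → ℝ}
    (H : IsLagData M τ₀ τ₁ F₁ F₂ U₀ U₁ U₂) :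
    ∃ a U : ℝ, 0 < a ∧ ∃ τ u : ∀ n : ℕ, ℝ → ZMod (n + 1) → ℝ,
      IsApprox M a U τ₀ U₀ (fun n => n + 1) τ u := by
  obtain ⟨m, b, U, K, G, Z₀, hm, hb, hU, hK, hG, hZ, h1, h2⟩ := H.exists_bounds
  have hM := H.mass_pos
  set D := 1 / m ^ 2 + 2 * (M * (K + U)) with hD
  have hD0 : 0 < D := by positivity
  set a := 1 / √D with ha
  have ha0 : 0 < a := by positivity
  have hsq : a ^ 2 = 1 / D := by rw [ha, div_pow, Real.sq_sqrt hD0.le, one_pow]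
  have ham : a ≤ m := by
    refine (pow_le_pow_iff_left₀ ha0.le hm.le two_ne_zero).1 ?_
    rw [hsq, div_le_iff₀ hD0, hD, mul_add, mul_one_div_cancel (by positivity)]
    have : 0 ≤ m ^ 2 * (2 * (M * (K + U))) := by positivity
    linarith
  have hh : ∀ n : ℕ, 0 < M / ((n + 1 : ℕ) : ℝ) := fun n => by positivity
  have hNh : ∀ n : ℕ, ((n + 1 : ℕ) : ℝ) * (M / ((n + 1 : ℕ) : ℝ)) = M := fun n => by
    field_simp
  have key : ∀ n : ℕ, ∃ τ u : ℝ → ZMod (n + 1) → ℝ,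
      IsLatticeFlow (M / ((n + 1 : ℕ) : ℝ)) n (sampV (M / ((n + 1 : ℕ) : ℝ)) τ₀ U₀) τ u ∧
      τ 0 = samp (M / ((n + 1 : ℕ) : ℝ)) τ₀ ∧ u 0 = samp (M / ((n + 1 : ℕ) : ℝ)) U₀ ∧
      ∀ t ∈ Icc (0 : ℝ) n, ∀ i, a ≤ τ t i ∧ τ t i ≤ b + G * t ∧ |u t i| ≤ U := by
    intro n
    have hb2 := h2 (n + 1) _ (hh n) (hNh n)
    refine exists_latticeFlow (m := m) (K := K + U) (hh n) (Nat.cast_nonneg n) ha0 ham _ _ _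
      (fun i => ?_) (fun i => add_le_add_left (hb2 i).1 U) ?_ (fun i => (h1 _).1)
      (fun i => (h1 _).2.1) (fun i => (h1 _).2.2) (fun i => (le_abs_self _).trans (hb2 i).2.1)
    · exact (add_sub_cancel_right _ _).symm
    · rw [hNh, hsq, hD]
      field_simp
      exact le_rfl
  choose τ u hflow hτ0 hu0 hbd using key
  refine ⟨a, U, ha0, τ, u, ?_, fun T => ?_, hτ0, hu0, fun T => ?_, fun T => ?_⟩
  · have := (tendsto_one_div_add_atTop_nhds_zero_nat (𝕜 := ℝ)).const_mul M
    simp only [mul_zero, mul_one_div] at this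
    simpa using this
  · filter_upwards [eventually_ge_atTop T] with n hn
    exact (hflow n).mono (by exact_mod_cast hn)
  · filter_upwards [eventually_ge_atTop T] with n hn t ht i
    have := hbd n t ⟨ht.1, ht.2.trans (by exact_mod_cast hn)⟩ i
    exact ⟨this.1, this.2.2⟩
  · obtain ⟨C, hC⟩ := exists_lattice_bounds (M := M) (a := a) (b := b + G * T) (K := K + U)
      (G := G) (Z₀ := Z₀) (U := U) (T := T) hM ha0 (Nat.cast_nonneg T) hZ (by positivity) hG
      (by positivity)
    refine ⟨C, ?_⟩
    filter_upwards [eventually_ge_atTop T] with n hn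
    have hT : ∀ t ∈ Icc (0 : ℝ) T, t ∈ Icc (0 : ℝ) n := fun t ht =>
      ⟨ht.1, ht.2.trans (by exact_mod_cast hn)⟩
    have hb2 := h2 (n + 1) _ (hh n) (hNh n)
    have e1 : ∀ t ∈ Icc (0 : ℝ) T, ∀ i, a ≤ τ n t i ∧ τ n t i ≤ b + G * T := fun t ht i => by
      have := hbd n t (hT t ht) i
      refine ⟨this.1, this.2.1.trans ?_⟩
      have := ht.2
      gcongr
    have e2 : ∀ t ∈ Icc (0 : ℝ) T, ∀ i,
        |sampV (M / ((n + 1 : ℕ) : ℝ)) τ₀ U₀ i - u n t i| ≤ K + U := fun t ht i =>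
      (abs_sub _ _).trans (add_le_add (hb2 i).1 (hbd n t (hT t ht) i).2.2)
    have e3 : nsq (M / ((n + 1 : ℕ) : ℝ))
        (bwd (M / ((n + 1 : ℕ) : ℝ)) (flux (M / ((n + 1 : ℕ) : ℝ)) (τ n) (u n) 0)) ≤ Z₀ := by
      have := (hb2 0).2.2
      unfold flux
      rw [hτ0, hu0]
      exact this
    obtain ⟨r1, r2, r3, r4, r5, r6⟩ := hC (n + 1) (M / ((n + 1 : ℕ) : ℝ)) _ (τ n) (u n) (hh n)
      (hNh n) ((hflow n).mono (by exact_mod_cast hn)) e1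
      (fun t ht i => (hbd n t (hT t ht) i).2.2) e2 (fun i => (hb2 i).2.1) e3
    exact ⟨r1, r2, r3, r4, r5, r6⟩

lemma abs_sub_le_moduli {A B C D x y z : ℝ} (hAB : (x - y) ^ 2 ≤ A * C)
    (hBC : (y - z) ^ 2 ≤ B * D) : |x - z| ≤ √(A * C) + √(B * D) := by
  calc |x - z| = |(x - y) + (y - z)| := by ring_nf
    _ ≤ |x - y| + |y - z| := abs_add_le _ _
    _ ≤ _ := add_le_add (Real.abs_le_sqrt hAB) (Real.abs_le_sqrt hBC)

/-- Joint continuity from square-root moduli in space and time. -/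
lemma continuous_of_moduli {M : ℝ} (hM : 0 < M) {g : ℝ → ℝ → ℝ} (hmax : ∀ t, g (max t 0) = g t)
    (hg : ∀ T : ℕ, ∃ C, (∀ t ∈ Icc (0 : ℝ) T, ∀ y z, |z - y| < M →
        (g t z - g t y) ^ 2 ≤ |z - y| * C) ∧
      ∀ s ∈ Icc (0 : ℝ) T, ∀ t ∈ Icc (0 : ℝ) T, ∀ y, (g t y - g s y) ^ 2 ≤ C * √|t - s|) :
    Continuous (Function.uncurry g) := by
  rw [continuous_iff_continuousAt]
  rintro ⟨t, y⟩
  obtain ⟨T, hT⟩ := exists_nat_gt (max t 0 + 1)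
  obtain ⟨C, h1, h2⟩ := hg T
  rw [ContinuousAt, tendsto_iff_norm_sub_tendsto_zero]
  have hlim : Tendsto (fun q : ℝ × ℝ => √(|q.2 - y| * C) + √(C * √|max q.1 0 - max t 0|))
      (𝓝 (t, y)) (𝓝 0) := by
    have : Continuous fun q : ℝ × ℝ => √(|q.2 - y| * C) + √(C * √|max q.1 0 - max t 0|) := by
      fun_prop
    have h3 := this.tendsto (t, y)
    simpa using h3
  refine squeeze_zero' (Eventually.of_forall fun _ => norm_nonneg _) ?_ hlim
  have hn : ∀ᶠ q : ℝ × ℝ in 𝓝 (t, y), |q.2 - y| < M ∧ q.1 < t + 1 := by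
    refine ((continuous_snd.sub continuous_const).abs.continuousAt.eventually_lt
      continuousAt_const ?_).and ?_
    · simpa using hM
    · exact continuous_fst.continuousAt.eventually_lt continuousAt_const (by simp)
  filter_upwards [hn] with q hq
  have ht0 : max t 0 ∈ Icc (0 : ℝ) T := ⟨le_max_right _ _, by linarith⟩
  have hq0 : max q.1 0 ∈ Icc (0 : ℝ) T := by
    refine ⟨le_max_right _ _, ?_⟩
    have h4 : max q.1 0 ≤ max t 0 + 1 :=
      max_le (by linarith [le_max_left t 0, hq.2]) (by linarith [le_max_right t 0])
    linarith
  have e1 := h1 _ hq0 y q.2 hq.1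
  have e2 := h2 _ ht0 _ hq0 y
  rw [hmax] at e1
  rw [hmax, hmax] at e2
  exact abs_sub_le_moduli e1 e2

section Limit

set_option linter.unusedSectionVars false

variable {M a U : ℝ} {τ₀ U₀ : ℝ → ℝ} {N : ℕ → ℕ} [∀ n, NeZero (N n)]
  {τn un : ∀ n, ℝ → ZMod (N n) → ℝ}

lemma mesh_pos (hM : 0 < M) (n : ℕ) : 0 < M / N n :=
  div_pos hM (by exact_mod_cast Nat.pos_of_ne_zero (NeZero.ne (N n)))

lemma mesh_mul (M : ℝ) (n : ℕ) : (N n : ℝ) * (M / N n) = M := by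
  have : (N n : ℝ) ≠ 0 := by exact_mod_cast NeZero.ne (N n)
  field_simp

/-- The regularity class of sequences of lattice functions to which compactness applies. -/
def SeqReg (M : ℝ) (fn : ∀ n, ℝ → ZMod (N n) → ℝ) : Prop :=
  ∀ T : ℕ, ∃ C, ∀ᶠ n in atTop, LatticeReg (M / N n) T C (fn n)

lemma IsApprox.seqReg_τ (H : IsApprox M a U τ₀ U₀ N τn un) : SeqReg M τn := fun T =>
  let ⟨C, hC⟩ := H.reg T; ⟨C, hC.mono fun _ h => h.regτ⟩

lemma IsApprox.seqReg_u (H : IsApprox M a U τ₀ U₀ N τn un) : SeqReg M un := fun T =>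
  let ⟨C, hC⟩ := H.reg T; ⟨C, hC.mono fun _ h => h.regu⟩

lemma IsApprox.seqReg_flux (H : IsApprox M a U τ₀ U₀ N τn un) :
    SeqReg M fun n => flux (M / N n) (τn n) (un n) := fun T =>
  let ⟨C, hC⟩ := H.reg T; ⟨C, hC.mono fun _ h => h.regσ⟩

lemma SeqReg.bound {fn : ∀ n, ℝ → ZMod (N n) → ℝ} (H : SeqReg M fn) (t y : ℝ) :
    ∃ C, ∀ᶠ n in atTop, |step (M / N n) (fn n (max t 0)) y| ≤ C := by
  obtain ⟨T, hT⟩ := exists_nat_gt (max t 0)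
  obtain ⟨C, hC⟩ := H T
  exact ⟨C, hC.mono fun n hn => hn.bound _ ⟨le_max_right _ _, hT.le⟩ _⟩

lemma SeqReg.equicont {fn : ∀ n, ℝ → ZMod (N n) → ℝ} (H : SeqReg M fn) (hM : 0 < M)
    (hmesh : Tendsto (fun n => M / N n) atTop (𝓝 0)) (p : ℝ × ℝ) {ε : ℝ} (hε : 0 < ε) :
    ∃ W ∈ 𝓝 p, ∀ᶠ n in atTop, ∀ q ∈ W, |step (M / N n) (fn n (max q.1 0)) q.2 -
      step (M / N n) (fn n (max p.1 0)) p.2| ≤ ε := by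
  obtain ⟨t, y⟩ := p
  obtain ⟨T, hT⟩ := exists_nat_gt (max t 0 + 1)
  obtain ⟨C, hC⟩ := H T
  have hpair : Tendsto (fun q : (ℝ × ℝ) × ℕ => (q.1, M / (N q.2 : ℝ))) (𝓝 (t, y) ×ˢ atTop)
      (𝓝 ((t, y), 0)) := by
    have h1 : Tendsto (fun q : (ℝ × ℝ) × ℕ => M / (N q.2 : ℝ)) (𝓝 (t, y) ×ˢ atTop) (𝓝 0) :=
      hmesh.comp tendsto_snd
    have h2 : Tendsto (fun q : (ℝ × ℝ) × ℕ => q.1) (𝓝 (t, y) ×ˢ atTop) (𝓝 (t, y)) := tendsto_fst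
    exact h2.prodMk_nhds h1
  have hlim : Tendsto (fun q : (ℝ × ℝ) × ℕ =>
      √((|q.1.2 - y| + M / N q.2) * C) + √(C * √|max q.1.1 0 - max t 0|))
      (𝓝 (t, y) ×ˢ atTop) (𝓝 0) := by
    have hc : Continuous fun q : (ℝ × ℝ) × ℝ =>
        √((|q.1.2 - y| + q.2) * C) + √(C * √|max q.1.1 0 - max t 0|) := by fun_prop
    have h3 := (hc.tendsto ((t, y), 0)).comp hpair
    simpa only [sub_self, abs_zero, add_zero, zero_mul, Real.sqrt_zero, mul_zero,
      Function.comp_def] using h3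
  have hlim2 : Tendsto (fun q : (ℝ × ℝ) × ℕ => |q.1.2 - y| + M / N q.2)
      (𝓝 (t, y) ×ˢ atTop) (𝓝 0) := by
    have hc : Continuous fun q : (ℝ × ℝ) × ℝ => |q.1.2 - y| + q.2 := by fun_prop
    have h3 := (hc.tendsto ((t, y), 0)).comp hpair
    simpa only [sub_self, abs_zero, add_zero, Function.comp_def] using h3
  have hn : ∀ᶠ q : ℝ × ℝ in 𝓝 (t, y), q.1 < t + 1 :=
    continuous_fst.continuousAt.eventually_lt continuousAt_const (by simp)
  have hall := ((hlim.eventually_lt_const hε).and (hlim2.eventually_lt_const hM)).and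
    ((hn.prod_inl atTop).and (hC.prod_inr (𝓝 (t, y))))
  obtain ⟨pa, hpa, pb, hpb, hab⟩ := eventually_prod_iff.1 hall
  refine ⟨_, hpa, hpb.mono fun n hn q hq => ?_⟩
  obtain ⟨⟨e1, e2⟩, e3, e4⟩ := hab hq hn
  simp only at e1 e2 e3 e4
  have ht0 : max t 0 ∈ Icc (0 : ℝ) T := ⟨le_max_right _ _, by linarith⟩
  have hq0 : max q.1 0 ∈ Icc (0 : ℝ) T := by
    refine ⟨le_max_right _ _, ?_⟩
    have h4 : max q.1 0 ≤ max t 0 + 1 :=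
      max_le (by linarith [le_max_left t 0]) (by linarith [le_max_right t 0])
    linarith
  refine (abs_sub_le_moduli (y := step (M / N n) (fn n (max q.1 0)) y) ?_ ?_).trans e1.le
  · exact sq_step_sub_le (mesh_pos hM n) (mesh_mul M n) _ (e4.space _ hq0) e2.le
  · exact e4.time _ ht0 _ hq0 _

/-- Convergence of the step functions at all points and all nonnegative times. -/
def StepLim (M : ℝ) (fn : ∀ n, ℝ → ZMod (N n) → ℝ) (g : ℝ → ℝ → ℝ) : Prop :=
  ∀ t y, Tendsto (fun n => step (M / N n) (fn n (max t 0)) y) atTop (𝓝 (g t y))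

lemma StepLim.of_nonneg {fn : ∀ n, ℝ → ZMod (N n) → ℝ} {g : ℝ → ℝ → ℝ} (H : StepLim M fn g)
    {t : ℝ} (ht : 0 ≤ t) (y : ℝ) :
    Tendsto (fun n => step (M / N n) (fn n t) y) atTop (𝓝 (g t y)) := by
  have := H t y
  rwa [max_eq_left ht] at this

lemma StepLim.max_eq {fn : ∀ n, ℝ → ZMod (N n) → ℝ} {g : ℝ → ℝ → ℝ} (H : StepLim M fn g)
    (t : ℝ) : g (max t 0) = g t := by
  ext y
  have := H.of_nonneg (le_max_right t 0) y
  exact tendsto_nhds_unique this (H t y)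

lemma StepLim.periodic {fn : ∀ n, ℝ → ZMod (N n) → ℝ} {g : ℝ → ℝ → ℝ} (H : StepLim M fn g)
    (hM : 0 < M) (t : ℝ) : Function.Periodic (g t) M := by
  intro y
  refine tendsto_nhds_unique (H t (y + M)) ?_
  simp only [(periodic_step (mesh_pos hM _) (mesh_mul M _) _) y]
  exact H t y

lemma StepLim.continuous {fn : ∀ n, ℝ → ZMod (N n) → ℝ} {g : ℝ → ℝ → ℝ} (H : StepLim M fn g)
    (hreg : SeqReg M fn) (hM : 0 < M) (hmesh : Tendsto (fun n => M / N n) atTop (𝓝 0)) :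
    Continuous (Function.uncurry g) := by
  refine continuous_of_moduli hM H.max_eq fun T => ?_
  obtain ⟨C, hC⟩ := hreg T
  refine ⟨C, fun t ht y z hyz => ?_, fun s hs t ht y => ?_⟩
  · have h1 := ((H.of_nonneg ht.1 z).sub (H.of_nonneg ht.1 y)).pow 2
    have h2 := (hmesh.const_add |z - y|).mul_const C
    rw [add_zero] at h2
    refine le_of_tendsto_of_tendsto h1 h2 ?_
    have h3 := (hmesh.const_add |z - y|).eventually_lt_const (u := M) (by simpa using hyz)
    filter_upwards [hC, h3] with n hn hn'
    exact sq_step_sub_le (mesh_pos hM n) (mesh_mul M n) _ (hn.space _ ht) hn'.le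
  · have h1 := ((H.of_nonneg ht.1 y).sub (H.of_nonneg hs.1 y)).pow 2
    refine le_of_tendsto h1 ?_
    filter_upwards [hC] with n hn
    exact hn.time _ hs _ ht _

/-- A shift by one lattice site does not affect the limit. -/
lemma StepLim.shift {fn : ∀ n, ℝ → ZMod (N n) → ℝ} {g : ℝ → ℝ → ℝ} (H : StepLim M fn g)
    (hreg : SeqReg M fn) (hM : 0 < M) (hmesh : Tendsto (fun n => M / N n) atTop (𝓝 0))
    {t : ℝ} (ht : 0 ≤ t) (y : ℝ) :
    Tendsto (fun n => step (M / N n) (fun i => fn n t (i + 1)) y) atTop (𝓝 (g t y)) := by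
  obtain ⟨T, hT⟩ := exists_nat_gt t
  obtain ⟨C, hC⟩ := hreg T
  have h1 : Tendsto (fun n => step (M / N n) (fn n t) (y + M / N n) - step (M / N n) (fn n t) y)
      atTop (𝓝 0) := by
    have h2 : Tendsto (fun n => √((M / N n + M / N n) * C)) atTop (𝓝 0) := by
      have := ((hmesh.add hmesh).mul_const C).sqrt
      simpa using this
    refine squeeze_zero_norm' ?_ h2
    have h3 := (hmesh.add hmesh).eventually_lt_const (u := M) (by simpa using hM)
    filter_upwards [hC, h3] with n hn hn'
    have hp := mesh_pos (N := N) hM n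
    have := sq_step_sub_le hp (mesh_mul M n) (fn n t) (hn.space _ ⟨ht, hT.le⟩)
      (y := y) (z := y + M / N n) (by rw [add_sub_cancel_left, abs_of_pos hp]; exact hn'.le)
    rw [add_sub_cancel_left, abs_of_pos hp] at this
    exact Real.abs_le_sqrt this
  have h4 := h1.add (H.of_nonneg ht y)
  simp only [sub_add_cancel, zero_add] at h4
  refine h4.congr fun n => ?_
  rw [step_add_mesh (mesh_pos hM n).ne']
  rfl

end Limit

theorem IsLagData.exists_limit {M : ℝ} {τ₀ τ₁ F₁ F₂ U₀ U₁ U₂ : ℝ → ℝ}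
    (H : IsLagData M τ₀ τ₁ F₁ F₂ U₀ U₁ U₂) :
    ∃ (a U : ℝ) (N : ℕ → ℕ) (_ : ∀ n, NeZero (N n)) (τn un : ∀ n, ℝ → ZMod (N n) → ℝ)
      (τ u σ : ℝ → ℝ → ℝ), 0 < a ∧ IsApprox M a U τ₀ U₀ N τn un ∧ StepLim M τn τ ∧
      StepLim M un u ∧ StepLim M (fun n => flux (M / N n) (τn n) (un n)) σ := by
  obtain ⟨a, U, ha, τn, un, hA⟩ := H.exists_approx
  have hM := H.mass_pos
  set F : Fin 3 → ∀ n : ℕ, ℝ → ZMod (n + 1) → ℝ := fun j n =>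
    match j with
    | 0 => τn n
    | 1 => un n
    | 2 => flux (M / ((n + 1 : ℕ) : ℝ)) (τn n) (un n) with hF
  have hreg : ∀ j, SeqReg (N := fun n => n + 1) M (F j) := by
    intro j
    fin_cases j
    · exact hA.seqReg_τ
    · exact hA.seqReg_u
    · exact hA.seqReg_flux
  obtain ⟨φ, hφ, g, hg⟩ := exists_subseq_forall_tendsto (P := ℝ × ℝ)
    (fun n j p => step (M / ((n + 1 : ℕ) : ℝ)) (F j n (max p.1 0)) p.2)
    (fun j p => (hreg j).bound p.1 p.2)
    (fun j p ε hε => (hreg j).equicont hM hA.mesh p hε)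
  refine ⟨a, U, fun n => φ n + 1, fun n => inferInstance, fun n => τn (φ n), fun n => un (φ n),
    fun t y => g 0 (t, y), fun t y => g 1 (t, y), fun t y => g 2 (t, y), ha, hA.comp hφ,
    fun t y => hg 0 (t, y), fun t y => hg 1 (t, y), fun t y => hg 2 (t, y)⟩

/-! ### The equations satisfied by the limit -/

lemma hasDerivAt_of_periodic_of_integral {G F : ℝ → ℝ} {M : ℝ} (hM : 0 < M)
    (hG : Function.Periodic G M) (hF : Function.Periodic F M) (hc : Continuous F)
    (h : ∀ y, 0 ≤ y → G y - G 0 = ∫ z in (0 : ℝ)..y, F z) (y : ℝ) : HasDerivAt G (F y) y := by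
  have key : ∀ y, 0 < y → HasDerivAt G (F y) y := by
    intro y hy
    have h1 : HasDerivAt (fun y => G 0 + ∫ z in (0 : ℝ)..y, F z) (F y) y :=
      (hc.integral_hasStrictDerivAt 0 y).hasDerivAt.const_add _
    refine h1.congr_of_eventuallyEq ?_
    filter_upwards [lt_mem_nhds hy] with z hz
    rw [← h z hz.le]
    ring
  obtain ⟨n, hn⟩ := exists_nat_gt (-y / M)
  rw [div_lt_iff₀ hM] at hn
  have h1 := (key (y + n * M) (by linarith)).comp_add_const y (n * M)
  rw [hF.nat_mul n y] at h1
  exact h1.congr_of_eventuallyEq (Eventually.of_forall fun z => (hG.nat_mul n z).symm)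

lemma tendsto_floor_mul {h : ℕ → ℝ} (hh : ∀ n, 0 < h n) (h0 : Tendsto h atTop (𝓝 0)) (y : ℝ) :
    Tendsto (fun n => (⌊y / h n⌋ : ℝ) * h n) atTop (𝓝 y) :=
  tendsto_iff_norm_sub_tendsto_zero.2
    (squeeze_zero (fun _ => norm_nonneg _) (fun n => abs_floor_mul_sub_le (hh n) y) h0)

lemma tendsto_slope_of_hasDerivAt {f f' : ℝ → ℝ} (hf : ∀ y, HasDerivAt f (f' y) y)
    (hc : Continuous f') {h x : ℕ → ℝ} {y : ℝ} (hh : ∀ n, 0 < h n) (h0 : Tendsto h atTop (𝓝 0))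
    (hx : Tendsto x atTop (𝓝 y)) :
    Tendsto (fun n => (f (x n + h n) - f (x n)) / h n) atTop (𝓝 (f' y)) := by
  have h1 : HasStrictDerivAt f (f' y) y := hasStrictDerivAt_of_hasDerivAt_of_continuousAt
    (Eventually.of_forall hf) hc.continuousAt
  have h2 : Tendsto (fun n => (x n + h n, x n)) atTop (𝓝 (y, y)) := by
    have := hx.add h0
    rw [add_zero] at this
    exact this.prodMk_nhds hx
  have h3 := ((hasDerivAtFilter_iff_isLittleO.1 h1).comp_tendsto h2).tendsto_div_nhds_zero
  rw [← tendsto_sub_nhds_zero_iff]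
  refine h3.congr fun n => ?_
  have := (hh n).ne'
  simp only [Function.comp, add_sub_cancel_left, smul_eq_mul]
  field_simp

/-- A solution of the system in mass coordinates: specific volume `τ`, velocity `u`, and
flux `σ = u_y / τ³`. -/
structure IsLagSol (M a : ℝ) (τ₀ F₁ U₀ : ℝ → ℝ) (τ u σ : ℝ → ℝ → ℝ) : Prop where
  low_pos : 0 < a
  low : ∀ t y, a ≤ τ t y
  cτ : Continuous (Function.uncurry τ)
  cu : Continuous (Function.uncurry u)
  cσ : Continuous (Function.uncurry σ)
  maxτ : ∀ t, τ (max t 0) = τ t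
  maxu : ∀ t, u (max t 0) = u t
  maxσ : ∀ t, σ (max t 0) = σ t
  perτ : ∀ t, Function.Periodic (τ t) M
  peru : ∀ t, Function.Periodic (u t) M
  perσ : ∀ t, Function.Periodic (σ t) M
  initτ : τ 0 = τ₀
  initu : u 0 = U₀
  evolτ : ∀ t, 0 ≤ t → ∀ y, τ t y - τ₀ y = ∫ s in (0 : ℝ)..t, τ s y ^ 3 * σ s y
  evolu : ∀ t, 0 ≤ t → ∀ y, 0 ≤ y →
    ∫ z in (0 : ℝ)..y, (u t z - U₀ z) = ∫ s in (0 : ℝ)..t, (σ s y - σ s 0)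
  derivu : ∀ t y, HasDerivAt (u t) (τ t y ^ 3 * σ t y) y
  derivF : ∀ t y, HasDerivAt (fun z => 1 / (2 * τ t z ^ 2)) (U₀ y + F₁ y - u t y) y

section Limit

set_option linter.unusedSectionVars false

variable {M a U : ℝ} {τ₀ τ₁ F₁ F₂ U₀ U₁ U₂ : ℝ → ℝ} {N : ℕ → ℕ} [∀ n, NeZero (N n)]
  {τn un : ∀ n, ℝ → ZMod (N n) → ℝ} {τ u σ : ℝ → ℝ → ℝ}

lemma tendsto_step_samp {f : ℝ → ℝ} (hM : 0 < M) (hmesh : Tendsto (fun n => M / N n) atTop (𝓝 0))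
    (hf : Function.Periodic f M) (hc : Continuous f) (y : ℝ) :
    Tendsto (fun n => step (M / N n) (samp (N := N n) (M / N n) f) y) atTop (𝓝 (f y)) := by
  have h1 := (hc.tendsto y).comp (tendsto_floor_mul (fun n => mesh_pos (N := N) hM n) hmesh y)
  refine h1.congr fun n => ?_
  rw [step_samp (by rw [mesh_mul]; exact hf)]
  rfl

lemma IsApprox.tendsto_fwd (H : IsApprox M a U τ₀ U₀ N τn un) (hτ : StepLim M τn τ)
    (hσ : StepLim M (fun n => flux (M / N n) (τn n) (un n)) σ) {t : ℝ} (ht : 0 ≤ t) (y : ℝ) :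
    Tendsto (fun n => step (M / N n) (fwd (M / N n) (un n t)) y) atTop
      (𝓝 (τ t y ^ 3 * σ t y)) := by
  obtain ⟨T, hT⟩ := exists_nat_gt t
  refine Tendsto.congr' ?_ (((hτ.of_nonneg ht y).pow 3).mul (hσ.of_nonneg ht y))
  filter_upwards [H.flow T] with n hn
  exact (hn.fwd_eq ⟨ht, hT.le⟩ _).symm

/-- Passing to the limit in a time integral along a fixed site. -/
lemma tendsto_integral_time {fn : ∀ n, ℝ → ZMod (N n) → ℝ} {g : ℝ → ℝ → ℝ} {t C : ℝ} (ht : 0 ≤ t)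
    (hc : ∀ᶠ n in atTop, ∀ i, ContinuousOn (fun s => fn n s i) (Icc 0 t))
    (hb : ∀ᶠ n in atTop, ∀ s ∈ Icc 0 t, ∀ i, |fn n s i| ≤ C) (y : ℝ)
    (hlim : ∀ s, 0 ≤ s → Tendsto (fun n => step (M / N n) (fn n s) y) atTop (𝓝 (g s y))) :
    Tendsto (fun n => ∫ s in (0 : ℝ)..t, step (M / N n) (fn n s) y) atTop
      (𝓝 (∫ s in (0 : ℝ)..t, g s y)) := by
  refine intervalIntegral.tendsto_integral_filter_of_dominated_convergence (fun _ => C) ?_ ?_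
    intervalIntegrable_const ?_
  · filter_upwards [hc] with n hn
    rw [uIoc_of_le ht]
    exact ((hn _).mono Ioc_subset_Icc_self).aestronglyMeasurable measurableSet_Ioc
  · filter_upwards [hb] with n hn
    refine Eventually.of_forall fun s hs => ?_
    rw [uIoc_of_le ht] at hs
    exact hn s (Ioc_subset_Icc_self hs) _
  · refine Eventually.of_forall fun s hs => ?_
    rw [uIoc_of_le ht] at hs
    exact hlim s hs.1.le

theorem IsApprox.isLagSol (H : IsApprox M a U τ₀ U₀ N τn un) (ha : 0 < a)
    (D : IsLagData M τ₀ τ₁ F₁ F₂ U₀ U₁ U₂) (hτ : StepLim M τn τ) (hu : StepLim M un u)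
    (hσ : StepLim M (fun n => flux (M / N n) (τn n) (un n)) σ) :
    IsLagSol M a τ₀ F₁ U₀ τ u σ := by
  have hM := D.mass_pos
  have cτ₀ : Continuous τ₀ := continuous_iff_continuousAt.2 fun y => (D.dτ y).continuousAt
  have cU₀ : Continuous U₀ := continuous_iff_continuousAt.2 fun y => (D.dU y).continuousAt
  have cF₁ : Continuous F₁ := continuous_iff_continuousAt.2 fun y => (D.dF₁ y).continuousAt
  have pF : Function.Periodic (fun z => 1 / (2 * τ₀ z ^ 2)) M := fun y => by
    simp only [D.periodic_τ y]
  have pF₁ := periodic_of_hasDerivAt pF D.dF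
  have cτ := hτ.continuous H.seqReg_τ hM H.mesh
  have cu := hu.continuous H.seqReg_u hM H.mesh
  have cσ := hσ.continuous H.seqReg_flux hM H.mesh
  have cs : ∀ {g : ℝ → ℝ → ℝ}, Continuous (Function.uncurry g) → ∀ t, Continuous (g t) :=
    fun hg t => hg.comp (Continuous.prodMk_right t)
  have low : ∀ t y, a ≤ τ t y := by
    intro t y
    obtain ⟨T, hT⟩ := exists_nat_gt (max t 0)
    refine ge_of_tendsto (hτ t y) ?_
    filter_upwards [H.low T] with n hn
    exact (hn _ ⟨le_max_right _ _, hT.le⟩ _).1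
  have initτ : τ 0 = τ₀ := by
    ext y
    refine tendsto_nhds_unique (hτ.of_nonneg le_rfl y) ?_
    simp only [H.initτ]
    exact tendsto_step_samp hM H.mesh D.periodic_τ cτ₀ y
  have initu : u 0 = U₀ := by
    ext y
    refine tendsto_nhds_unique (hu.of_nonneg le_rfl y) ?_
    simp only [H.initu]
    exact tendsto_step_samp hM H.mesh D.periodic_U cU₀ y
  have hwt : ∀ t, 0 ≤ t → ∀ y, HasDerivAt (u t) (τ t y ^ 3 * σ t y) y := by
    intro t ht
    obtain ⟨T, hT⟩ := exists_nat_gt t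
    obtain ⟨C, hC⟩ := H.reg T
    refine hasDerivAt_of_periodic_of_integral hM (hu.periodic hM t) (fun y => ?_) ?_ fun y hy => ?_
    · rw [hτ.periodic hM t, hσ.periodic hM t]
    · exact ((cs cτ t).pow 3).mul (cs cσ t)
    · refine sub_eq_integral_of_step_tendsto (fun n => mesh_pos (N := N) hM n) H.mesh
        (g := fun n => un n t) (f := fun n => fwd (M / N n) (un n t)) (C := C)
        (Eventually.of_forall fun n => rfl) ?_ (hu.of_nonneg ht) (H.tendsto_fwd hτ hσ ht) hy
      filter_upwards [hC] with n hn
      exact hn.fwdu t ⟨ht, hT.le⟩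
  have hFt : ∀ t, 0 ≤ t → ∀ y, HasDerivAt (fun z => 1 / (2 * τ t z ^ 2))
      (U₀ y + F₁ y - u t y) y := by
    intro t ht
    obtain ⟨T, hT⟩ := exists_nat_gt t
    obtain ⟨C, hC⟩ := H.reg T
    obtain ⟨f₁, hf₁0, hf₁⟩ := exists_abs_le_of_periodic cF₁ pF₁ hM
    have hne : ∀ y, 2 * τ t y ^ 2 ≠ 0 := fun y => by
      have := ha.trans_le (low t y)
      positivity
    refine hasDerivAt_of_periodic_of_integral hM (fun y => ?_) (fun y => ?_) ?_ fun y hy => ?_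
    · simp only [hτ.periodic hM t y]
    · rw [D.periodic_U, pF₁, hu.periodic hM t]
    · exact (cU₀.add cF₁).sub (cs cu t)
    · refine sub_eq_integral_of_step_tendsto (fun n => mesh_pos (N := N) hM n) H.mesh
        (G := fun z => 1 / (2 * τ t z ^ 2)) (F := fun y => U₀ y + F₁ y - u t y)
        (g := fun n i => 1 / (2 * τn n t i ^ 2))
        (f := fun n i => un n 0 (i + 1) + fwd (M / N n) (samp (M / N n)
          fun z => 1 / (2 * τ₀ z ^ 2)) i - un n t (i + 1)) (C := C + f₁ + C) ?_ ?_ ?_ ?_ hy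
      · filter_upwards [H.flow T] with n hn
        ext i
        rw [H.initu, hn.vel t ⟨ht, hT.le⟩ (i + 1), fwd_eq_bwd, fwd_eq_bwd, sampV]
        ring
      · filter_upwards [hC] with n hn i
        have e1 := hn.regu.bound 0 ⟨le_rfl, ht.trans hT.le⟩ (i + 1)
        have e2 := hn.regu.bound t ⟨ht, hT.le⟩ (i + 1)
        have e3 : |fwd (M / N n) (samp (M / N n) fun z => 1 / (2 * τ₀ z ^ 2)) i| ≤ f₁ := by
          rw [fwd_eq_bwd]
          exact abs_bwd_samp_le (mesh_pos hM n) (by rw [mesh_mul]; exact pF)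
            (abs_sub_le_of_hasDerivAt D.dF hf₁) _
        exact (abs_sub _ _).trans (add_le_add ((abs_add_le _ _).trans (add_le_add e1 e3)) e2)
      · intro z
        exact tendsto_const_nhds.div (((hτ.of_nonneg ht z).pow 2).const_mul 2) (hne z)
      · intro z
        have e1 := hu.shift H.seqReg_u hM H.mesh (le_refl (0 : ℝ)) z
        have e2 := hu.shift H.seqReg_u hM H.mesh ht z
        have e3 := tendsto_slope_of_hasDerivAt D.dF cF₁ (fun n => mesh_pos (N := N) hM n) H.mesh
          (tendsto_floor_mul (fun n => mesh_pos (N := N) hM n) H.mesh z)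
        rw [initu] at e1
        refine ((e1.add e3).sub e2).congr fun n => ?_
        have e4 : step (M / N n) (fwd (M / N n) (samp (N := N n) (M / N n)
            fun z => 1 / (2 * τ₀ z ^ 2))) z = (1 / (2 * τ₀ (⌊z / (M / N n)⌋ * (M / N n) + M / N n) ^ 2)
              - 1 / (2 * τ₀ (⌊z / (M / N n)⌋ * (M / N n)) ^ 2)) / (M / N n) := by
          have pF' : Function.Periodic (fun z => 1 / (2 * τ₀ z ^ 2)) (N n * (M / N n)) := by
            rw [mesh_mul]; exact pF
          rw [fwd_samp pF', step_samp]
          intro x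
          have := pF' x
          have := pF' (x + M / N n)
          simp only [add_right_comm x] at *
          simp only [*]
        rw [← e4]
        rfl
  have hmax0 : ∀ t : ℝ, 0 ≤ max t 0 := fun t => le_max_right t 0
  refine ⟨ha, low, cτ, cu, cσ, hτ.max_eq, hu.max_eq, hσ.max_eq, hτ.periodic hM, hu.periodic hM,
    hσ.periodic hM, initτ, initu, fun t ht y => ?_, fun t ht y hy => ?_, fun t y => ?_,
    fun t y => ?_⟩
  · obtain ⟨T, hT⟩ := exists_nat_gt t
    obtain ⟨C, hC⟩ := H.reg T
    have hsub : Icc 0 t ⊆ Icc (0 : ℝ) T := Icc_subset_Icc_right hT.le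
    have h1 := tendsto_integral_time (M := M) (fn := fun n s => fwd (M / N n) (un n s))
      (g := fun s y => τ s y ^ 3 * σ s y) (C := C) ht ?_ ?_ y
      (fun s hs => H.tendsto_fwd hτ hσ hs y)
    · have h2 := (hτ.of_nonneg ht y).sub (hτ.of_nonneg le_rfl y)
      rw [initτ] at h2
      refine tendsto_nhds_unique h2 (h1.congr' ?_)
      filter_upwards [H.flow T] with n hn
      refine intervalIntegral.integral_eq_sub_of_hasDerivAt
        (f := fun s => τn n s (⌊y / (M / N n)⌋ : ℤ))
        (f' := fun s => fwd (M / N n) (un n s) (⌊y / (M / N n)⌋ : ℤ)) (fun s hs => ?_) ?_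
      · rw [uIcc_of_le ht] at hs
        exact hn.dτ s (hsub hs) _
      · refine ContinuousOn.intervalIntegrable ?_
        rw [uIcc_of_le ht]
        exact (continuousOn_fwd (fun i => hn.continuousOn_u i) _).mono hsub
    · filter_upwards [H.flow T] with n hn i
      exact (continuousOn_fwd (fun i => hn.continuousOn_u i) _).mono hsub
    · filter_upwards [hC] with n hn s hs
      exact hn.fwdu s (hsub hs)
  · obtain ⟨T, hT⟩ := exists_nat_gt t
    obtain ⟨C, hC⟩ := H.reg T
    have hsub : Icc 0 t ⊆ Icc (0 : ℝ) T := Icc_subset_Icc_right hT.le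
    have h1 : ∀ y, Tendsto (fun n => step (M / N n)
        (fun i => ∫ s in (0 : ℝ)..t, flux (M / N n) (τn n) (un n) s i) y) atTop
        (𝓝 (∫ s in (0 : ℝ)..t, σ s y)) := by
      intro y
      refine tendsto_integral_time (M := M) (fn := fun n => flux (M / N n) (τn n) (un n)) (C := C)
        ht ?_ ?_ y (fun s hs => hσ.of_nonneg hs y)
      · filter_upwards [H.flow T] with n hn i
        exact (hn.continuousOn_flux i).mono hsub
      · filter_upwards [hC] with n hn s hs
        exact hn.regσ.bound s (hsub hs)
    have h2 := sub_eq_integral_of_step_tendsto (fun n => mesh_pos (N := N) hM n) H.mesh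
      (g := fun n i => ∫ s in (0 : ℝ)..t, flux (M / N n) (τn n) (un n) s i)
      (f := fun n i => un n t (i + 1) - un n 0 (i + 1)) (C := C + C)
      (G := fun y => ∫ s in (0 : ℝ)..t, σ s y) (F := fun y => u t y - U₀ y) ?_ ?_ h1 ?_ hy
    · rw [← h2, intervalIntegral.integral_sub]
      · exact (cσ.comp (Continuous.prodMk_left y)).intervalIntegrable _ _
      · exact (cσ.comp (Continuous.prodMk_left 0)).intervalIntegrable _ _
    · filter_upwards [H.flow T] with n hn
      ext i
      have hi : ∀ i, IntervalIntegrable (fun s => flux (M / N n) (τn n) (un n) s i) volume 0 t := by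
        intro i
        refine ContinuousOn.intervalIntegrable ?_
        rw [uIcc_of_le ht]
        exact (hn.continuousOn_flux i).mono hsub
      rw [fwd, ← intervalIntegral.integral_sub (hi _) (hi _), ← intervalIntegral.integral_div]
      have e1 : ∀ s ∈ uIcc 0 t, HasDerivAt (fun s => un n s (i + 1))
          ((flux (M / N n) (τn n) (un n) s (i + 1) - flux (M / N n) (τn n) (un n) s i) /
            (M / N n)) s := by
        intro s hs
        rw [uIcc_of_le ht] at hs
        have := hn.hasDerivAt_u (hsub hs) (i + 1)
        rwa [← fwd_eq_bwd] at this
      exact intervalIntegral.integral_eq_sub_of_hasDerivAt e1 (((hi _).sub (hi _)).div_const _)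
    · filter_upwards [hC] with n hn i
      exact (abs_sub _ _).trans (add_le_add (hn.regu.bound t ⟨ht, hT.le⟩ _)
        (hn.regu.bound 0 ⟨le_rfl, ht.trans hT.le⟩ _))
    · intro z
      have e1 := hu.shift H.seqReg_u hM H.mesh (le_refl (0 : ℝ)) z
      rw [initu] at e1
      exact (hu.shift H.seqReg_u hM H.mesh ht z).sub e1
  · have := hwt (max t 0) (hmax0 t) y
    rwa [hu.max_eq, hτ.max_eq, hσ.max_eq] at this
  · have := hFt (max t 0) (hmax0 t) y
    rwa [hu.max_eq, hτ.max_eq] at this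

end Limit

/-! ### Fourier coefficients of lattice functions and of their limits -/

/-- Fourier coefficient of a function of period `L`, without normalization. -/
def fc (L : ℝ) (k : ℤ) (f : ℝ → ℝ) : ℂ :=
  ∫ y in (0 : ℝ)..L, fourier (-k) (y : AddCircle L) * (f y : ℂ)

lemma norm_fourier_coe {L : ℝ} (k : ℤ) (y : AddCircle L) : ‖fourier k y‖ = 1 :=
  Circle.norm_coe _

/-- The wave number of the `k`-th Fourier mode. -/
def wave (L : ℝ) (k : ℤ) : ℝ := 2 * Real.pi * k / L

section Dft

open ZMod

variable {N : ℕ} [NeZero N]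

lemma sum_norm_sq_dft (Φ : ZMod N → ℂ) : ∑ k, ‖dft Φ k‖ ^ 2 = N * ∑ j, ‖Φ j‖ ^ 2 := by
  have key : ∑ k, starRingEnd ℂ (dft Φ k) * dft Φ k = N * ∑ j, starRingEnd ℂ (Φ j) * Φ j := by
    calc ∑ k, starRingEnd ℂ (dft Φ k) * dft Φ k
        = ∑ k, ∑ j, starRingEnd ℂ (Φ j) * (stdAddChar (-(k * (-j))) • dft Φ k) := by
          refine Finset.sum_congr rfl fun k _ => ?_
          rw [dft_apply Φ k, map_sum, Finset.sum_mul]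
          refine Finset.sum_congr rfl fun j _ => ?_
          rw [smul_eq_mul, map_mul, ← AddChar.map_neg_eq_conj, smul_eq_mul]
          ring_nf
      _ = ∑ j, starRingEnd ℂ (Φ j) * dft (dft Φ) (-j) := by
          rw [Finset.sum_comm]
          refine Finset.sum_congr rfl fun j _ => ?_
          rw [← Finset.mul_sum, dft_apply (dft Φ)]
      _ = _ := by
          rw [dft_dft, Finset.mul_sum]
          refine Finset.sum_congr rfl fun j _ => ?_
          simp only [neg_neg, smul_eq_mul]
          ring
  simp only [Complex.conj_mul'] at key
  exact_mod_cast key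

lemma dft_shift (Φ : ZMod N → ℂ) (c k : ZMod N) :
    dft (fun j => Φ (j + c)) k = stdAddChar (c * k) * dft Φ k := by
  rw [dft_apply, dft_apply, Finset.mul_sum]
  refine Fintype.sum_equiv (Equiv.addRight c) _ _ fun j => ?_
  simp only [Equiv.coe_addRight, smul_eq_mul]
  rw [← mul_assoc, ← AddChar.map_add_eq_mul]
  congr 2
  ring

lemma dft_lap (h : ℝ) (f : ZMod N → ℝ) (k : ZMod N) :
    dft (fun j => (lap h f j : ℂ)) k =
      ((stdAddChar k + stdAddChar (-k) - 2) / (h : ℂ) ^ 2) * dft (fun j => (f j : ℂ)) k := by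
  have h1 := dft_shift (fun j => (f j : ℂ)) 1 k
  have h2 := dft_shift (fun j => (f j : ℂ)) (-1) k
  rw [one_mul] at h1
  rw [neg_one_mul] at h2
  have h3 : (fun j => (lap h f j : ℂ)) = ((h : ℂ) ^ 2)⁻¹ • ((fun j => (f (j + 1) : ℂ)) -
      (2 : ℂ) • (fun j => (f j : ℂ)) + fun j => (f (j + -1) : ℂ)) := by
    ext j
    simp only [lap, Pi.smul_apply, Pi.add_apply, Pi.sub_apply, smul_eq_mul, ← sub_eq_add_neg]
    push_cast
    rw [div_eq_inv_mul]
  rw [h3, _root_.map_smul, map_add, map_sub, _root_.map_smul]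
  simp only [Pi.smul_apply, Pi.add_apply, Pi.sub_apply, smul_eq_mul, h1, h2]
  rw [div_eq_inv_mul]
  ring

lemma norm_stdAddChar_symbol (k : ℤ) :
    ‖stdAddChar (k : ZMod N) + stdAddChar (-(k : ZMod N)) - 2‖ =
      4 * Real.sin (Real.pi * k / N) ^ 2 := by
  have e : (stdAddChar (k : ZMod N) + stdAddChar (-(k : ZMod N)) - 2 : ℂ) =
      ((-(4 * Real.sin (Real.pi * k / N) ^ 2) : ℝ) : ℂ) := by
    have h0 : (-(k : ZMod N)) = ((-k : ℤ) : ZMod N) := by push_cast; rfl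
    have h3 : Real.cos (2 * (Real.pi * k / N)) = 1 - 2 * Real.sin (Real.pi * k / N) ^ 2 := by
      rw [Real.cos_two_mul, Real.cos_sq']
      ring
    have h4 : (-(4 * Real.sin (Real.pi * k / N) ^ 2) : ℝ) =
        2 * Real.cos (2 * (Real.pi * k / N)) - 2 := by
      rw [h3]
      ring
    rw [h4, h0, stdAddChar_coe, stdAddChar_coe]
    push_cast
    rw [Complex.two_cos]
    ring_nf
  rw [e, Complex.norm_real, Real.norm_eq_abs, abs_neg, abs_of_nonneg (by positivity)]

/-- The Fourier coefficient of a lattice function. -/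
def latCoeff (h : ℝ) (k : ℤ) (f : ZMod N → ℝ) : ℂ := h * dft (fun j => (f j : ℂ)) (k : ZMod N)

/-- The symbol of the discrete Laplacian. -/
def latSymbol (M h : ℝ) (k : ℤ) : ℝ := 4 * (Real.sin (Real.pi * k / M * h) / h) ^ 2

lemma sum_latCoeff_le {h M : ℝ} (hh : 0 < h) (hM : N * h = M) (f : ZMod N → ℝ) (K : Finset ℤ)
    (hK : Set.InjOn (fun k : ℤ => (k : ZMod N)) K) :
    ∑ k ∈ K, latSymbol M h k ^ 2 * ‖latCoeff h k f‖ ^ 2 ≤ M * nsq h (lap h f) := by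
  have hN : (N : ℝ) ≠ 0 := by exact_mod_cast NeZero.ne N
  have h1 : ∀ k : ℤ, latSymbol M h k ^ 2 * ‖latCoeff h k f‖ ^ 2 =
      h ^ 2 * ‖dft (fun j => (lap h f j : ℂ)) (k : ZMod N)‖ ^ 2 := by
    intro k
    have e : latSymbol M h k = 4 * Real.sin (Real.pi * k / N) ^ 2 / h ^ 2 := by
      rw [latSymbol, ← hM]
      have : Real.pi * k / (N * h) * h = Real.pi * k / N := by field_simp
      rw [this]
      ring
    rw [dft_lap, norm_mul, norm_div, norm_stdAddChar_symbol, latCoeff, norm_mul, e, norm_pow,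
      Complex.norm_real, Real.norm_eq_abs, abs_of_pos hh]
    ring
  simp only [h1]
  rw [← Finset.mul_sum, ← Finset.sum_image (g := fun k : ℤ => (k : ZMod N))
    (f := fun k => ‖dft (fun j => (lap h f j : ℂ)) k‖ ^ 2) hK]
  calc h ^ 2 * ∑ k ∈ K.image (fun k : ℤ => (k : ZMod N)), ‖dft (fun j => (lap h f j : ℂ)) k‖ ^ 2
      ≤ h ^ 2 * ∑ k, ‖dft (fun j => (lap h f j : ℂ)) k‖ ^ 2 := by
        refine mul_le_mul_of_nonneg_left ?_ (sq_nonneg h)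
        exact Finset.sum_le_sum_of_subset_of_nonneg (Finset.subset_univ _)
          fun _ _ _ => sq_nonneg _
    _ = M * nsq h (lap h f) := by
        rw [sum_norm_sq_dft, nsq, ← hM]
        simp only [Complex.norm_real, Real.norm_eq_abs, sq_abs]
        ring

lemma latCoeff_eq_integral {h M : ℝ} (hh : 0 < h) (hM : N * h = M) (k : ℤ) (f : ZMod N → ℝ) :
    latCoeff h k f = ∫ y in (0 : ℝ)..M,
      fourier (-k) ((⌊y / h⌋ * h : ℝ) : AddCircle M) * (step h f y : ℂ) := by
  have hN : (N : ℝ) ≠ 0 := by exact_mod_cast NeZero.ne N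
  have h1 := (integral_floor_comp hh (fun j : ℤ =>
    fourier (-k) ((j * h : ℝ) : AddCircle M) * (f (j : ZMod N) : ℂ)) N).2
  rw [hM] at h1
  refine Eq.trans ?_ h1.symm
  rw [latCoeff, dft_apply, sum_val_eq_sum_range, Complex.real_smul]
  congr 1
  refine Finset.sum_congr rfl fun j _ => ?_
  rw [smul_eq_mul]
  congr 1
  · have e : (-(((j : ℕ) : ZMod N) * (k : ZMod N))) = ((-(j * k) : ℤ) : ZMod N) := by push_cast; rfl
    rw [e, stdAddChar_coe, fourier_coe_apply, ← hM]
    congr 1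
    have hN' : (N : ℂ) ≠ 0 := by exact_mod_cast hN
    have hh' : (h : ℂ) ≠ 0 := by exact_mod_cast hh.ne'
    push_cast
    field_simp
  · simp

lemma norm_latCoeff_le {h M C : ℝ} (hh : 0 < h) (hM : N * h = M) (k : ℤ) (f : ZMod N → ℝ)
    (hf : ∀ i, |f i| ≤ C) : ‖latCoeff h k f‖ ≤ C * M := by
  rw [latCoeff_eq_integral hh hM]
  have hM0 : 0 ≤ M := by rw [← hM]; positivity
  have := intervalIntegral.norm_integral_le_of_norm_le_const (a := 0) (b := M) (C := C)
    (f := fun y => fourier (-k) ((⌊y / h⌋ * h : ℝ) : AddCircle M) * (step h f y : ℂ))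
    fun y _ => by
      rw [norm_mul, norm_fourier_coe, one_mul, Complex.norm_real]
      exact hf _
  rwa [sub_zero, abs_of_nonneg hM0] at this

end Dft

section Limit

set_option linter.unusedSectionVars false

variable {M : ℝ} {N : ℕ → ℕ} [∀ n, NeZero (N n)]

lemma eventually_injOn_intCast (hM : 0 < M) (hmesh : Tendsto (fun n => M / N n) atTop (𝓝 0))
    (K : Finset ℤ) : ∀ᶠ n in atTop, Set.InjOn (fun k : ℤ => (k : ZMod (N n))) K := by
  obtain ⟨B, hB⟩ : ∃ B : ℕ, ∀ k ∈ K, k.natAbs ≤ B :=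
    ⟨K.sup Int.natAbs, fun k hk => Finset.le_sup (f := Int.natAbs) hk⟩
  have h1 : (0 : ℝ) < M / (2 * B + 1) := by positivity
  filter_upwards [hmesh.eventually_lt_const h1] with n hn
  have hN : (0 : ℝ) < N n := by exact_mod_cast Nat.pos_of_ne_zero (NeZero.ne (N n))
  rw [div_lt_div_iff_of_pos_left hM hN (by positivity)] at hn
  have hn' : 2 * B + 1 < N n := by exact_mod_cast hn
  intro k hk l hl hkl
  have h2 := (ZMod.intCast_eq_intCast_iff_dvd_sub _ _ _).1 hkl
  have h3 := hB k hk
  have h4 := hB l hl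
  by_contra hne
  have h5 := Int.natAbs_le_of_dvd_ne_zero h2 (sub_ne_zero.2 (Ne.symm hne))
  omega

lemma tendsto_latSymbol (hM : 0 < M) (hmesh : Tendsto (fun n => M / N n) atTop (𝓝 0)) (k : ℤ) :
    Tendsto (fun n => latSymbol M (M / N n) k) atTop (𝓝 (wave M k ^ 2)) := by
  have h1 := tendsto_slope_of_hasDerivAt (f := fun x => Real.sin (Real.pi * k / M * x))
    (f' := fun x => Real.cos (Real.pi * k / M * x) * (Real.pi * k / M))
    (fun y => by
      have := ((hasDerivAt_id y).const_mul (Real.pi * k / M)).sin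
      simpa using this)
    (by fun_prop) (x := fun _ => 0) (y := 0) (fun n => mesh_pos (N := N) hM n) hmesh
    tendsto_const_nhds
  have h2 := (h1.pow 2).const_mul 4
  simp only [mul_zero, Real.cos_zero, one_mul, zero_add, Real.sin_zero, sub_zero] at h2
  have e : 4 * (Real.pi * k / M) ^ 2 = wave M k ^ 2 := by rw [wave]; ring
  rw [e] at h2
  exact h2

lemma tendsto_latCoeff (hM : 0 < M) (hmesh : Tendsto (fun n => M / N n) atTop (𝓝 0)) (k : ℤ)
    {fn : ∀ n, ZMod (N n) → ℝ} {g : ℝ → ℝ} {C : ℝ} (hC : ∀ᶠ n in atTop, ∀ i, |fn n i| ≤ C)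
    (hlim : ∀ y, Tendsto (fun n => step (M / N n) (fn n) y) atTop (𝓝 (g y))) :
    Tendsto (fun n => latCoeff (M / N n) k (fn n)) atTop (𝓝 (fc M k g)) := by
  simp only [latCoeff_eq_integral (mesh_pos hM _) (mesh_mul M _)]
  refine intervalIntegral.tendsto_integral_filter_of_dominated_convergence (fun _ => C) ?_ ?_
    intervalIntegrable_const ?_
  · refine Eventually.of_forall fun n => Measurable.aestronglyMeasurable ?_
    exact measurable_floor_comp (M / N n) fun j : ℤ =>
      fourier (-k) ((j * (M / N n) : ℝ) : AddCircle M) * ((fn n (j : ZMod (N n)) : ℝ) : ℂ)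
  · filter_upwards [hC] with n hn
    refine Eventually.of_forall fun y _ => ?_
    rw [norm_mul, norm_fourier_coe, one_mul, Complex.norm_real]
    exact hn _
  · refine Eventually.of_forall fun y _ => ?_
    refine Tendsto.mul ?_ ((Complex.continuous_ofReal.tendsto _).comp (hlim y))
    have hc : Continuous fun y : ℝ => fourier (-k) (y : AddCircle M) :=
      (fourier (-k)).continuous.comp (AddCircle.continuous_mk' M)
    exact (hc.tendsto y).comp (tendsto_floor_mul (fun n => mesh_pos (N := N) hM n) hmesh y)

/-- Bound on the `H²` seminorm of the limit of lattice functions. -/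
lemma sum_wave_fc_le (hM : 0 < M) (hmesh : Tendsto (fun n => M / N n) atTop (𝓝 0))
    {fn : ∀ n, ZMod (N n) → ℝ} {g : ℝ → ℝ} {C D : ℝ} (hC : ∀ᶠ n in atTop, ∀ i, |fn n i| ≤ C)
    (hlim : ∀ y, Tendsto (fun n => step (M / N n) (fn n) y) atTop (𝓝 (g y)))
    (hD : ∀ᶠ n in atTop, nsq (M / N n) (lap (M / N n) (fn n)) ≤ D) (K : Finset ℤ) :
    ∑ k ∈ K, wave M k ^ 4 * ‖fc M k g‖ ^ 2 ≤ M * D := by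
  have h1 : Tendsto (fun n => ∑ k ∈ K, latSymbol M (M / N n) k ^ 2 *
      ‖latCoeff (M / N n) k (fn n)‖ ^ 2) atTop
      (𝓝 (∑ k ∈ K, (wave M k ^ 2) ^ 2 * ‖fc M k g‖ ^ 2)) :=
    tendsto_finsetSum _ fun k _ => ((tendsto_latSymbol hM hmesh k).pow 2).mul
      ((tendsto_latCoeff hM hmesh k hC hlim).norm.pow 2)
  simp only [← pow_mul] at h1
  refine le_of_tendsto h1 ?_
  filter_upwards [eventually_injOn_intCast hM hmesh K, hD] with n hn hn'
  exact (sum_latCoeff_le (mesh_pos hM n) (mesh_mul M n) _ K hn).trans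
    (mul_le_mul_of_nonneg_left hn' hM.le)

/-- The time integrated version of `sum_wave_fc_le`. -/
lemma sum_wave_integral_fc_le (hM : 0 < M) (hmesh : Tendsto (fun n => M / N n) atTop (𝓝 0))
    {fn : ∀ n, ℝ → ZMod (N n) → ℝ} {g : ℝ → ℝ → ℝ} {T C D : ℝ} (hT : 0 ≤ T)
    (hC : ∀ᶠ n in atTop, ∀ t ∈ Icc 0 T, ∀ i, |fn n t i| ≤ C)
    (hcont : ∀ᶠ n in atTop, ∀ i, ContinuousOn (fun t => fn n t i) (Icc 0 T))
    (hlim : ∀ t, 0 ≤ t → ∀ y, Tendsto (fun n => step (M / N n) (fn n t) y) atTop (𝓝 (g t y)))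
    (hD : ∀ᶠ n in atTop, ∫ t in (0 : ℝ)..T, nsq (M / N n) (lap (M / N n) (fn n t)) ≤ D)
    (K : Finset ℤ) :
    ∑ k ∈ K, wave M k ^ 4 * ∫ t in (0 : ℝ)..T, ‖fc M k (g t)‖ ^ 2 ≤ M * D := by
  have hcc : ∀ k, ∀ᶠ n in atTop,
      ContinuousOn (fun t => ‖latCoeff (M / N n) k (fn n t)‖ ^ 2) (Icc 0 T) := by
    intro k
    filter_upwards [hcont] with n hn
    refine ContinuousOn.pow (ContinuousOn.norm ?_) 2
    simp only [latCoeff, ZMod.dft_apply, smul_eq_mul]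
    exact continuousOn_const.mul (continuousOn_finsetSum _ fun i _ =>
      continuousOn_const.mul (Complex.continuous_ofReal.comp_continuousOn (hn i)))
  have h0 : ∀ k, Tendsto (fun n => ∫ t in (0 : ℝ)..T, ‖latCoeff (M / N n) k (fn n t)‖ ^ 2) atTop
      (𝓝 (∫ t in (0 : ℝ)..T, ‖fc M k (g t)‖ ^ 2)) := by
    intro k
    refine intervalIntegral.tendsto_integral_filter_of_dominated_convergence
      (fun _ => (C * M) ^ 2) ?_ ?_ intervalIntegrable_const ?_
    · filter_upwards [hcc k] with n hn
      rw [uIoc_of_le hT]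
      exact (hn.mono Ioc_subset_Icc_self).aestronglyMeasurable measurableSet_Ioc
    · filter_upwards [hC] with n hn
      refine Eventually.of_forall fun t ht => ?_
      rw [uIoc_of_le hT] at ht
      rw [norm_pow, norm_norm]
      have := norm_latCoeff_le (mesh_pos hM n) (mesh_mul M n) k _ (hn t (Ioc_subset_Icc_self ht))
      gcongr
    · refine Eventually.of_forall fun t ht => ?_
      rw [uIoc_of_le hT] at ht
      exact (tendsto_latCoeff hM hmesh k (hC.mono fun n hn => hn t (Ioc_subset_Icc_self ht))
        (hlim t ht.1.le)).norm.pow 2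
  have h1 : Tendsto (fun n => ∑ k ∈ K, latSymbol M (M / N n) k ^ 2 *
      ∫ t in (0 : ℝ)..T, ‖latCoeff (M / N n) k (fn n t)‖ ^ 2) atTop
      (𝓝 (∑ k ∈ K, (wave M k ^ 2) ^ 2 * ∫ t in (0 : ℝ)..T, ‖fc M k (g t)‖ ^ 2)) :=
    tendsto_finsetSum _ fun k _ => ((tendsto_latSymbol hM hmesh k).pow 2).mul (h0 k)
  simp only [← pow_mul] at h1
  refine le_of_tendsto h1 ?_
  have hall : ∀ᶠ n in atTop, ∀ k ∈ K,
      ContinuousOn (fun t => ‖latCoeff (M / N n) k (fn n t)‖ ^ 2) (Icc 0 T) :=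
    (Finset.eventually_all K).2 fun k _ => hcc k
  filter_upwards [eventually_injOn_intCast hM hmesh K, hD, hall, hcont] with n hn hn' hn'' hn3
  have hi : ∀ k ∈ K, IntervalIntegrable (fun t => latSymbol M (M / N n) k ^ 2 *
      ‖latCoeff (M / N n) k (fn n t)‖ ^ 2) volume 0 T := fun k hk =>
    ContinuousOn.intervalIntegrable (by
      rw [uIcc_of_le hT]
      exact continuousOn_const.mul (hn'' k hk))
  simp only [← intervalIntegral.integral_const_mul]
  rw [← intervalIntegral.integral_finsetSum hi]
  refine le_trans ?_ (mul_le_mul_of_nonneg_left hn' hM.le)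
  rw [← intervalIntegral.integral_const_mul]
  refine intervalIntegral.integral_mono_on hT ?_ ?_ fun t ht =>
    sum_latCoeff_le (mesh_pos hM n) (mesh_mul M n) _ K hn
  · have := IntervalIntegrable.sum K hi
    simpa only [Finset.sum_fn] using this
  · refine ContinuousOn.intervalIntegrable ?_
    rw [uIcc_of_le hT]
    exact continuousOn_const.mul (continuousOn_nsq fun i => continuousOn_lap hn3 i)

end Limit

/-! ### Primitives, and square integrable periodic functions -/

namespace IsPrim

variable {A B A' B' : ℝ → ℝ}

lemma eq_add (h : IsPrim A B) (a : ℝ) : A = fun x => A a + ∫ t in a..x, B t := by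
  ext x
  rw [← h.2 a x]
  ring

lemma ae_hasDerivAt (h : IsPrim A B) : ∀ᵐ x, HasDerivAt A (B x) x := by
  have hl : LocallyIntegrable B volume := by
    intro x
    refine ⟨Ioo (x - 1) (x + 1), Ioo_mem_nhds (by linarith) (by linarith), ?_⟩
    exact ((intervalIntegrable_iff_integrableOn_Ioc_of_le (by linarith)).1
      (h.1 (x - 1) (x + 1))).mono_set Ioo_subset_Ioc_self
  filter_upwards [_root_.LocallyIntegrable.ae_hasDerivAt_integral hl] with x hx
  rw [h.eq_add 0]
  exact (hx 0).const_add _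

lemma absolutelyContinuousOnInterval (h : IsPrim A B) (a b : ℝ) :
    AbsolutelyContinuousOnInterval A a b := by
  have h1 := (h.1 a b).absolutelyContinuousOnInterval_intervalIntegral (c := a) left_mem_uIcc
  have h2 : AbsolutelyContinuousOnInterval (fun _ : ℝ => A a) a b :=
    ((LipschitzWith.const (A a)).lipschitzOnWith).absolutelyContinuousOnInterval
  have h3 := h2.add h1
  rwa [h.eq_add a]

lemma continuous (h : IsPrim A B) : Continuous A := by
  rw [h.eq_add 0]
  exact continuous_const.add (intervalIntegral.continuous_primitive h.1 0)

lemma congr_ae (h : IsPrim A B) (hB : B =ᵐ[volume] B') : IsPrim A B' := by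
  refine ⟨fun a b => (h.1 a b).congr_ae (ae_restrict_of_ae hB), fun a b => ?_⟩
  rw [h.2 a b]
  exact intervalIntegral.integral_congr_ae (hB.mono fun _ hx _ => hx)

lemma mul (h : IsPrim A B) (h' : IsPrim A' B') :
    IsPrim (fun x => A x * A' x) fun x => B x * A' x + A x * B' x := by
  refine ⟨fun a b => ((h.1 a b).mul_continuousOn h'.continuous.continuousOn).add
    ((h'.1 a b).continuousOn_mul h.continuous.continuousOn), fun a b => ?_⟩
  rw [← (h.absolutelyContinuousOnInterval a b).integral_deriv_mul_eq_sub
    (h'.absolutelyContinuousOnInterval a b)]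
  refine intervalIntegral.integral_congr_ae ?_
  filter_upwards [h.ae_hasDerivAt, h'.ae_hasDerivAt] with x hx hx' _
  rw [hx.deriv, hx'.deriv]

lemma add (h : IsPrim A B) (h' : IsPrim A' B') : IsPrim (fun x => A x + A' x) fun x => B x + B' x :=
  ⟨fun a b => (h.1 a b).add (h'.1 a b), fun a b => by
    rw [intervalIntegral.integral_add (h.1 a b) (h'.1 a b), ← h.2, ← h'.2]
    ring⟩

lemma hasDerivAt (h : IsPrim A B) (hB : Continuous B) (x : ℝ) : HasDerivAt A (B x) x := by
  rw [h.eq_add 0]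
  exact (hB.integral_hasStrictDerivAt 0 x).hasDerivAt.const_add _

end IsPrim

namespace PerL2

variable {L : ℝ} {f g : ℝ → ℝ}

lemma aestronglyMeasurable (h : PerL2 L f) (a b : ℝ) :
    AEStronglyMeasurable f (volume.restrict (Ioc a b)) :=
  (h.int a b).1.aestronglyMeasurable

lemma memLp (h : PerL2 L f) (a b : ℝ) : MemLp f 2 (volume.restrict (Ioc a b)) :=
  (memLp_two_iff_integrable_sq (h.aestronglyMeasurable a b)).2 (h.sq a b).1

lemma of_memLp (hL : 0 < L) (hp : Function.Periodic f L)
    (h : MemLp f 2 (volume.restrict (Ioc 0 L))) : PerL2 L f := by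
  refine ⟨hp, hp.intervalIntegrable₀ hL.ne' ?_, ?_⟩
  · rw [intervalIntegrable_iff_integrableOn_Ioc_of_le hL.le]
    exact h.integrable one_le_two
  · have hp2 : Function.Periodic (fun x => f x ^ 2) L := fun x => by simp only [hp x]
    refine hp2.intervalIntegrable₀ hL.ne' ?_
    rw [intervalIntegrable_iff_integrableOn_Ioc_of_le hL.le]
    exact (memLp_two_iff_integrable_sq h.1).1 h

lemma of_continuous (hp : Function.Periodic f L) (hc : Continuous f) : PerL2 L f :=
  ⟨hp, fun _ _ => hc.intervalIntegrable _ _, fun _ _ => (hc.pow 2).intervalIntegrable _ _⟩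

lemma sub (hL : 0 < L) (hf : PerL2 L f) (hg : PerL2 L g) : PerL2 L fun x => f x - g x :=
  of_memLp hL (fun x => by rw [hf.periodic, hg.periodic]) ((hf.memLp 0 L).sub (hg.memLp 0 L))

lemma add (hL : 0 < L) (hf : PerL2 L f) (hg : PerL2 L g) : PerL2 L fun x => f x + g x :=
  of_memLp hL (fun x => by rw [hf.periodic, hg.periodic]) ((hf.memLp 0 L).add (hg.memLp 0 L))

lemma mul_continuous (hf : PerL2 L f) (hp : Function.Periodic g L) (hc : Continuous g) :
    PerL2 L fun x => f x * g x :=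
  ⟨fun x => by rw [hf.periodic, hp], fun a b => (hf.int a b).mul_continuousOn hc.continuousOn,
    fun a b => by
      simp only [mul_pow]
      exact (hf.sq a b).mul_continuousOn (hc.pow 2).continuousOn⟩

end PerL2

lemma IsPrim.periodic {A B : ℝ → ℝ} {L : ℝ} (h : IsPrim A B) (hB : Function.Periodic B L)
    (h0 : ∫ x in (0 : ℝ)..L, B x = 0) : Function.Periodic A L := by
  intro x
  have h1 := h.2 x (x + L)
  rw [hB.intervalIntegral_add_eq x 0, zero_add, h0] at h1
  linarith

/-! ### Fourier series of real functions -/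

section Fc

variable {L : ℝ}

lemma intervalIntegrable_ofReal {f : ℝ → ℝ} {a b : ℝ} (h : IntervalIntegrable f volume a b) :
    IntervalIntegrable (fun x => (f x : ℂ)) volume a b :=
  ⟨h.1.ofReal, h.2.ofReal⟩

lemma fourier_coe_eq (k : ℤ) (y : ℝ) : (fourier (-k) (y : AddCircle L) : ℂ) =
    (Real.cos (wave L k * y) : ℂ) - (Real.sin (wave L k * y) : ℂ) * Complex.I := by
  rw [fourier_coe_apply, Complex.ofReal_cos, Complex.ofReal_sin]
  have e : (2 * Real.pi * Complex.I * ((-k : ℤ) : ℂ) * y / L : ℂ) =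
      (-(wave L k * y : ℝ) : ℂ) * Complex.I := by
    rw [wave]
    push_cast
    ring
  rw [e, Complex.exp_mul_I, Complex.cos_neg, Complex.sin_neg]
  ring

lemma fc_eq {f : ℝ → ℝ} (hf : IntervalIntegrable f volume 0 L) (k : ℤ) :
    fc L k f = ((∫ y in (0 : ℝ)..L, f y * Real.cos (wave L k * y) : ℝ) : ℂ) -
      ((∫ y in (0 : ℝ)..L, f y * Real.sin (wave L k * y) : ℝ) : ℂ) * Complex.I := by
  have h1 : IntervalIntegrable (fun y => f y * Real.cos (wave L k * y)) volume 0 L :=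
    hf.mul_continuousOn (by fun_prop)
  have h2 : IntervalIntegrable (fun y => f y * Real.sin (wave L k * y)) volume 0 L :=
    hf.mul_continuousOn (by fun_prop)
  rw [fc, ← intervalIntegral.integral_ofReal, ← intervalIntegral.integral_ofReal,
    ← intervalIntegral.integral_mul_const, ← intervalIntegral.integral_sub]
  · refine intervalIntegral.integral_congr fun y _ => ?_
    simp only [fourier_coe_eq]
    push_cast
    ring
  · exact intervalIntegrable_ofReal h1
  · exact (intervalIntegrable_ofReal h2).mul_const _

lemma fc_sub {f g : ℝ → ℝ} (hf : IntervalIntegrable f volume 0 L)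
    (hg : IntervalIntegrable g volume 0 L) (k : ℤ) :
    fc L k (fun y => f y - g y) = fc L k f - fc L k g := by
  have hc : ContinuousOn (fun y : ℝ => (fourier (-k) (y : AddCircle L) : ℂ)) (uIcc 0 L) :=
    ((fourier (-k)).continuous.comp (AddCircle.continuous_mk' L)).continuousOn
  rw [fc, fc, fc, ← intervalIntegral.integral_sub]
  · refine intervalIntegral.integral_congr fun y _ => ?_
    push_cast
    ring
  · exact (intervalIntegrable_ofReal hf).continuousOn_mul hc
  · exact (intervalIntegrable_ofReal hg).continuousOn_mul hc

lemma wave_mul_self (hL : 0 < L) (k : ℤ) : wave L k * L = k * (2 * Real.pi) := by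
  rw [wave]
  field_simp

/-- Fourier coefficients of a derivative. -/
lemma IsPrim.fc_eq (hL : 0 < L) {A B : ℝ → ℝ} (h : IsPrim A B) (hA : Function.Periodic A L)
    (k : ℤ) : fc L k B = Complex.I * wave L k * fc L k A := by
  have hc : IsPrim (fun y => Real.cos (wave L k * y)) fun y => -Real.sin (wave L k * y) * wave L k :=
    .of_hasDerivAt (fun y => by
      have := ((hasDerivAt_id y).const_mul (wave L k)).cos
      simpa using this) (by fun_prop)
  have hs : IsPrim (fun y => Real.sin (wave L k * y)) fun y => Real.cos (wave L k * y) * wave L k :=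
    .of_hasDerivAt (fun y => by
      have := ((hasDerivAt_id y).const_mul (wave L k)).sin
      simpa using this) (by fun_prop)
  have hAL : A L = A 0 := by simpa using hA 0
  have e1 := (h.mul hc).2 0 L
  have e2 := (h.mul hs).2 0 L
  have i1 := h.1 0 L
  have cA := h.continuous
  rw [intervalIntegral.integral_add (i1.mul_continuousOn (by fun_prop))
    (Continuous.intervalIntegrable (by fun_prop) _ _)] at e1 e2
  simp only [wave_mul_self hL, Real.cos_int_mul_two_pi, hAL, mul_zero, Real.cos_zero, sub_self,
    Real.sin_zero] at e1 e2
  have hsin : Real.sin (k * (2 * Real.pi)) = 0 := by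
    rw [show (k : ℝ) * (2 * Real.pi) = ((2 * k : ℤ) : ℝ) * Real.pi by push_cast; ring,
      Real.sin_int_mul_pi]
  rw [hsin, mul_zero, sub_self] at e2
  have e3 : ∫ y in (0 : ℝ)..L, A y * (-Real.sin (wave L k * y) * wave L k) =
      -wave L k * ∫ y in (0 : ℝ)..L, A y * Real.sin (wave L k * y) := by
    rw [← intervalIntegral.integral_const_mul]
    exact intervalIntegral.integral_congr fun y _ => by ring
  have e4 : ∫ y in (0 : ℝ)..L, A y * (Real.cos (wave L k * y) * wave L k) =
      wave L k * ∫ y in (0 : ℝ)..L, A y * Real.cos (wave L k * y) := by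
    rw [← intervalIntegral.integral_const_mul]
    exact intervalIntegral.integral_congr fun y _ => by ring
  rw [e3] at e1
  rw [e4] at e2
  rw [PressurelessNS.fc_eq i1, PressurelessNS.fc_eq (cA.intervalIntegrable _ _)]
  have e5 : (∫ y in (0 : ℝ)..L, B y * Real.cos (wave L k * y)) =
    wave L k * ∫ y in (0 : ℝ)..L, A y * Real.sin (wave L k * y) := by linarith
  have e6 : (∫ y in (0 : ℝ)..L, B y * Real.sin (wave L k * y)) =
    -(wave L k * ∫ y in (0 : ℝ)..L, A y * Real.cos (wave L k * y)) := by linarith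
  rw [e5, e6]
  push_cast
  linear_combination ((wave L k : ℂ) *
    ((∫ y in (0 : ℝ)..L, A y * Real.sin (wave L k * y) : ℝ) : ℂ)) * Complex.I_sq

lemma fc_eq_fourierCoeffOn (hL : 0 < L) (f : ℝ → ℝ) (k : ℤ) :
    fc L k f = L * fourierCoeffOn hL (fun y => (f y : ℂ)) k := by
  rw [fourierCoeffOn_eq_integral, sub_zero, Complex.real_smul]
  have hL' : (L : ℂ) ≠ 0 := by exact_mod_cast hL.ne'
  push_cast
  rw [← mul_assoc, mul_one_div_cancel hL', one_mul, fc]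
  refine intervalIntegral.integral_congr fun y _ => ?_
  simp only [fourier_coe_apply, smul_eq_mul]

/-- Parseval's identity. -/
lemma PerL2.hasSum_fc (hL : 0 < L) {f : ℝ → ℝ} (hf : PerL2 L f) :
    HasSum (fun k => ‖fc L k f‖ ^ 2) (L * ∫ y in (0 : ℝ)..L, f y ^ 2) := by
  have h1 := (hasSum_sq_fourierCoeffOn hL (f := fun y => (f y : ℂ)) (hf.memLp 0 L).ofReal).mul_left
    (L ^ 2)
  have e : L ^ 2 * ((L - 0)⁻¹ • ∫ y in (0 : ℝ)..L, ‖(f y : ℂ)‖ ^ 2) =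
      L * ∫ y in (0 : ℝ)..L, f y ^ 2 := by
    simp only [Complex.norm_real, Real.norm_eq_abs, sq_abs, sub_zero, smul_eq_mul]
    field_simp
  rw [e] at h1
  have e2 : (fun k => ‖fc L k f‖ ^ 2) =
      fun k => L ^ 2 * ‖fourierCoeffOn hL (fun y => (f y : ℂ)) k‖ ^ 2 := by
    ext k
    rw [fc_eq_fourierCoeffOn hL, norm_mul, mul_pow, Complex.norm_real, Real.norm_eq_abs, sq_abs]
  rw [e2]
  exact h1

lemma PerL2.ae_eq_zero (hL : 0 < L) {f : ℝ → ℝ} (hf : PerL2 L f) (h : ∀ k, fc L k f = 0) :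
    f =ᵐ[volume.restrict (Ioc 0 L)] 0 := by
  have h1 := hf.hasSum_fc hL
  simp only [h, norm_zero, ne_eq, OfNat.ofNat_ne_zero, not_false_eq_true, zero_pow] at h1
  have h2 : ∫ y in (0 : ℝ)..L, f y ^ 2 = 0 := by
    have := h1.unique hasSum_zero
    exact (mul_eq_zero.1 this).resolve_left hL.ne'
  rw [intervalIntegral.integral_of_le hL.le,
    integral_eq_zero_iff_of_nonneg (fun _ => sq_nonneg _) (hf.sq 0 L).1] at h2
  filter_upwards [h2] with x hx
  exact pow_eq_zero_iff two_ne_zero |>.1 hx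

/-- A function whose Fourier coefficients are those of a primitive of `g` is a primitive of `g`. -/
lemma PerL2.exists_isPrim (hL : 0 < L) {f g : ℝ → ℝ} (hf : PerL2 L f) (hg : PerL2 L g)
    (h : ∀ k, fc L k g = Complex.I * wave L k * fc L k f) :
    ∃ A, IsPrim A g ∧ Function.Periodic A L ∧ f =ᵐ[volume.restrict (Ioc 0 L)] A := by
  have h0 : ∫ x in (0 : ℝ)..L, g x = 0 := by
    have h1 := h 0
    rw [wave, fc] at h1
    simp only [neg_zero, fourier_zero, one_mul, Int.cast_zero, mul_zero, zero_div,
      Complex.ofReal_zero, zero_mul] at h1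
    rw [intervalIntegral.integral_ofReal] at h1
    exact_mod_cast h1
  set c : ℝ := (∫ y in (0 : ℝ)..L, (f y - ∫ t in (0 : ℝ)..y, g t)) / L with hc
  set A : ℝ → ℝ := fun x => c + ∫ t in (0 : ℝ)..x, g t with hA
  have hcA₀ : Continuous fun x => ∫ t in (0 : ℝ)..x, g t :=
    intervalIntegral.continuous_primitive hg.int 0
  have hprim : IsPrim A g := ⟨hg.int, fun a b => by
    rw [hA, ← intervalIntegral.integral_interval_sub_left (hg.int 0 b) (hg.int 0 a)]
    ring⟩
  have hper := hprim.periodic hg.periodic h0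
  refine ⟨A, hprim, hper, ?_⟩
  have hAL2 : PerL2 L A := .of_continuous hper hprim.continuous
  have hz := (hf.sub hL hAL2).ae_eq_zero hL fun k => ?_
  · filter_upwards [hz] with x hx
    exact sub_eq_zero.1 hx
  · by_cases hk : k = 0
    · subst hk
      rw [fc]
      simp only [neg_zero, fourier_zero, one_mul]
      rw [intervalIntegral.integral_ofReal]
      norm_cast
      have e : ∀ y, f y - A y = (f y - ∫ t in (0 : ℝ)..y, g t) - c := fun y => by
        rw [hA]; ring
      simp only [e]
      rw [intervalIntegral.integral_sub ((hf.int 0 L).sub (hcA₀.intervalIntegrable _ _))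
        intervalIntegrable_const, intervalIntegral.integral_const, hc]
      simp only [sub_zero, smul_eq_mul]
      field_simp
      ring
    · rw [fc_sub (hf.int 0 L) (hAL2.int 0 L)]
      have h1 := hprim.fc_eq hL hper k
      rw [h k] at h1
      have hw : (Complex.I * wave L k : ℂ) ≠ 0 := by
        refine mul_ne_zero Complex.I_ne_zero ?_
        have : wave L k ≠ 0 := by
          rw [wave]
          have : (k : ℝ) ≠ 0 := by exact_mod_cast hk
          positivity
        exact_mod_cast this
      rw [mul_left_cancel₀ hw h1, sub_self]

end Fc

/-! ### Continuity in time of the second derivative -/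

section RieszFischer

variable {L : ℝ}

lemma intervalIntegral_conj (f : ℝ → ℂ) (a b : ℝ) :
    ∫ y in a..b, starRingEnd ℂ (f y) = starRingEnd ℂ (∫ y in a..b, f y) := by
  rw [intervalIntegral, intervalIntegral, integral_conj, integral_conj, map_sub]

lemma exists_perL2_of_summable (hL : 0 < L) {b : ℤ → ℂ} (hconj : ∀ k, b (-k) = starRingEnd ℂ (b k))
    (hs : Summable fun k => ‖b k‖ ^ 2) : ∃ g, PerL2 L g ∧ ∀ k, fc L k g = b k := by
  have : Fact (0 < L) := ⟨hL⟩
  have hL' : (L : ℂ) ≠ 0 := by exact_mod_cast hL.ne'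
  have hmem : Memℓp (fun k => b k / L) 2 := by
    refine memℓp_gen ?_
    have h1 := hs.mul_right (L ^ 2)⁻¹
    refine h1.congr fun k => ?_
    rw [norm_div, Complex.norm_real, Real.norm_eq_abs, abs_of_pos hL]
    norm_num
    rw [div_pow, div_eq_mul_inv]
  set G : Lp ℂ 2 (AddCircle.haarAddCircle (T := L)) :=
    fourierBasis.repr.symm ⟨fun k => b k / L, hmem⟩ with hG
  have hc : ∀ k, fourierCoeff (G : AddCircle L → ℂ) k = b k / L := by
    intro k
    rw [← fourierBasis_repr, hG, LinearIsometryEquiv.apply_symm_apply]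
  have hGm : MemLp (G : AddCircle L → ℂ) 2 volume := (Lp.memLp G).of_haarAddCircle
  have hmp := AddCircle.measurePreserving_mk L 0
  rw [zero_add] at hmp
  have hm : MemLp (fun y : ℝ => G (y : AddCircle L)) 2 (volume.restrict (Ioc 0 L)) :=
    hGm.comp_measurePreserving hmp
  have hint : IntervalIntegrable (fun y : ℝ => G (y : AddCircle L)) volume 0 L := by
    rw [intervalIntegrable_iff_integrableOn_Ioc_of_le hL.le]
    exact hm.integrable one_le_two
  refine ⟨fun y => (G (y : AddCircle L)).re, PerL2.of_memLp hL (fun y => ?_) hm.re, fun k => ?_⟩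
  · simp
  · have hcoef : ∀ k, ∫ y in (0 : ℝ)..L, fourier (-k) (y : AddCircle L) * G (y : AddCircle L) =
        b k := by
      intro k
      have h1 := fourierCoeff_eq_intervalIntegral (G : AddCircle L → ℂ) k 0
      rw [hc, zero_add, Complex.real_smul] at h1
      push_cast at h1
      field_simp at h1
      exact h1.symm
    have hcont : ∀ k : ℤ, ContinuousOn (fun y : ℝ => (fourier k (y : AddCircle L) : ℂ))
        (uIcc 0 L) := fun k =>
      ((fourier k).continuous.comp (AddCircle.continuous_mk' L)).continuousOn
    have h2 := hcoef k
    have h3 := congrArg (starRingEnd ℂ) (hcoef (-k))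
    rw [hconj, Complex.conj_conj, ← intervalIntegral_conj] at h3
    have h4 : fc L k (fun y => (G (y : AddCircle L)).re) = 2⁻¹ *
        ((∫ y in (0 : ℝ)..L, fourier (-k) (y : AddCircle L) * G (y : AddCircle L)) +
        ∫ y in (0 : ℝ)..L, starRingEnd ℂ
          (fourier (- -k) (y : AddCircle L) * G (y : AddCircle L))) := by
      rw [← intervalIntegral.integral_add, ← intervalIntegral.integral_const_mul, fc]
      · refine intervalIntegral.integral_congr fun y _ => ?_
        simp only [map_mul, ← fourier_neg, neg_neg]
        rw [← mul_add, Complex.add_conj]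
        push_cast
        ring
      · exact hint.continuousOn_mul (hcont _)
      · have := hint.continuousOn_mul (hcont (- -k))
        exact ⟨(Complex.conjCLE : ℂ →L[ℝ] ℂ).integrable_comp this.1,
          (Complex.conjCLE : ℂ →L[ℝ] ℂ).integrable_comp this.2⟩
    rw [h4, h2, h3]
    ring

/-- Continuity in `L²` of a function of time. -/
def ContL2 (L : ℝ) (g : ℝ → ℝ → ℝ) : Prop :=
  ∀ t, Tendsto (fun s => ∫ y in (0 : ℝ)..L, (g s y - g t y) ^ 2) (𝓝 t) (𝓝 0)

lemma exists_contL2 (hL : 0 < L) {b : ℝ → ℤ → ℂ} (hconj : ∀ t k, b t (-k) = starRingEnd ℂ (b t k))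
    (hc : ∀ k, Continuous fun t => b t k)
    (hs : ∀ T : ℕ, ∃ d : ℤ → ℝ, Summable d ∧ ∀ t < (T : ℝ), ∀ k, ‖b t k‖ ^ 2 ≤ d k) :
    ∃ g : ℝ → ℝ → ℝ, (∀ t, PerL2 L (g t)) ∧ (∀ t k, fc L k (g t) = b t k) ∧ ContL2 L g := by
  have hsum : ∀ t, Summable fun k => ‖b t k‖ ^ 2 := by
    intro t
    obtain ⟨T, hT⟩ := exists_nat_gt t
    obtain ⟨d, hd, hb⟩ := hs T
    exact Summable.of_nonneg_of_le (fun _ => sq_nonneg _) (hb t hT) hd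
  choose g hg hgb using fun t => exists_perL2_of_summable hL (hconj t) (hsum t)
  refine ⟨g, hg, hgb, fun t => ?_⟩
  have e : ∀ s, ∫ y in (0 : ℝ)..L, (g s y - g t y) ^ 2 = L⁻¹ * ∑' k, ‖b s k - b t k‖ ^ 2 := by
    intro s
    have h1 := (((hg s).sub hL (hg t)).hasSum_fc hL).tsum_eq
    simp only [fc_sub ((hg s).int 0 L) ((hg t).int 0 L), hgb] at h1
    rw [h1]
    field_simp
  simp only [e]
  obtain ⟨T, hT⟩ := exists_nat_gt t
  obtain ⟨d, hd, hb⟩ := hs T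
  have h1 : Tendsto (fun s => ∑' k, ‖b s k - b t k‖ ^ 2) (𝓝 t) (𝓝 (∑' _ : ℤ, (0 : ℝ))) := by
    refine tendsto_tsum_of_dominated_convergence (bound := fun k => 4 * d k) (hd.mul_left 4) ?_ ?_
    · intro k
      have h2 := (((hc k).tendsto t).sub_const (b t k)).norm.pow 2
      simpa using h2
    · filter_upwards [gt_mem_nhds hT] with s hs k
      rw [norm_pow, norm_norm]
      have h3 := norm_sub_le (b s k) (b t k)
      have h4 := hb s hs k
      have h5 := hb t hT k
      have h6 : ‖b s k - b t k‖ ^ 2 ≤ (‖b s k‖ + ‖b t k‖) ^ 2 := by gcongr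
      nlinarith [sq_nonneg (‖b s k‖ - ‖b t k‖)]
  rw [tsum_zero] at h1
  simpa using h1.const_mul L⁻¹

lemma fc_neg (f : ℝ → ℝ) (k : ℤ) : fc L (-k) f = starRingEnd ℂ (fc L k f) := by
  rw [fc, fc, ← intervalIntegral_conj]
  refine intervalIntegral.integral_congr fun y _ => ?_
  simp only [map_mul, Complex.conj_ofReal, ← fourier_neg]

lemma continuous_fc {g : ℝ → ℝ → ℝ} (hg : Continuous (Function.uncurry g)) (k : ℤ) :
    Continuous fun t => fc L k (g t) := by
  refine intervalIntegral.continuous_parametric_intervalIntegral_of_continuous' ?_ 0 L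
  refine Continuous.mul ?_ (Complex.continuous_ofReal.comp hg)
  exact (fourier (-k)).continuous.comp ((AddCircle.continuous_mk' L).comp continuous_snd)

lemma eq_of_ae_eq_of_periodic (hL : 0 < L) {f g : ℝ → ℝ} (hf : Continuous f) (hg : Continuous g)
    (hpf : Function.Periodic f L) (hpg : Function.Periodic g L)
    (h : f =ᵐ[volume.restrict (Ioc 0 L)] g) : f = g := by
  have h1 := Measure.eqOn_Ioc_of_ae_eq volume h hf.continuousOn hg.continuousOn
  ext y
  have h2 : Function.Periodic (fun y => f y - g y) L := fun y => by simp only [hpf y, hpg y]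
  obtain ⟨z, hz, hzy⟩ := h2.exists_mem_Ioc hL y 0
  rw [zero_add] at hz
  simp only [h1 hz, sub_self] at hzy
  exact sub_eq_zero.1 hzy

end RieszFischer

section Modes

variable {M a : ℝ} {τ₀ F₁ U₀ : ℝ → ℝ} {τ u σ : ℝ → ℝ → ℝ}

lemma IsLagSol.continuous_slice {g : ℝ → ℝ → ℝ} (hg : Continuous (Function.uncurry g)) (t : ℝ) :
    Continuous (g t) :=
  hg.comp (Continuous.prodMk_right t)

lemma IsLagSol.cw (H : IsLagSol M a τ₀ F₁ U₀ τ u σ) :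
    Continuous (Function.uncurry fun t y => τ t y ^ 3 * σ t y) :=
  (H.cτ.pow 3).mul H.cσ

lemma IsLagSol.isPrim_u (H : IsLagSol M a τ₀ F₁ U₀ τ u σ) (t : ℝ) :
    IsPrim (u t) fun y => τ t y ^ 3 * σ t y :=
  .of_hasDerivAt (H.derivu t) (IsLagSol.continuous_slice H.cw t)

lemma IsLagSol.fc_w (H : IsLagSol M a τ₀ F₁ U₀ τ u σ) (hM : 0 < M) (t : ℝ) (k : ℤ) :
    fc M k (fun y => τ t y ^ 3 * σ t y) = Complex.I * wave M k * fc M k (u t) :=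
  (H.isPrim_u t).fc_eq hM (H.peru t) k

lemma fc_integral {g : ℝ → ℝ → ℝ} (hg : Continuous (Function.uncurry g)) (k : ℤ) (t : ℝ) :
    fc M k (fun y => ∫ s in (0 : ℝ)..t, g s y) = ∫ s in (0 : ℝ)..t, fc M k (g s) := by
  simp only [fc]
  have hc : Continuous (Function.uncurry fun y s : ℝ =>
      (fourier (-k) (y : AddCircle M) : ℂ) * (g s y : ℂ)) := by
    refine Continuous.mul ?_ (Complex.continuous_ofReal.comp (hg.comp continuous_swap))
    exact (fourier (-k)).continuous.comp ((AddCircle.continuous_mk' M).comp continuous_fst)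
  rw [← intervalIntegral_intervalIntegral_swap]
  · refine intervalIntegral.integral_congr fun y _ => ?_
    rw [← intervalIntegral.integral_ofReal, ← intervalIntegral.integral_const_mul]
  · refine (hc.continuousOn.integrableOn_compact
      ((isCompact_uIcc (a := 0) (b := M)).prod (isCompact_uIcc (a := 0) (b := t)))).mono_set ?_
    exact prod_mono uIoc_subset_uIcc uIoc_subset_uIcc

lemma IsLagSol.fc_u (H : IsLagSol M a τ₀ F₁ U₀ τ u σ) (hM : 0 < M) {t : ℝ} (ht : 0 ≤ t) (k : ℤ) :
    fc M k (u t) = fc M k (u 0) + Complex.I * wave M k * ∫ s in (0 : ℝ)..t, fc M k (σ s) := by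
  have hcu := IsLagSol.continuous_slice H.cu
  have hcσ : ∀ y, Continuous fun s => σ s y := fun y => H.cσ.comp (Continuous.prodMk_left y)
  set Q : ℝ → ℝ := fun y => ∫ s in (0 : ℝ)..t, σ s y with hQ
  have hQp : Function.Periodic Q M := fun y => by simp only [hQ, H.perσ _ y]
  have hd : ∀ y, HasDerivAt Q (u t y - u 0 y) y := by
    refine hasDerivAt_of_periodic_of_integral hM hQp (fun y => ?_) ((hcu t).sub (hcu 0))
      fun y hy => ?_
    · rw [H.peru t, H.peru 0]
    · rw [H.initu, H.evolu t ht y hy, hQ, intervalIntegral.integral_sub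
        ((hcσ y).intervalIntegrable _ _) ((hcσ 0).intervalIntegrable _ _)]
  have h1 := (IsPrim.of_hasDerivAt hd ((hcu t).sub (hcu 0))).fc_eq hM hQp k
  rw [fc_sub ((hcu t).intervalIntegrable _ _) ((hcu 0).intervalIntegrable _ _),
    fc_integral H.cσ] at h1
  rw [← h1]
  ring

/-- Energy estimate for a single Fourier mode. -/
lemma IsLagSol.wave_fc_le (H : IsLagSol M a τ₀ F₁ U₀ τ u σ) (hM : 0 < M) {t T : ℝ} (ht : 0 ≤ t)
    (htT : t ≤ T) (k : ℤ) :
    wave M k ^ 4 * ‖fc M k (u t)‖ ^ 2 ≤ wave M k ^ 4 * ‖fc M k (u 0)‖ ^ 2 +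
      (wave M k ^ 4 * (∫ s in (0 : ℝ)..T, ‖fc M k (fun y => τ s y ^ 3 * σ s y)‖ ^ 2) +
        wave M k ^ 4 * ∫ s in (0 : ℝ)..T, ‖fc M k (σ s)‖ ^ 2) := by
  have cσ := continuous_fc (L := M) H.cσ k
  have cw := continuous_fc (L := M) H.cw k
  have cu := continuous_fc (L := M) H.cu k
  set z : ℝ → ℂ := fun t => fc M k (u 0) + Complex.I * wave M k * ∫ s in (0 : ℝ)..t, fc M k (σ s)
    with hz
  have hzd : ∀ s, HasDerivAt z (Complex.I * wave M k * fc M k (σ s)) s := fun s =>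
    ((cσ.integral_hasStrictDerivAt 0 s).hasDerivAt.const_mul _).const_add _
  have hzu : ∀ s, 0 ≤ s → z s = fc M k (u s) := fun s hs => (H.fc_u hM hs k).symm
  have hcz : Continuous z := continuous_iff_continuousAt.2 fun s => (hzd s).continuousAt
  have hN : ∀ s, HasDerivAt (fun s => ‖z s‖ ^ 2)
      (2 * inner ℝ (z s) (Complex.I * wave M k * fc M k (σ s))) s := fun s => (hzd s).norm_sq
  have hcD : Continuous fun s => 2 * inner ℝ (z s) (Complex.I * wave M k * fc M k (σ s)) :=
    continuous_const.mul (hcz.inner (continuous_const.mul cσ))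
  have h1 := intervalIntegral.integral_eq_sub_of_hasDerivAt (a := 0) (b := t) (fun s _ => hN s)
    (hcD.intervalIntegrable _ _)
  have cR : Continuous fun s => ‖fc M k (fun y => τ s y ^ 3 * σ s y)‖ ^ 2 + ‖fc M k (σ s)‖ ^ 2 :=
    (cw.norm.pow 2).add (cσ.norm.pow 2)
  have h2 : ∫ s in (0 : ℝ)..t, 2 * inner ℝ (z s) (Complex.I * wave M k * fc M k (σ s)) ≤
      ∫ s in (0 : ℝ)..t, (‖fc M k (fun y => τ s y ^ 3 * σ s y)‖ ^ 2 + ‖fc M k (σ s)‖ ^ 2) := by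
    refine intervalIntegral.integral_mono_on ht (hcD.intervalIntegrable _ _)
      (cR.intervalIntegrable _ _) fun s hs => ?_
    have e1 := real_inner_le_norm (z s) (Complex.I * wave M k * fc M k (σ s))
    rw [norm_mul, norm_mul, Complex.norm_I, one_mul] at e1
    rw [H.fc_w hM, norm_mul, norm_mul, Complex.norm_I, one_mul, ← hzu s hs.1]
    nlinarith [sq_nonneg (‖(wave M k : ℂ)‖ * ‖z s‖ - ‖fc M k (σ s)‖)]
  have h3 : ∫ s in (0 : ℝ)..t, (‖fc M k (fun y => τ s y ^ 3 * σ s y)‖ ^ 2 + ‖fc M k (σ s)‖ ^ 2) ≤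
      ∫ s in (0 : ℝ)..T, (‖fc M k (fun y => τ s y ^ 3 * σ s y)‖ ^ 2 + ‖fc M k (σ s)‖ ^ 2) :=
    intervalIntegral.integral_mono_interval le_rfl ht htT
      (Eventually.of_forall fun s => by positivity) (cR.intervalIntegrable _ _)
  have cw2 : Continuous fun s => ‖fc M k (fun y => τ s y ^ 3 * σ s y)‖ ^ 2 := cw.norm.pow 2
  have cσ2 : Continuous fun s => ‖fc M k (σ s)‖ ^ 2 := cσ.norm.pow 2
  have h5 := intervalIntegral.integral_add (cw2.intervalIntegrable (μ := volume) 0 T)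
    (cσ2.intervalIntegrable 0 T)
  simp only [hzu t ht, hzu 0 le_rfl] at h1
  have h4 : ‖fc M k (u t)‖ ^ 2 ≤ ‖fc M k (u 0)‖ ^ 2 +
      ((∫ s in (0 : ℝ)..T, ‖fc M k (fun y => τ s y ^ 3 * σ s y)‖ ^ 2) +
        ∫ s in (0 : ℝ)..T, ‖fc M k (σ s)‖ ^ 2) := by linarith
  rw [← mul_add, ← mul_add]
  have : 0 ≤ wave M k ^ 4 := by positivity
  gcongr

end Modes

/-- Global solution in mass coordinates, with `u_yy` continuous in time with values in `L²`. -/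
theorem IsLagData.exists_isLagSol {M : ℝ} {τ₀ τ₁ F₁ F₂ U₀ U₁ U₂ : ℝ → ℝ}
    (D : IsLagData M τ₀ τ₁ F₁ F₂ U₀ U₁ U₂) :
    ∃ (a : ℝ) (τ u σ g : ℝ → ℝ → ℝ), IsLagSol M a τ₀ F₁ U₀ τ u σ ∧ (∀ t, PerL2 M (g t)) ∧
      (∀ t, IsPrim (fun y => τ t y ^ 3 * σ t y) (g t)) ∧ ContL2 M g := by
  have hM := D.mass_pos
  obtain ⟨a, U, N, _, τn, un, τ, u, σ, ha, A, hτ, hu, hσ⟩ := D.exists_limit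
  have H := A.isLagSol ha D hτ hu hσ
  have hsum : ∀ T : ℕ, ∃ d : ℤ → ℝ, Summable d ∧ ∀ t < (T : ℝ), ∀ k,
      ‖-((wave M k : ℂ) ^ 2) * fc M k (u t)‖ ^ 2 ≤ d k := by
    intro T
    obtain ⟨C, hC⟩ := A.reg T
    have hT : (0 : ℝ) ≤ T := Nat.cast_nonneg T
    have s0 : ∀ K : Finset ℤ, ∑ k ∈ K, wave M k ^ 4 * ‖fc M k (u 0)‖ ^ 2 ≤ _ :=
      sum_wave_fc_le hM A.mesh (fn := fun n => un n 0) (C := C)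
        (hC.mono fun n hn => hn.regu.bound 0 ⟨le_rfl, hT⟩) (hu.of_nonneg le_rfl)
        (Eventually.of_forall fun n => by
          rw [A.initu n]
          exact nsq_lap_samp_le (mesh_pos hM n) (mesh_mul M n) D.periodic_U D.dU D.dU₁ D.sqU)
    have s1 : ∀ K : Finset ℤ, ∑ k ∈ K, wave M k ^ 4 * ∫ s in (0 : ℝ)..T,
        ‖fc M k (fun y => τ s y ^ 3 * σ s y)‖ ^ 2 ≤ _ :=
      sum_wave_integral_fc_le hM A.mesh (fn := fun n t => fwd (M / N n) (un n t))
        (g := fun t y => τ t y ^ 3 * σ t y) (C := C) hT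
        (hC.mono fun n hn => hn.fwdu) ((A.flow T).mono fun n hn =>
          continuousOn_fwd fun i => hn.continuousOn_u i)
        (fun t ht => A.tendsto_fwd hτ hσ ht) (hC.mono fun n hn => hn.lapw)
    have s2 : ∀ K : Finset ℤ, ∑ k ∈ K, wave M k ^ 4 * ∫ s in (0 : ℝ)..T,
        ‖fc M k (σ s)‖ ^ 2 ≤ _ :=
      sum_wave_integral_fc_le hM A.mesh (fn := fun n => flux (M / N n) (τn n) (un n)) (C := C) hT
        (hC.mono fun n hn => hn.regσ.bound) ((A.flow T).mono fun n hn i => hn.continuousOn_flux i)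
        (fun t ht => hσ.of_nonneg ht) (hC.mono fun n hn => hn.lapσ)
    have hnn : ∀ f : ℝ → ℂ, 0 ≤ ∫ s in (0 : ℝ)..T, ‖f s‖ ^ 2 := fun f =>
      intervalIntegral.integral_nonneg hT fun s _ => sq_nonneg _
    refine ⟨_, (summable_of_sum_le (fun k => by positivity) s0).add
      ((summable_of_sum_le (fun k => mul_nonneg (by positivity) (hnn _)) s1).add
      (summable_of_sum_le (fun k => mul_nonneg (by positivity) (hnn _)) s2)), fun t ht k => ?_⟩
    have h1 := H.wave_fc_le hM (le_max_right t 0) (max_le ht.le hT) k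
    rw [H.maxu] at h1
    rw [norm_mul, norm_neg, norm_pow, Complex.norm_real, Real.norm_eq_abs, sq_abs, mul_pow,
      ← pow_mul]
    exact h1
  have hconj : ∀ (t : ℝ) (k : ℤ), -((wave M (-k) : ℂ) ^ 2) * fc M (-k) (u t) =
      starRingEnd ℂ (-((wave M k : ℂ) ^ 2) * fc M k (u t)) := fun t k => by
    simp only [fc_neg, map_mul, map_neg, map_pow, Complex.conj_ofReal]
    have : wave M (-k) = -wave M k := by simp only [wave]; push_cast; ring
    rw [this]
    push_cast
    ring
  obtain ⟨g, hg, hgb, hgc⟩ := exists_contL2 hM (b := fun t k => -((wave M k : ℂ) ^ 2) * fc M k (u t))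
    hconj (fun k => continuous_const.mul (continuous_fc H.cu k)) hsum
  refine ⟨a, τ, u, σ, g, H, hg, fun t => ?_, hgc⟩
  have hwc := IsLagSol.continuous_slice H.cw t
  have hwp : Function.Periodic (fun y => τ t y ^ 3 * σ t y) M := fun y => by
    simp only [H.perτ t y, H.perσ t y]
  obtain ⟨A, hA, hAp, hAe⟩ := PerL2.exists_isPrim hM (.of_continuous hwp hwc) (hg t) fun k => by
    rw [hgb, H.fc_w hM]
    linear_combination (-(wave M k : ℂ) ^ 2 * fc M k (u t)) * Complex.I_sq
  rw [eq_of_ae_eq_of_periodic hM hwc hA.continuous hwp hAp hAe]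
  exact hA

/-! ### Functions on the torus as periodic functions on the line -/

lemma memLp_liftIoc {T : ℝ} [Fact (0 < T)] {f : ℝ → ℝ}
    (h : MemLp f 2 (volume.restrict (Ioc 0 T))) : MemLp (AddCircle.liftIoc T 0 f) 2 := by
  have e : volume.restrict (Ioc 0 T) = volume.restrict (Ioc 0 (0 + T)) := by rw [zero_add]
  rw [e] at h
  simp only [AddCircle.liftIoc, Set.domRestrict_def, Function.comp_def]
  apply h.comp_measurePreserving
  refine .comp (measurePreserving_subtype_coe measurableSet_Ioc) ?_
  exact AddCircle.measurePreserving_equivIoc T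

lemma liftIoc_coe_of_periodic {T : ℝ} [hT : Fact (0 < T)] {f : ℝ → ℝ} (hf : Function.Periodic f T)
    (y : ℝ) : AddCircle.liftIoc T 0 f (y : AddCircle T) = f y := by
  obtain ⟨z, hz, hzy⟩ : ∃ z ∈ Ioc (0 : ℝ) (0 + T), (z : AddCircle T) = y := by
    have : (y : AddCircle T) ∈ ((↑) : ℝ → AddCircle T) '' Ioc 0 (0 + T) := by
      rw [AddCircle.coe_image_Ioc_eq]
      exact mem_univ _
    exact this
  rw [← hzy, AddCircle.liftIoc_coe_apply hz]
  have h1 : hf.lift (z : AddCircle T) = hf.lift (y : AddCircle T) := by rw [hzy]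
  simpa using h1

/-- The element of `L²` of the torus defined by a periodic function on the line. -/
def ofFun (f : ℝ → ℝ) : L2 :=
  open Classical in
  if h : MemLp (AddCircle.liftIoc (2 * Real.pi) 0 f) 2 volume then h.toLp else 0

lemma ofFun_ae {f : ℝ → ℝ} (hf : PerL2 (2 * Real.pi) f) :
    ofFun f =ᵐ[volume] AddCircle.liftIoc (2 * Real.pi) 0 f := by
  have h := memLp_liftIoc (hf.memLp 0 (2 * Real.pi))
  rw [ofFun, dif_pos h]
  exact h.coeFn_toLp

lemma integral_torus {E : Type*} [NormedAddCommGroup E] [NormedSpace ℝ E] (f : Torus → E) :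
    ∫ x, f x = ∫ y in (0 : ℝ)..2 * Real.pi, f (y : Torus) := by
  have := AddCircle.intervalIntegral_preimage (2 * Real.pi) 0 f
  rw [zero_add] at this
  exact this.symm

lemma integral_ofFun_mul {f : ℝ → ℝ} (hf : PerL2 (2 * Real.pi) f) (φ : Torus → ℝ) :
    ∫ x, ofFun f x * φ x = ∫ y in (0 : ℝ)..2 * Real.pi, f y * φ (y : Torus) := by
  have h1 : ∫ x, ofFun f x * φ x = ∫ x, AddCircle.liftIoc (2 * Real.pi) 0 f x * φ x :=
    integral_congr_ae (by filter_upwards [ofFun_ae hf] with x hx; rw [hx])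
  rw [h1, integral_torus]
  simp only [liftIoc_coe_of_periodic hf.periodic]

lemma norm_sq_L2 (f : L2) : ‖f‖ ^ 2 = ∫ y in (0 : ℝ)..2 * Real.pi, f (y : Torus) ^ 2 := by
  have h := L2.inner_def (𝕜 := ℝ) f f
  rw [real_inner_self_eq_norm_sq] at h
  rw [h, integral_torus]
  refine intervalIntegral.integral_congr fun y _ => ?_
  simp [pow_two]

lemma perL2_coe (f : L2) : PerL2 (2 * Real.pi) fun y => f (y : Torus) := by
  refine .of_memLp Real.two_pi_pos (fun y => by simp) ?_
  have hmp := AddCircle.measurePreserving_mk (2 * Real.pi) 0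
  rw [zero_add] at hmp
  exact (Lp.memLp f).comp_measurePreserving hmp

lemma ae_coe_of_ae {p : Torus → Prop} (h : ∀ᵐ x, p x) :
    ∀ᵐ y ∂(volume.restrict (Ioc 0 (2 * Real.pi))), p ((y : ℝ) : Torus) := by
  have hmp := AddCircle.measurePreserving_mk (2 * Real.pi) 0
  rw [zero_add] at hmp
  exact hmp.quasiMeasurePreserving.ae h

lemma norm_sq_ofFun_sub {f g : ℝ → ℝ} (hf : PerL2 (2 * Real.pi) f) (hg : PerL2 (2 * Real.pi) g) :
    ‖ofFun f - ofFun g‖ ^ 2 = ∫ y in (0 : ℝ)..2 * Real.pi, (f y - g y) ^ 2 := by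
  rw [norm_sq_L2, intervalIntegral.integral_of_le Real.two_pi_pos.le,
    intervalIntegral.integral_of_le Real.two_pi_pos.le]
  refine integral_congr_ae ?_
  filter_upwards [ae_coe_of_ae (Lp.coeFn_sub (ofFun f) (ofFun g)), ae_coe_of_ae (ofFun_ae hf),
    ae_coe_of_ae (ofFun_ae hg)] with y h1 h2 h3
  rw [h1, Pi.sub_apply, h2, h3, liftIoc_coe_of_periodic hf.periodic,
    liftIoc_coe_of_periodic hg.periodic]

lemma ofFun_congr {f g : ℝ → ℝ} (hf : PerL2 (2 * Real.pi) f) (hg : PerL2 (2 * Real.pi) g)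
    (h : f =ᵐ[volume.restrict (Ioc 0 (2 * Real.pi))] g) : ofFun f = ofFun g := by
  rw [← sub_eq_zero, ← norm_eq_zero, ← sq_eq_zero_iff, norm_sq_ofFun_sub hf hg,
    intervalIntegral.integral_of_le Real.two_pi_pos.le]
  rw [integral_congr_ae (g := fun _ => (0 : ℝ)), integral_zero]
  filter_upwards [h] with y hy
  rw [hy, sub_self, zero_pow two_ne_zero]

lemma ofFun_coe (f : L2) : ofFun (fun y => f (y : Torus)) = f := by
  refine Lp.ext ((ofFun_ae (perL2_coe f)).trans (Eventually.of_forall fun x => ?_))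
  obtain ⟨y, rfl⟩ := QuotientAddGroup.mk_surjective x
  exact liftIoc_coe_of_periodic (perL2_coe f).periodic y

lemma isTestPair_of_periodic {f f' : ℝ → ℝ} (hf : Function.Periodic f (2 * Real.pi))
    (hf' : Function.Periodic f' (2 * Real.pi)) (hc : ContDiff ℝ ∞ f)
    (hd : ∀ x, HasDerivAt f (f' x) x) :
    IsTestPair (AddCircle.liftIoc (2 * Real.pi) 0 f) (AddCircle.liftIoc (2 * Real.pi) 0 f') := by
  simp only [IsTestPair, liftIoc_coe_of_periodic hf, liftIoc_coe_of_periodic hf']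
  exact ⟨hc, hd⟩

lemma wave_two_pi (k : ℤ) : wave (2 * Real.pi) k = k := by
  rw [wave]
  field_simp

lemma periodic_cos_wave (k : ℤ) :
    Function.Periodic (fun y => Real.cos (wave (2 * Real.pi) k * y)) (2 * Real.pi) := fun y => by
  simp only [wave_two_pi, mul_add]
  exact Real.cos_add_int_mul_two_pi _ k

lemma periodic_sin_wave (k : ℤ) :
    Function.Periodic (fun y => Real.sin (wave (2 * Real.pi) k * y)) (2 * Real.pi) := fun y => by
  simp only [wave_two_pi, mul_add]
  exact Real.sin_add_int_mul_two_pi _ k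

lemma isTestPair_cos (k : ℤ) :
    IsTestPair (AddCircle.liftIoc (2 * Real.pi) 0 fun y => Real.cos (wave (2 * Real.pi) k * y))
      (AddCircle.liftIoc (2 * Real.pi) 0
        fun y => -wave (2 * Real.pi) k * Real.sin (wave (2 * Real.pi) k * y)) := by
  refine isTestPair_of_periodic (periodic_cos_wave k) (fun y => ?_) (by fun_prop) fun y => ?_
  · simp only [periodic_sin_wave k y]
  · have := ((hasDerivAt_id y).const_mul (wave (2 * Real.pi) k)).cos
    refine this.congr_deriv ?_
    simp only [id, mul_one]
    ring

lemma isTestPair_sin (k : ℤ) :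
    IsTestPair (AddCircle.liftIoc (2 * Real.pi) 0 fun y => Real.sin (wave (2 * Real.pi) k * y))
      (AddCircle.liftIoc (2 * Real.pi) 0
        fun y => wave (2 * Real.pi) k * Real.cos (wave (2 * Real.pi) k * y)) := by
  refine isTestPair_of_periodic (periodic_sin_wave k) (fun y => ?_) (by fun_prop) fun y => ?_
  · simp only [periodic_cos_wave k y]
  · have := ((hasDerivAt_id y).const_mul (wave (2 * Real.pi) k)).sin
    refine this.congr_deriv ?_
    simp only [id, mul_one]
    ring

/-- Smooth functions separate the elements of `L²`. -/
lemma eq_zero_of_forall_test {f : L2}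
    (h : ∀ φ φ' : Torus → ℝ, IsTestPair φ φ' → ∫ x, f x * φ x = 0) : f = 0 := by
  have hf := perL2_coe f
  have hz := hf.ae_eq_zero Real.two_pi_pos fun k => by
    have h1 := h _ _ (isTestPair_cos k)
    have h2 := h _ _ (isTestPair_sin k)
    rw [integral_torus] at h1 h2
    simp only [liftIoc_coe_of_periodic (periodic_cos_wave k)] at h1
    simp only [liftIoc_coe_of_periodic (periodic_sin_wave k)] at h2
    rw [fc_eq (hf.int 0 _), h1, h2]
    simp
  rw [← ofFun_coe f, ofFun_congr hf (.of_continuous (f := fun _ => 0) (fun _ => rfl)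
    continuous_const) hz]
  have h0 : (ofFun fun _ => 0) = 0 := by
    rw [← norm_eq_zero, ← sq_eq_zero_iff, norm_sq_L2,
      intervalIntegral.integral_of_le Real.two_pi_pos.le]
    rw [integral_congr_ae (g := fun _ => (0 : ℝ)), integral_zero]
    filter_upwards [ae_coe_of_ae (ofFun_ae (.of_continuous (f := fun _ => 0) (fun _ => rfl)
      continuous_const))] with y hy
    rw [hy, liftIoc_coe_of_periodic (fun _ => rfl), zero_pow two_ne_zero]
  exact h0

lemma IsWeakDeriv.unique {f g g' : L2} (h : IsWeakDeriv f g) (h' : IsWeakDeriv f g') : g = g' := by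
  rw [← sub_eq_zero]
  refine eq_zero_of_forall_test fun φ φ' hφ => ?_
  have e : ∫ x, (g - g' : L2) x * φ x = ∫ x, (g x * φ x - g' x * φ x) := by
    refine integral_congr_ae ?_
    filter_upwards [Lp.coeFn_sub g g'] with x hx
    rw [hx, Pi.sub_apply, sub_mul]
  rw [e, integral_sub (integrable_mul_continuous g hφ.continuous.1)
    (integrable_mul_continuous g' hφ.continuous.1)]
  linarith [h φ φ' hφ, h' φ φ' hφ]

lemma Sobolev.ext_zero {k : ℕ} {f g : Sobolev k} (h : der f 0 = der g 0) : f = g := by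
  have key : ∀ j : ℕ, ∀ hj : j < k + 1, der f ⟨j, hj⟩ = der g ⟨j, hj⟩ := by
    intro j
    induction j with
    | zero => exact fun _ => h
    | succ j ih =>
      intro hj
      have h1 := f.2 ⟨j, by omega⟩
      have h2 := g.2 ⟨j, by omega⟩
      have h3 : f.1 (Fin.castSucc ⟨j, by omega⟩) = g.1 (Fin.castSucc ⟨j, by omega⟩) :=
        ih (by omega)
      rw [h3] at h1
      exact h1.unique h2
  refine Subtype.ext (PiLp.ext fun j => ?_)
  exact key j.1 j.2

/-- A periodic primitive has a weak derivative. -/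
lemma IsPrim.isWeakDeriv {A B : ℝ → ℝ} (h : IsPrim A B)
    (hA : Function.Periodic A (2 * Real.pi)) (hB : PerL2 (2 * Real.pi) B) :
    IsWeakDeriv (ofFun A) (ofFun B) := by
  intro φ φ' hφ
  have hAL : PerL2 (2 * Real.pi) A := .of_continuous hA h.continuous
  have cφ : Continuous fun y : ℝ => φ (y : Torus) := hφ.1.continuous
  have cφ' : Continuous fun y : ℝ => φ' (y : Torus) :=
    hφ.continuous.2.comp (AddCircle.continuous_mk' _)
  rw [integral_ofFun_mul hAL, integral_ofFun_mul hB]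
  have h1 := (h.mul (IsPrim.of_hasDerivAt hφ.2 cφ')).2 0 (2 * Real.pi)
  have cAφ' : Continuous fun y : ℝ => A y * φ' (y : Torus) := h.continuous.mul cφ'
  have h4 := intervalIntegral.integral_add ((h.1 0 (2 * Real.pi)).mul_continuousOn
    cφ.continuousOn) (cAφ'.intervalIntegrable 0 (2 * Real.pi))
  have h2 : A (2 * Real.pi) = A 0 := by simpa using hA 0
  have h3 : φ ((2 * Real.pi : ℝ) : Torus) = φ ((0 : ℝ) : Torus) := by
    congr 1
    simp
  simp only [h2, h3, sub_self] at h1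
  linarith

lemma IsWeakDeriv.fc {f g : L2} (h : IsWeakDeriv f g) (k : ℤ) :
    fc (2 * Real.pi) k (fun y => g (y : Torus)) =
      Complex.I * wave (2 * Real.pi) k * PressurelessNS.fc (2 * Real.pi) k fun y => f (y : Torus) := by
  have h1 := h _ _ (isTestPair_cos k)
  have h2 := h _ _ (isTestPair_sin k)
  have p1 : Function.Periodic (fun y => -wave (2 * Real.pi) k *
      Real.sin (wave (2 * Real.pi) k * y)) (2 * Real.pi) := fun y => by
    simp only [periodic_sin_wave k y]
  have p2 : Function.Periodic (fun y => wave (2 * Real.pi) k *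
      Real.cos (wave (2 * Real.pi) k * y)) (2 * Real.pi) := fun y => by
    simp only [periodic_cos_wave k y]
  rw [integral_torus, integral_torus] at h1 h2
  simp only [liftIoc_coe_of_periodic (periodic_cos_wave k), liftIoc_coe_of_periodic p1] at h1
  simp only [liftIoc_coe_of_periodic (periodic_sin_wave k), liftIoc_coe_of_periodic p2] at h2
  simp only [mul_left_comm (f _), intervalIntegral.integral_const_mul] at h1 h2
  have h3 := congrArg (fun r : ℝ => (r : ℂ)) h1
  have h4 := congrArg (fun r : ℝ => (r : ℂ)) h2
  rw [fc_eq ((perL2_coe f).int 0 _), fc_eq ((perL2_coe g).int 0 _)]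
  push_cast at h3 h4
  linear_combination h3 - Complex.I * h4 + (wave (2 * Real.pi) k : ℂ) *
    ((∫ y in (0 : ℝ)..2 * Real.pi, f (y : Torus) * Real.sin (wave (2 * Real.pi) k * y) : ℝ) : ℂ) *
      Complex.I_sq

lemma ae_of_periodic {L : ℝ} (hL : 0 < L) {f g : ℝ → ℝ} (hf : Function.Periodic f L)
    (hg : Function.Periodic g L) (h : f =ᵐ[volume.restrict (Ioc 0 L)] g) : f =ᵐ[volume] g := by
  rw [EventuallyEq, ae_restrict_iff' measurableSet_Ioc, ae_iff] at h
  rw [EventuallyEq, ae_iff]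
  refine measure_mono_null (t := ⋃ n : ℤ, (fun x => x + -(n * L)) ⁻¹'
    {x | ¬(x ∈ Ioc 0 L → f x = g x)}) (fun x hx => ?_) (measure_iUnion_null fun n => ?_)
  · obtain ⟨n, hn, -⟩ := existsUnique_sub_zsmul_mem_Ioc hL x 0
    rw [zero_add, zsmul_eq_mul] at hn
    refine mem_iUnion.2 ⟨n, ?_⟩
    simp only [mem_preimage, mem_ofPred_eq, Classical.not_imp, ← sub_eq_add_neg]
    refine ⟨hn, ?_⟩
    rw [hf.sub_int_mul_eq, hg.sub_int_mul_eq]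
    exact hx
  · rw [measure_preimage_add_right]
    exact h

/-- A function with a weak derivative has a representative which is a primitive. -/
lemma IsWeakDeriv.exists_isPrim {f g : L2} (h : IsWeakDeriv f g) :
    ∃ A, IsPrim A (fun y => g (y : Torus)) ∧ Function.Periodic A (2 * Real.pi) ∧
      (fun y : ℝ => f (y : Torus)) =ᵐ[volume] A := by
  obtain ⟨A, hA, hp, he⟩ := (perL2_coe f).exists_isPrim Real.two_pi_pos (perL2_coe g) h.fc
  exact ⟨A, hA, hp, ae_of_periodic Real.two_pi_pos (perL2_coe f).periodic hp he⟩

/-! ### Changes of coordinates -/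

/-- `X` is a `C¹` diffeomorphism of the line, with inverse `Y` and derivative `τ`, which descends
to a map of circles of lengths `M` and `L`. -/
structure IsCoord (M L : ℝ) (X Y τ : ℝ → ℝ) : Prop where
  pos : ∀ y, 0 < τ y
  cont : Continuous τ
  deriv : ∀ y, HasDerivAt X (τ y) y
  left : ∀ y, Y (X y) = y
  right : ∀ x, X (Y x) = x
  shift : ∀ y, X (y + M) = X y + L

lemma mul_sub_le_of_le_hasDerivAt {X τ : ℝ → ℝ} {a : ℝ} (hd : ∀ y, HasDerivAt X (τ y) y)
    (ha : ∀ y, a ≤ τ y) {y z : ℝ} (h : y ≤ z) : a * (z - y) ≤ X z - X y :=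
  mul_sub_le_image_sub_of_le_deriv (fun y => (hd y).differentiableAt)
    (fun y => by rw [(hd y).deriv]; exact ha y) h

lemma exists_isCoord {M L a : ℝ} {X τ : ℝ → ℝ} (ha : 0 < a) (hτ : ∀ y, a ≤ τ y)
    (hc : Continuous τ) (hd : ∀ y, HasDerivAt X (τ y) y) (hs : ∀ y, X (y + M) = X y + L) :
    ∃ Y, IsCoord M L X Y τ := by
  have hcX : Continuous X := continuous_iff_continuousAt.2 fun y => (hd y).continuousAt
  have hmono : StrictMono X := fun y z h => by
    have := mul_sub_le_of_le_hasDerivAt hd hτ h.le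
    nlinarith
  have hsurj : Function.Surjective X := by
    refine hcX.surjective ?_ ?_
    · have h1 : Tendsto (fun y => X 0 + a * y) atTop atTop :=
        tendsto_atTop_add_const_left _ _ (tendsto_id.const_mul_atTop ha)
      refine tendsto_atTop_mono' _ ?_ h1
      filter_upwards [eventually_ge_atTop 0] with y hy
      have := mul_sub_le_of_le_hasDerivAt hd hτ hy
      linarith
    · have h1 : Tendsto (fun y => X 0 + a * y) atBot atBot :=
        tendsto_atBot_add_const_left _ _ (tendsto_id.const_mul_atBot ha)
      refine tendsto_atBot_mono' _ ?_ h1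
      filter_upwards [eventually_le_atBot 0] with y hy
      have := mul_sub_le_of_le_hasDerivAt hd hτ hy
      linarith
  refine ⟨Function.surjInv hsurj, fun y => ha.trans_le (hτ y), hc, hd, fun y => ?_,
    Function.surjInv_eq hsurj, hs⟩
  exact hmono.injective (Function.surjInv_eq hsurj (X y))

namespace IsCoord

variable {M L : ℝ} {X Y τ : ℝ → ℝ}

lemma continuous (H : IsCoord M L X Y τ) : Continuous X :=
  continuous_iff_continuousAt.2 fun y => (H.deriv y).continuousAt

lemma strictMono (H : IsCoord M L X Y τ) : StrictMono X :=
  strictMono_of_deriv_pos fun y => by rw [(H.deriv y).deriv]; exact H.pos y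

lemma strictMono_inv (H : IsCoord M L X Y τ) : StrictMono Y := fun x z h => by
  rw [← H.strictMono.lt_iff_lt, H.right, H.right]
  exact h

lemma continuous_inv (H : IsCoord M L X Y τ) : Continuous Y :=
  H.strictMono_inv.monotone.continuous_of_surjective fun y => ⟨X y, H.left y⟩

lemma symm (H : IsCoord M L X Y τ) : IsCoord L M Y X fun x => 1 / τ (Y x) where
  pos x := one_div_pos.2 (H.pos _)
  cont := continuous_const.div (H.cont.comp H.continuous_inv) fun x => (H.pos _).ne'
  deriv x := by
    rw [one_div]
    exact (H.deriv (Y x)).of_local_left_inverse H.continuous_inv.continuousAt (H.pos _).ne'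
      (Eventually.of_forall H.right)
  left := H.right
  right := H.left
  shift x := H.strictMono.injective (by rw [H.right, H.shift, H.right])

lemma periodic (H : IsCoord M L X Y τ) {f : ℝ → ℝ} (hf : Function.Periodic f L) :
    Function.Periodic (fun y => f (X y)) M := fun y => by
  simp only [H.shift, hf (X y)]

lemma integral_comp (H : IsCoord M L X Y τ) (f : ℝ → ℝ) (a b : ℝ) :
    ∫ y in a..b, f (X y) * τ y = ∫ x in X a..X b, f x :=
  intervalIntegral.integral_comp_mul_deriv_of_deriv_nonneg H.continuous.continuousOn
    (fun y _ => H.deriv y) fun y _ => (H.pos y).le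

lemma intervalIntegrable_comp (H : IsCoord M L X Y τ) {f : ℝ → ℝ}
    (hf : ∀ a b, IntervalIntegrable f volume a b) (a b : ℝ) :
    IntervalIntegrable (fun y => f (X y) * τ y) volume a b :=
  (intervalIntegral.integrable_comp_mul_deriv_iff_of_deriv_nonneg H.continuous.continuousOn
    (fun y _ => H.deriv y) fun y _ => (H.pos y).le).2 (hf _ _)

lemma isPrim_comp (H : IsCoord M L X Y τ) {A B : ℝ → ℝ} (h : IsPrim A B) :
    IsPrim (fun y => A (X y)) fun y => B (X y) * τ y :=
  ⟨H.intervalIntegrable_comp h.1, fun a b => by rw [H.integral_comp, h.2]⟩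

lemma integral_period (H : IsCoord M L X Y τ) {f : ℝ → ℝ} (hf : Function.Periodic f L) :
    ∫ y in (0 : ℝ)..M, f (X y) * τ y = ∫ x in (0 : ℝ)..L, f x := by
  rw [H.integral_comp]
  have h1 := H.shift 0
  rw [zero_add] at h1
  rw [h1, hf.intervalIntegral_add_eq (X 0) 0, zero_add]

lemma perL2_comp (H : IsCoord M L X Y τ) {f : ℝ → ℝ} (hf : PerL2 L f) :
    PerL2 M fun y => f (X y) := by
  have hinv : Continuous fun y => 1 / τ y := continuous_const.div H.cont fun y => (H.pos y).ne'
  have key : ∀ g : ℝ → ℝ, (∀ a b, IntervalIntegrable g volume a b) → ∀ a b,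
      IntervalIntegrable (fun y => g (X y)) volume a b := by
    intro g hg a b
    have h1 := (H.intervalIntegrable_comp hg a b).mul_continuousOn hinv.continuousOn
    refine h1.congr_ae (Eventually.of_forall fun y => ?_)
    have := (H.pos y).ne'
    field_simp
  exact ⟨H.periodic hf.periodic, key f hf.int, key _ hf.sq⟩

end IsCoord

/-! ### The initial data in mass coordinates -/

lemma exists_rep_two (u : Sobolev 2) : ∃ W₀ W₁ W₂ : ℝ → ℝ, IsPrim W₀ W₁ ∧ IsPrim W₁ W₂ ∧
    Function.Periodic W₀ (2 * Real.pi) ∧ Function.Periodic W₁ (2 * Real.pi) ∧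
    PerL2 (2 * Real.pi) W₂ ∧ ofFun W₀ = der u 0 := by
  obtain ⟨W₀, h0, p0, e0⟩ := (u.2 0).exists_isPrim
  obtain ⟨W₁, h1, p1, e1⟩ := (u.2 1).exists_isPrim
  refine ⟨W₀, W₁, _, h0.congr_ae e1, h1, p0, p1, perL2_coe _, ?_⟩
  rw [← ofFun_coe (der u 0)]
  exact ofFun_congr (.of_continuous p0 h0.continuous) (perL2_coe _) (ae_restrict_of_ae e0.symm)

lemma exists_rep_three (ρ : Sobolev 3) (hρ : IsPositive (der ρ 0)) :
    ∃ (c : ℝ) (R₀ R₁ R₂ R₃ : ℝ → ℝ), 0 < c ∧ (∀ x, c ≤ R₀ x) ∧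
    IsPrim R₀ R₁ ∧ IsPrim R₁ R₂ ∧ IsPrim R₂ R₃ ∧
    Function.Periodic R₀ (2 * Real.pi) ∧ Function.Periodic R₁ (2 * Real.pi) ∧
    Function.Periodic R₂ (2 * Real.pi) ∧ PerL2 (2 * Real.pi) R₃ ∧ ofFun R₀ = der ρ 0 := by
  obtain ⟨c, hc, hcρ⟩ := hρ
  obtain ⟨R₀, h0, p0, e0⟩ := (ρ.2 0).exists_isPrim
  obtain ⟨R₁, h1, p1, e1⟩ := (ρ.2 1).exists_isPrim
  obtain ⟨R₂, h2, p2, e2⟩ := (ρ.2 2).exists_isPrim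
  refine ⟨c, R₀, R₁, R₂, _, hc, fun x => ?_, h0.congr_ae e1, h1.congr_ae e2, h2, p0, p1, p2,
    perL2_coe _, ?_⟩
  · have h3 : (fun x => max c (R₀ x)) = R₀ := by
      refine eq_of_ae_eq_of_periodic Real.two_pi_pos (continuous_const.max h0.continuous)
        h0.continuous (fun x => by simp only [p0 x]) p0 ?_
      filter_upwards [ae_coe_of_ae hcρ, ae_restrict_of_ae e0] with x hx hx'
      rw [← hx']
      exact max_eq_right hx
    rw [← congrFun h3 x]
    exact le_max_left _ _
  · rw [← ofFun_coe (der ρ 0)]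
    exact ofFun_congr (.of_continuous p0 h0.continuous) (perL2_coe _) (ae_restrict_of_ae e0.symm)

theorem exists_isLagData {c : ℝ} {R₀ R₁ R₂ R₃ W₀ W₁ W₂ : ℝ → ℝ} (hc : 0 < c) (hR : ∀ x, c ≤ R₀ x)
    (r0 : IsPrim R₀ R₁) (r1 : IsPrim R₁ R₂) (r2 : IsPrim R₂ R₃)
    (p0 : Function.Periodic R₀ (2 * Real.pi))
    (p2 : Function.Periodic R₂ (2 * Real.pi)) (p3 : PerL2 (2 * Real.pi) R₃)
    (w0 : IsPrim W₀ W₁) (w1 : IsPrim W₁ W₂) (q0 : Function.Periodic W₀ (2 * Real.pi))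
    (q1 : Function.Periodic W₁ (2 * Real.pi)) (q2 : PerL2 (2 * Real.pi) W₂) :
    ∃ (M : ℝ) (X₀ Y₀ τ₀ τ₁ F₁ F₂ F₃ U₀ U₁ U₂ : ℝ → ℝ), IsLagData M τ₀ τ₁ F₁ F₂ U₀ U₁ U₂ ∧
      IsPrim F₂ F₃ ∧ PerL2 M F₃ ∧ IsCoord M (2 * Real.pi) X₀ Y₀ τ₀ ∧
      (∀ y, R₀ (X₀ y) = 1 / τ₀ y) ∧ ∀ y, W₀ (X₀ y) = U₀ y := by
  have cR₀ := r0.continuous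
  set M : ℝ := ∫ x in (0 : ℝ)..2 * Real.pi, R₀ x with hM
  have hMpos : 0 < M := by
    have h1 : ∫ _ in (0 : ℝ)..2 * Real.pi, c ≤ M :=
      intervalIntegral.integral_mono_on Real.two_pi_pos.le intervalIntegrable_const
        (cR₀.intervalIntegrable _ _) fun x _ => hR x
    rw [intervalIntegral.integral_const, sub_zero, smul_eq_mul] at h1
    exact lt_of_lt_of_le (by positivity) h1
  obtain ⟨X₀, hX⟩ := exists_isCoord (M := 2 * Real.pi) (L := M)
    (X := fun x => ∫ z in (0 : ℝ)..x, R₀ z) hc hR cR₀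
    (fun x => (cR₀.integral_hasStrictDerivAt 0 x).hasDerivAt) fun x => by
      have h1 := intervalIntegral.integral_add_adjacent_intervals (μ := volume)
        (cR₀.intervalIntegrable 0 x) (cR₀.intervalIntegrable x (x + 2 * Real.pi))
      rw [← h1, p0.intervalIntegral_add_eq x 0, zero_add]
  have H := hX.symm
  have hpos : ∀ x, 0 < R₀ x := fun x => hc.trans_le (hR x)
  set τ₀ : ℝ → ℝ := fun y => 1 / R₀ (X₀ y) with hτ₀
  set τ₁ : ℝ → ℝ := fun y => -R₁ (X₀ y) * τ₀ y ^ 3 with hτ₁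
  have cX := H.continuous
  have dR₀ := r0.hasDerivAt r1.continuous
  have dR₁ := r1.hasDerivAt r2.continuous
  have dW₀ := w0.hasDerivAt w1.continuous
  have dτ₀ : ∀ y, HasDerivAt τ₀ (τ₁ y) y := by
    intro y
    have h1 := ((dR₀ (X₀ y)).comp y (H.deriv y)).fun_inv (hpos _).ne'
    simp only [hτ₀, one_div]
    refine h1.congr_deriv ?_
    have := (hpos (X₀ y)).ne'
    simp only [hτ₁, hτ₀, Function.comp]
    field_simp
  have cτ₁ : Continuous τ₁ := (r1.continuous.comp cX).neg.mul (H.cont.pow 3)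
  have pτ₀ : Function.Periodic τ₀ M := H.periodic (f := fun x => 1 / R₀ x) fun x => by
    simp only [p0 x]
  have pτ₁ := periodic_of_hasDerivAt pτ₀ dτ₀
  have primτ := IsPrim.of_hasDerivAt dτ₀ cτ₁
  refine ⟨M, X₀, _, τ₀, τ₁, fun y => R₁ (X₀ y), fun y => R₂ (X₀ y) * τ₀ y, _, fun y => W₀ (X₀ y),
    fun y => W₁ (X₀ y) * τ₀ y, _, ⟨hMpos, H.pos, pτ₀, H.periodic q0, dτ₀, cτ₁, fun y => ?_,
    fun y => (dR₁ (X₀ y)).comp y (H.deriv y), (r2.continuous.comp cX).mul H.cont,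
    fun y => (dW₀ (X₀ y)).comp y (H.deriv y), (w1.continuous.comp cX).mul H.cont,
    (H.isPrim_comp w1).mul primτ, ?_⟩, (H.isPrim_comp r2).mul primτ, ?_, H, fun y => ?_,
    fun y => rfl⟩
  · have h1 := (((dR₀ (X₀ y)).comp y (H.deriv y)).fun_pow 2).div_const 2
    have e : (fun z => 1 / (2 * τ₀ z ^ 2)) = fun z => (R₀ ∘ X₀) z ^ 2 / 2 := by
      ext z
      have := (hpos (X₀ z)).ne'
      simp only [hτ₀, Function.comp]
      field_simp
    rw [e]
    refine h1.congr_deriv ?_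
    have := (hpos (X₀ y)).ne'
    simp only [Function.comp, hτ₀, Nat.cast_ofNat, Nat.add_one_sub_one, pow_one]
    field_simp
  · exact (((H.perL2_comp q2).mul_continuous pτ₀ H.cont).mul_continuous pτ₀ H.cont).add hMpos
      (.of_continuous (fun y => by simp only [H.periodic q1 y, pτ₁ y])
        ((w1.continuous.comp cX).mul cτ₁))
  · exact (((H.perL2_comp p3).mul_continuous pτ₀ H.cont).mul_continuous pτ₀ H.cont).add hMpos
      (.of_continuous (fun y => by simp only [H.periodic p2 y, pτ₁ y])
        ((r2.continuous.comp cX).mul cτ₁))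
  · have := (hpos (X₀ y)).ne'
    simp only [hτ₀]
    field_simp

/-! ### Square integrable functions transported by a flow -/

lemma PerL2.integral_add_sq_le {L : ℝ} (hL : 0 < L) {f g : ℝ → ℝ} (hf : PerL2 L f)
    (hg : PerL2 L g) : ∫ y in (0 : ℝ)..L, (f y + g y) ^ 2 ≤
      2 * (∫ y in (0 : ℝ)..L, f y ^ 2) + 2 * ∫ y in (0 : ℝ)..L, g y ^ 2 := by
  rw [← intervalIntegral.integral_const_mul, ← intervalIntegral.integral_const_mul,
    ← intervalIntegral.integral_add ((hf.sq 0 L).const_mul 2) ((hg.sq 0 L).const_mul 2)]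
  refine intervalIntegral.integral_mono_on hL.le ((hf.add hL hg).sq 0 L)
    (((hf.sq 0 L).const_mul 2).add ((hg.sq 0 L).const_mul 2)) fun y _ => ?_
  nlinarith [sq_nonneg (f y - g y)]

lemma PerL2.integral_sub_sq_le {L : ℝ} (hL : 0 < L) {f g k : ℝ → ℝ} (hf : PerL2 L f)
    (hg : PerL2 L g) (hk : PerL2 L k) : ∫ y in (0 : ℝ)..L, (f y - k y) ^ 2 ≤
      2 * (∫ y in (0 : ℝ)..L, (f y - g y) ^ 2) + 2 * ∫ y in (0 : ℝ)..L, (g y - k y) ^ 2 := by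
  have := PerL2.integral_add_sq_le hL (hf.sub hL hg) (hg.sub hL hk)
  simpa only [sub_add_sub_cancel] using this

lemma PerL2.exists_continuous_approx {M : ℝ} (hM : 0 < M) {f : ℝ → ℝ} (hf : PerL2 M f) {ε : ℝ}
    (hε : 0 < ε) : ∃ c, Continuous c ∧ Function.Periodic c M ∧
      ∫ y in (0 : ℝ)..M, (f y - c y) ^ 2 ≤ ε := by
  have : Fact (0 < M) := ⟨hM⟩
  have hm := memLp_liftIoc (hf.memLp 0 M)
  have h2 : ENNReal.ofReal 2 = 2 := by norm_num
  rw [← h2] at hm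
  obtain ⟨g, hg, -⟩ := hm.exists_boundedContinuous_integral_rpow_sub_le two_pos hε
  refine ⟨fun y => g (y : AddCircle M), g.continuous.comp (AddCircle.continuous_mk' M),
    fun y => by simp, ?_⟩
  have e := AddCircle.intervalIntegral_preimage M 0
    (fun x => ‖AddCircle.liftIoc M 0 f x - g x‖ ^ (2 : ℝ))
  rw [← e, zero_add] at hg
  simpa only [liftIoc_coe_of_periodic hf.periodic, Real.rpow_two, Real.norm_eq_abs, sq_abs] using hg

namespace ContL2

variable {L : ℝ} {f g : ℝ → ℝ → ℝ}

lemma of_continuous (hf : Continuous (Function.uncurry f)) : ContL2 L f := by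
  intro t
  have h1 : Continuous fun s => ∫ y in (0 : ℝ)..L, (f s y - f t y) ^ 2 := by
    refine intervalIntegral.continuous_parametric_intervalIntegral_of_continuous' ?_ 0 L
    exact (hf.sub (hf.comp (continuous_const.prodMk continuous_snd))).pow 2
  have h2 := h1.tendsto t
  simpa using h2

lemma add (hL : 0 < L) (pf : ∀ t, PerL2 L (f t)) (pg : ∀ t, PerL2 L (g t)) (hf : ContL2 L f)
    (hg : ContL2 L g) : ContL2 L fun t y => f t y + g t y := by
  intro t
  have h1 := ((hf t).const_mul 2).add ((hg t).const_mul 2)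
  rw [mul_zero, add_zero] at h1
  refine squeeze_zero (fun s => intervalIntegral.integral_nonneg hL.le fun y _ => sq_nonneg _)
    (fun s => ?_) h1
  have := PerL2.integral_add_sq_le hL ((pf s).sub hL (pf t)) ((pg s).sub hL (pg t))
  simpa only [add_sub_add_comm] using this

lemma exists_bound {c : ℝ → ℝ → ℝ} (hL : 0 < L) (hc : Continuous (Function.uncurry c))
    (hp : ∀ t, Function.Periodic (c t) L) (t : ℝ) :
    ∃ B, 0 < B ∧ ∀ᶠ s in 𝓝 t, ∀ y, |c s y| ≤ B := by
  obtain ⟨B, hB⟩ := ((isCompact_Icc (a := t - 1) (b := t + 1)).prod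
    (isCompact_Icc (a := 0) (b := L))).exists_bound_of_continuousOn hc.continuousOn
  refine ⟨max B 1, by positivity, ?_⟩
  filter_upwards [Ioo_mem_nhds (show t - 1 < t by linarith) (show t < t + 1 by linarith)] with s hs y
  obtain ⟨z, hz, hzy⟩ := (hp s).exists_mem_Ioc hL y 0
  rw [zero_add] at hz
  rw [hzy]
  exact (hB (s, z) ⟨Ioo_subset_Icc_self hs, Ioc_subset_Icc_self hz⟩).trans (le_max_left _ _)

lemma mul_continuous (hL : 0 < L) (pf : ∀ t, PerL2 L (f t)) (hf : ContL2 L f)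
    {c : ℝ → ℝ → ℝ} (hc : Continuous (Function.uncurry c)) (hp : ∀ t, Function.Periodic (c t) L) :
    ContL2 L fun t y => f t y * c t y := by
  intro t
  obtain ⟨B, hB0, hB⟩ := exists_bound hL hc hp t
  have hcs : ∀ s, Continuous (c s) := fun s => hc.comp (Continuous.prodMk_right s)
  have h1 : Tendsto (fun s => ∫ y in (0 : ℝ)..L, (f t y * (c s y - c t y)) ^ 2) (𝓝 t) (𝓝 0) := by
    have h2 : Tendsto (fun s => ∫ y in (0 : ℝ)..L, (f t y * (c s y - c t y)) ^ 2) (𝓝 t)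
        (𝓝 (∫ _ in (0 : ℝ)..L, (0 : ℝ))) := by
      refine intervalIntegral.tendsto_integral_filter_of_dominated_convergence
        (fun y => f t y ^ 2 * (2 * B) ^ 2) ?_ ?_ (((pf t).sq 0 L).mul_const _) ?_
      · refine Eventually.of_forall fun s => ?_
        rw [uIoc_of_le hL.le]
        exact (((pf t).aestronglyMeasurable 0 L).mul
          ((hcs s).sub (hcs t)).aestronglyMeasurable).pow 2
      · filter_upwards [hB] with s hs
        refine Eventually.of_forall fun y _ => ?_
        rw [Real.norm_eq_abs, abs_of_nonneg (sq_nonneg _), mul_pow, ← sq_abs (c s y - c t y)]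
        have h3 : |c s y - c t y| ≤ 2 * B := by
          have := (abs_sub (c s y) (c t y)).trans (add_le_add (hs y) (hB.self_of_nhds y))
          linarith
        gcongr
      · refine Eventually.of_forall fun y _ => ?_
        have h4 : Continuous fun s => (f t y * (c s y - c t y)) ^ 2 :=
          (continuous_const.mul ((hc.comp (Continuous.prodMk_left y)).sub continuous_const)).pow 2
        have h5 := h4.tendsto t
        simpa using h5
    simpa using h2
  have h6 := ((hf t).const_mul (2 * B ^ 2)).add (h1.const_mul 2)
  rw [mul_zero, mul_zero, add_zero] at h6
  refine squeeze_zero' (Eventually.of_forall fun s =>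
    intervalIntegral.integral_nonneg hL.le fun y _ => sq_nonneg _) ?_ h6
  filter_upwards [hB] with s hs
  have p1 := (((pf s).sub hL (pf t)).mul_continuous (hp s) (hcs s))
  have p2 : PerL2 L fun y => f t y * (c s y - c t y) :=
    (pf t).mul_continuous (fun y => by simp only [hp s y, hp t y]) ((hcs s).sub (hcs t))
  have h7 := PerL2.integral_add_sq_le hL p1 p2
  have e : ∀ y, (f s y - f t y) * c s y + f t y * (c s y - c t y) = f s y * c s y - f t y * c t y :=
    fun y => by ring
  simp only [e] at h7
  have h8 : ∫ y in (0 : ℝ)..L, ((f s y - f t y) * c s y) ^ 2 ≤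
      B ^ 2 * ∫ y in (0 : ℝ)..L, (f s y - f t y) ^ 2 := by
    rw [← intervalIntegral.integral_const_mul]
    refine intervalIntegral.integral_mono_on hL.le (p1.sq 0 L)
      ((((pf s).sub hL (pf t)).sq 0 L).const_mul _) fun y _ => ?_
    rw [mul_pow, mul_comm (B ^ 2), ← sq_abs (c s y)]
    have := hs y
    gcongr
  linarith

end ContL2

/-- A continuous family of changes of coordinates. -/
structure IsFlow (M L : ℝ) (X Y τ : ℝ → ℝ → ℝ) : Prop where
  pos_left : 0 < M
  pos_right : 0 < L
  coord : ∀ t, IsCoord M L (X t) (Y t) (τ t)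
  cX : Continuous (Function.uncurry X)
  cY : Continuous (Function.uncurry Y)
  cτ : Continuous (Function.uncurry τ)

lemma IsCoord.integral_sq_le {M L b : ℝ} {X Y τ : ℝ → ℝ} (hM : 0 < M) (H : IsCoord M L X Y τ)
    (hτ : Function.Periodic τ M) (hb : ∀ y, τ y ≤ b) {f : ℝ → ℝ} (hf : PerL2 M f) :
    ∫ x in (0 : ℝ)..L, f (Y x) ^ 2 ≤ b * ∫ y in (0 : ℝ)..M, f y ^ 2 := by
  have hp : Function.Periodic (fun y => f y ^ 2 * τ y) M := fun y => by
    simp only [hf.periodic y, hτ y]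
  have h1 := H.symm.integral_period hp
  have e : ∀ x, f (Y x) ^ 2 * τ (Y x) * (1 / τ (Y x)) = f (Y x) ^ 2 := fun x => by
    have := (H.pos (Y x)).ne'
    field_simp
  simp only [e] at h1
  rw [h1, ← intervalIntegral.integral_const_mul]
  refine intervalIntegral.integral_mono_on hM.le
    ((hf.sq 0 M).mul_continuousOn H.cont.continuousOn) ((hf.sq 0 M).const_mul b) fun y _ => ?_
  rw [mul_comm b]
  have := hb y
  gcongr

lemma IsCoord.periodic_deriv {M L : ℝ} {X Y τ : ℝ → ℝ} (H : IsCoord M L X Y τ) :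
    Function.Periodic τ M := by
  intro y
  have h1 : HasDerivAt (fun z => X (z + M)) (τ (y + M)) y := (H.deriv (y + M)).comp_add_const y M
  have h2 : (fun z => X (z + M)) = fun z => X z + L := funext H.shift
  rw [h2] at h1
  exact h1.unique ((H.deriv y).add_const L)

namespace IsFlow

variable {M L : ℝ} {X Y τ : ℝ → ℝ → ℝ}

lemma continuous_comp (H : IsFlow M L X Y τ) {f : ℝ → ℝ → ℝ}
    (hf : Continuous (Function.uncurry f)) :
    Continuous (Function.uncurry fun t x => f t (Y t x)) :=
  hf.comp (continuous_fst.prodMk H.cY)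

lemma contL2_comp (H : IsFlow M L X Y τ) {f : ℝ → ℝ → ℝ} (pf : ∀ t, PerL2 M (f t))
    (hf : ContL2 M f) : ContL2 L fun t x => f t (Y t x) := by
  have hM := H.pos_left
  have hL := H.pos_right
  intro t
  obtain ⟨b, hb0, hb⟩ := ContL2.exists_bound hM H.cτ (fun t => (H.coord t).periodic_deriv) t
  have hb' : ∀ᶠ s in 𝓝 t, ∀ y, τ s y ≤ b := hb.mono fun s hs y => (le_abs_self _).trans (hs y)
  have pY : ∀ s {k : ℝ → ℝ}, PerL2 M k → PerL2 L fun x => k (Y s x) := fun s _ hk =>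
    (H.coord s).symm.perL2_comp hk
  rw [tendsto_order]
  refine ⟨fun δ hδ => Eventually.of_forall fun s => hδ.trans_le
    (intervalIntegral.integral_nonneg hL.le fun y _ => sq_nonneg _), fun δ hδ => ?_⟩
  obtain ⟨c, cc, pc, hc⟩ := (pf t).exists_continuous_approx hM (ε := δ / (32 * b)) (by positivity)
  have hcc : ContL2 L fun s x => c (Y s x) := .of_continuous (cc.comp H.cY)
  have pcL : PerL2 M c := .of_continuous pc cc
  filter_upwards [hb', (hf t).eventually_lt_const (u := δ / (16 * b)) (by positivity),
    (hcc t).eventually_lt_const (u := δ / 32) (by positivity)] with s hs h1 h2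
  have e1 : ∫ x in (0 : ℝ)..L, (f s (Y s x) - f t (Y s x)) ^ 2 ≤ δ / 16 :=
    ((H.coord s).integral_sq_le hM (H.coord s).periodic_deriv hs ((pf s).sub hM (pf t))).trans
      ((mul_le_mul_of_nonneg_left h1.le hb0.le).trans_eq (by field_simp))
  have e2 : ∀ r, (∀ y, τ r y ≤ b) →
      ∫ x in (0 : ℝ)..L, (f t (Y r x) - c (Y r x)) ^ 2 ≤ δ / 32 := fun r hr =>
    ((H.coord r).integral_sq_le hM (H.coord r).periodic_deriv hr ((pf t).sub hM pcL)).trans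
      ((mul_le_mul_of_nonneg_left hc hb0.le).trans_eq (by field_simp))
  have e3 := e2 s hs
  have e4 := e2 t hb'.self_of_nhds
  have e5 : ∫ x in (0 : ℝ)..L, (c (Y t x) - f t (Y t x)) ^ 2 ≤ δ / 32 := by
    simpa only [← neg_sub (f t _) (c _), neg_sq] using e4
  have s1 := PerL2.integral_sub_sq_le hL (pY s (pf s)) (pY s (pf t)) (pY t (pf t))
  have s2 := PerL2.integral_sub_sq_le hL (pY s (pf t)) (pY s pcL) (pY t (pf t))
  have s3 := PerL2.integral_sub_sq_le hL (pY s pcL) (pY t pcL) (pY t (pf t))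
  linarith

end IsFlow

lemma continuous_ofFun {f : ℝ → ℝ → ℝ} (pf : ∀ t, PerL2 (2 * Real.pi) (f t))
    (hf : ContL2 (2 * Real.pi) f) : Continuous fun t => ofFun (f t) := by
  rw [continuous_iff_continuousAt]
  intro t
  rw [ContinuousAt, tendsto_iff_norm_sub_tendsto_zero]
  have h1 := (hf t).sqrt
  rw [Real.sqrt_zero] at h1
  refine h1.congr fun s => ?_
  rw [← norm_sq_ofFun_sub (pf s) (pf t), Real.sqrt_sq (norm_nonneg _)]

/-! ### The flow of a Lagrangian solution -/

lemma integral_swap {f : ℝ → ℝ → ℝ} (hf : Continuous (Function.uncurry f)) (a b c d : ℝ) :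
    ∫ x in a..b, ∫ y in c..d, f x y = ∫ y in c..d, ∫ x in a..b, f x y := by
  refine intervalIntegral_intervalIntegral_swap ?_
  exact (hf.continuousOn.integrableOn_compact ((isCompact_uIcc).prod isCompact_uIcc)).mono_set
    (prod_mono uIoc_subset_uIcc uIoc_subset_uIcc)

/-- The position at time `t` of the particle with label `y`, which starts from `X₀ y` and moves
with velocity `u`. -/
def flowMap (X₀ : ℝ → ℝ) (u : ℝ → ℝ → ℝ) (t y : ℝ) : ℝ := X₀ y + ∫ s in (0 : ℝ)..max t 0, u s y

lemma flowMap_zero (X₀ : ℝ → ℝ) (u : ℝ → ℝ → ℝ) : flowMap X₀ u 0 = X₀ := by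
  ext y
  simp [flowMap]

lemma continuous_flowMap {X₀ : ℝ → ℝ} {u : ℝ → ℝ → ℝ} (hX : Continuous X₀)
    (hu : Continuous (Function.uncurry u)) : Continuous (Function.uncurry (flowMap X₀ u)) := by
  refine (hX.comp continuous_snd).add ?_
  have h : Continuous (Function.uncurry fun (p : ℝ × ℝ) (s : ℝ) => u s p.2) :=
    hu.comp (continuous_snd.prodMk (continuous_snd.comp continuous_fst))
  exact intervalIntegral.continuous_parametric_intervalIntegral_of_continuous h
    (continuous_fst.max continuous_const)

lemma hasDerivAt_flowMap_time {X₀ : ℝ → ℝ} {u : ℝ → ℝ → ℝ} (hu : Continuous (Function.uncurry u))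
    {t : ℝ} (ht : 0 < t) (y : ℝ) : HasDerivAt (fun s => flowMap X₀ u s y) (u t y) t := by
  have h1 : Continuous fun s => u s y := hu.comp (Continuous.prodMk_left y)
  have h2 := (h1.integral_hasStrictDerivAt 0 t).hasDerivAt.const_add (X₀ y)
  refine h2.congr_of_eventuallyEq ?_
  filter_upwards [lt_mem_nhds ht] with s hs
  rw [flowMap, max_eq_left hs.le]

namespace IsLagSol

variable {M a L : ℝ} {τ₀ F₁ U₀ X₀ Y₀ : ℝ → ℝ} {τ u σ : ℝ → ℝ → ℝ}

lemma pos (H : IsLagSol M a τ₀ F₁ U₀ τ u σ) (t y : ℝ) : 0 < τ t y := H.low_pos.trans_le (H.low t y)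

lemma continuous_strain (H : IsLagSol M a τ₀ F₁ U₀ τ u σ) :
    Continuous (Function.uncurry fun t y => τ t y ^ 3 * σ t y) := (H.cτ.pow 3).mul H.cσ

lemma hasDerivAt_flowMap (H : IsLagSol M a τ₀ F₁ U₀ τ u σ) (hX : IsCoord M L X₀ Y₀ τ₀) (t y : ℝ) :
    HasDerivAt (flowMap X₀ u t) (τ t y) y := by
  have cτt : Continuous (τ t) := H.cτ.comp (Continuous.prodMk_right t)
  have cw := H.continuous_strain
  have hus : ∀ z, Continuous fun s => u s z := fun z => H.cu.comp (Continuous.prodMk_left z)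
  have key : ∀ z, flowMap X₀ u t z = flowMap X₀ u t 0 + ∫ x in (0 : ℝ)..z, τ t x := by
    intro z
    have e1 : ∫ x in (0 : ℝ)..z, τ₀ x = X₀ z - X₀ 0 :=
      intervalIntegral.integral_eq_sub_of_hasDerivAt (fun x _ => hX.deriv x)
        (hX.cont.intervalIntegrable _ _)
    have e2 : ∀ s, ∫ x in (0 : ℝ)..z, τ s x ^ 3 * σ s x = u s z - u s 0 := fun s =>
      intervalIntegral.integral_eq_sub_of_hasDerivAt (fun x _ => H.derivu s x)
        ((cw.comp (Continuous.prodMk_right s)).intervalIntegrable _ _)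
    have e3 := integral_swap cw 0 (max t 0) 0 z
    simp only [e2, ← H.evolτ (max t 0) (le_max_right _ _), H.maxτ] at e3
    rw [intervalIntegral.integral_sub ((hus z).intervalIntegrable _ _)
      ((hus 0).intervalIntegrable _ _), intervalIntegral.integral_sub
      (cτt.intervalIntegrable _ _) (hX.cont.intervalIntegrable _ _), e1] at e3
    simp only [flowMap]
    linarith
  rw [show flowMap X₀ u t = _ from funext key]
  exact (cτt.integral_hasStrictDerivAt 0 y).hasDerivAt.const_add _

theorem exists_isFlow (H : IsLagSol M a τ₀ F₁ U₀ τ u σ) (hM : 0 < M) (hL : 0 < L)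
    (hX : IsCoord M L X₀ Y₀ τ₀) : ∃ Y, IsFlow M L (flowMap X₀ u) Y τ := by
  have cX := continuous_flowMap hX.continuous H.cu
  have h1 : ∀ t, ∃ Y, IsCoord M L (flowMap X₀ u t) Y (τ t) := fun t =>
    exists_isCoord H.low_pos (H.low t) (H.cτ.comp (Continuous.prodMk_right t))
      (H.hasDerivAt_flowMap hX t) fun y => by
        simp only [flowMap, hX.shift, H.peru _ y]
        ring
  choose Y hY using h1
  refine ⟨Y, hM, hL, hY, cX, ?_, H.cτ⟩
  rw [continuous_iff_continuousAt]
  rintro ⟨s, x⟩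
  rw [ContinuousAt, tendsto_iff_norm_sub_tendsto_zero]
  have h2 : Continuous fun p : ℝ × ℝ => |p.2 - flowMap X₀ u p.1 (Y s x)| / a :=
    ((continuous_snd.sub (cX.comp (continuous_fst.prodMk continuous_const))).abs).div_const a
  have h3 := h2.tendsto (s, x)
  simp only [(hY s).right, sub_self, abs_zero, zero_div] at h3
  refine squeeze_zero (fun _ => norm_nonneg _) (fun p => ?_) h3
  have ha := H.low_pos
  rw [le_div_iff₀ ha, Real.norm_eq_abs]
  obtain ⟨t, x'⟩ := p
  simp only [Function.uncurry]
  have hd := H.hasDerivAt_flowMap hX t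
  rcases le_total (Y s x) (Y t x') with h | h
  · have h4 := mul_sub_le_of_le_hasDerivAt hd (H.low t) h
    rw [(hY t).right] at h4
    rw [abs_of_nonneg (sub_nonneg.2 h)]
    exact le_trans (by linarith) (le_abs_self _)
  · have h4 := mul_sub_le_of_le_hasDerivAt hd (H.low t) h
    rw [(hY t).right] at h4
    rw [abs_of_nonpos (sub_nonpos.2 h)]
    exact le_trans (by linarith) (neg_le_abs _)

end IsLagSol

/-! ### Time dependent fields with one space derivative -/

/-- `A` is a continuous field, periodic in space, whose space derivative `B` is square integrable
and depends continuously on time. -/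
structure IsField (L : ℝ) (A B : ℝ → ℝ → ℝ) : Prop where
  prim : ∀ t, IsPrim (A t) (B t)
  cont : Continuous (Function.uncurry A)
  per : ∀ t, Function.Periodic (A t) L
  perL2 : ∀ t, PerL2 L (B t)
  contL2 : ContL2 L B

namespace IsField

variable {L : ℝ} {A A' B B' C D : ℝ → ℝ → ℝ}

lemma congr_deriv (h : IsField L A B) (e : ∀ t y, B t y = B' t y) : IsField L A B' := by
  rwa [← (funext fun t => funext fun y => e t y : B = B')]

lemma slice (h : IsField L A B) (t : ℝ) : Continuous (A t) := (h.prim t).continuous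

lemma slice_perL2 (h : IsField L A B) (t : ℝ) : PerL2 L (A t) := .of_continuous (h.per t) (h.slice t)

lemma of_continuous (hp : ∀ t, Function.Periodic (A t) L) (hA : Continuous (Function.uncurry A))
    (hd : ∀ t y, HasDerivAt (A t) (B t y) y) (hB : Continuous (Function.uncurry B)) :
    IsField L A B where
  prim t := .of_hasDerivAt (hd t) (hB.comp (Continuous.prodMk_right t))
  cont := hA
  per := hp
  perL2 t := .of_continuous (periodic_of_hasDerivAt (hp t) (hd t))
    (hB.comp (Continuous.prodMk_right t))
  contL2 := .of_continuous hB

lemma of_stationary {A B : ℝ → ℝ} (hp : Function.Periodic A L) (h : IsPrim A B) (hB : PerL2 L B) :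
    IsField L (fun _ => A) fun _ => B where
  prim _ := h
  cont := h.continuous.comp continuous_snd
  per _ := hp
  perL2 _ := hB
  contL2 t := by simp

lemma mul (hL : 0 < L) (h : IsField L A B) (h' : IsField L A' B') :
    IsField L (fun t y => A t y * A' t y) fun t y => B t y * A' t y + A t y * B' t y where
  prim t := (h.prim t).mul (h'.prim t)
  cont := h.cont.mul h'.cont
  per t y := by simp only [h.per t y, h'.per t y]
  perL2 t := by
    have h1 := (h.perL2 t).mul_continuous (h'.per t) (h'.slice t)
    have h2 := (h'.perL2 t).mul_continuous (h.per t) (h.slice t)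
    simpa only [mul_comm (B' t _)] using h1.add hL h2
  contL2 := by
    have h1 := h.contL2.mul_continuous hL h.perL2 h'.cont h'.per
    have h2 := h'.contL2.mul_continuous hL h'.perL2 h.cont h.per
    have h3 := h1.add hL (fun t => (h.perL2 t).mul_continuous (h'.per t) (h'.slice t))
      (fun t => (h'.perL2 t).mul_continuous (h.per t) (h.slice t)) h2
    simpa only [mul_comm (B' _ _)] using h3

lemma add (hL : 0 < L) (h : IsField L A B) (h' : IsField L A' B') :
    IsField L (fun t y => A t y + A' t y) fun t y => B t y + B' t y where
  prim t := (h.prim t).add (h'.prim t)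
  cont := h.cont.add h'.cont
  per t y := by simp only [h.per t y, h'.per t y]
  perL2 t := (h.perL2 t).add hL (h'.perL2 t)
  contL2 := h.contL2.add hL h.perL2 h'.perL2 h'.contL2

lemma neg (hL : 0 < L) (h : IsField L A B) : IsField L (fun t y => -A t y) fun t y => -B t y := by
  have h1 : IsField L (fun _ _ => (-1 : ℝ)) fun _ _ => 0 :=
    of_continuous (fun _ _ => rfl) continuous_const (fun _ _ => hasDerivAt_const _ _)
      continuous_const
  simpa using h1.mul hL h

lemma sub (hL : 0 < L) (h : IsField L A B) (h' : IsField L A' B') :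
    IsField L (fun t y => A t y - A' t y) fun t y => B t y - B' t y := by
  simpa only [sub_eq_add_neg] using h.add hL (h'.neg hL)

lemma comp_flow {M : ℝ} {X Y τ : ℝ → ℝ → ℝ} (H : IsFlow M L X Y τ) (h : IsField M A B) :
    IsField L (fun t x => A t (Y t x)) fun t x => B t (Y t x) * (1 / τ t (Y t x)) where
  prim t := (H.coord t).symm.isPrim_comp (h.prim t)
  cont := H.continuous_comp h.cont
  per t := (H.coord t).symm.periodic (h.per t)
  perL2 t := ((H.coord t).symm.perL2_comp (h.perL2 t)).mul_continuous
    (H.coord t).symm.periodic_deriv (H.coord t).symm.cont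
  contL2 := by
    refine (H.contL2_comp h.perL2 h.contL2).mul_continuous H.pos_right
      (fun t => (H.coord t).symm.perL2_comp (h.perL2 t)) ?_
      fun t => (H.coord t).symm.periodic_deriv
    exact continuous_const.div (H.continuous_comp H.cτ) fun p => ((H.coord p.1).pos _).ne'

lemma isWeakDeriv (h : IsField (2 * Real.pi) A B) (t : ℝ) :
    IsWeakDeriv (ofFun (A t)) (ofFun (B t)) :=
  (h.prim t).isWeakDeriv (h.per t) (h.perL2 t)

lemma continuous_ofFun (h : IsField (2 * Real.pi) A B) : Continuous fun t => ofFun (A t) :=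
  PressurelessNS.continuous_ofFun h.slice_perL2 (.of_continuous h.cont)

lemma continuous_ofFun_deriv (h : IsField (2 * Real.pi) A B) : Continuous fun t => ofFun (B t) :=
  PressurelessNS.continuous_ofFun h.perL2 h.contL2

lemma exists_sobolev_two (h₀ : IsField (2 * Real.pi) A B) (h₁ : IsField (2 * Real.pi) B C) :
    ∃ f : ℝ → Sobolev 2, Continuous f ∧ (∀ t, der (f t) 0 = ofFun (A t)) ∧
      ∀ t, der (f t) 1 = ofFun (B t) := by
  refine ⟨fun t => ⟨WithLp.toLp 2 ![ofFun (A t), ofFun (B t), ofFun (C t)], fun i => ?_⟩, ?_,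
    fun t => rfl, fun t => rfl⟩
  · fin_cases i
    · exact h₀.isWeakDeriv t
    · exact h₁.isWeakDeriv t
  · refine ((PiLp.continuous_toLp 2 _).comp (continuous_pi fun i => ?_)).subtype_mk _
    fin_cases i
    · exact h₀.continuous_ofFun
    · exact h₁.continuous_ofFun
    · exact h₁.continuous_ofFun_deriv

lemma exists_sobolev_three (h₀ : IsField (2 * Real.pi) A B) (h₁ : IsField (2 * Real.pi) B C)
    (h₂ : IsField (2 * Real.pi) C D) :
    ∃ f : ℝ → Sobolev 3, Continuous f ∧ ∀ t, der (f t) 0 = ofFun (A t) := by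
  refine ⟨fun t => ⟨WithLp.toLp 2 ![ofFun (A t), ofFun (B t), ofFun (C t), ofFun (D t)],
    fun i => ?_⟩, ?_, fun t => rfl⟩
  · fin_cases i
    · exact h₀.isWeakDeriv t
    · exact h₁.isWeakDeriv t
    · exact h₂.isWeakDeriv t
  · refine ((PiLp.continuous_toLp 2 _).comp (continuous_pi fun i => ?_)).subtype_mk _
    fin_cases i
    · exact h₀.continuous_ofFun
    · exact h₁.continuous_ofFun
    · exact h₂.continuous_ofFun
    · exact h₂.continuous_ofFun_deriv

end IsField

lemma liftIoc_apply_of_periodic {f : ℝ → ℝ} (hf : Function.Periodic f (2 * Real.pi)) (x : Torus) :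
    ∃ y : ℝ, (y : Torus) = x ∧ AddCircle.liftIoc (2 * Real.pi) 0 f x = f y := by
  obtain ⟨y, rfl⟩ := QuotientAddGroup.mk_surjective x
  exact ⟨y, rfl, liftIoc_coe_of_periodic hf y⟩

lemma isPositive_ofFun {f : ℝ → ℝ} (hf : PerL2 (2 * Real.pi) f) {c : ℝ} (hc : 0 < c)
    (h : ∀ x, c ≤ f x) : IsPositive (ofFun f) := by
  refine ⟨c, hc, ?_⟩
  filter_upwards [ofFun_ae hf] with x hx
  obtain ⟨y, -, hy⟩ := liftIoc_apply_of_periodic hf.periodic x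
  rw [hx, hy]
  exact h y

/-- Pointwise operations on periodic functions correspond to those on the torus. -/
lemma ofFun_comp₂ {f g h : ℝ → ℝ} (hf : PerL2 (2 * Real.pi) f) (hg : PerL2 (2 * Real.pi) g)
    (hh : PerL2 (2 * Real.pi) h) {F : ℝ → ℝ → ℝ} (e : ∀ x, h x = F (f x) (g x)) :
    ofFun h =ᵐ[volume] fun x => F (ofFun f x) (ofFun g x) := by
  filter_upwards [ofFun_ae hf, ofFun_ae hg, ofFun_ae hh] with x h1 h2 h3
  obtain ⟨y, rfl⟩ := QuotientAddGroup.mk_surjective x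
  rw [h1, h2, h3]
  exact (liftIoc_coe_of_periodic hh.periodic y).trans ((e y).trans
    (congrArg₂ F (liftIoc_coe_of_periodic hf.periodic y).symm
      (liftIoc_coe_of_periodic hg.periodic y).symm))

/-! ### The fields of a Lagrangian solution -/

namespace IsLagSol

variable {M a : ℝ} {τ₀ τ₁ F₁ F₂ F₃ U₀ U₁ U₂ : ℝ → ℝ} {τ u σ g : ℝ → ℝ → ℝ}

lemma field_velocity (H : IsLagSol M a τ₀ F₁ U₀ τ u σ) :
    IsField M u fun t y => τ t y ^ 3 * σ t y :=
  .of_continuous H.peru H.cu H.derivu H.continuous_strain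

lemma field_strain (H : IsLagSol M a τ₀ F₁ U₀ τ u σ) (pg : ∀ t, PerL2 M (g t))
    (hg : ∀ t, IsPrim (fun y => τ t y ^ 3 * σ t y) (g t)) (cg : ContL2 M g) :
    IsField M (fun t y => τ t y ^ 3 * σ t y) g :=
  ⟨hg, H.continuous_strain, fun t y => by simp only [H.perτ t y, H.perσ t y], pg, cg⟩

lemma field_density (H : IsLagSol M a τ₀ F₁ U₀ τ u σ) (hF₁ : Continuous F₁) :
    IsField M (fun t y => 1 / τ t y) fun t y => τ t y * (U₀ y + F₁ y - u t y) := by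
  have cU₀ : Continuous U₀ := by
    rw [← H.initu]
    exact H.cu.comp (Continuous.prodMk_right 0)
  refine .of_continuous (fun t y => by simp only [H.perτ t y])
    (continuous_const.div H.cτ fun p => (H.pos p.1 p.2).ne') (fun t y => ?_)
    (H.cτ.mul (((cU₀.comp continuous_snd).add (hF₁.comp continuous_snd)).sub H.cu))
  have h0 := H.pos t y
  have h1 := ((H.derivF t y).const_mul 2).sqrt (by positivity)
  have e : (fun z => √(2 * (1 / (2 * τ t z ^ 2)))) = fun z => 1 / τ t z := by
    ext z
    have hz := H.pos t z
    rw [show 2 * (1 / (2 * τ t z ^ 2)) = (1 / τ t z) ^ 2 by field_simp,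
      Real.sqrt_sq (by positivity)]
  rw [e] at h1
  refine h1.congr_deriv ?_
  rw [congrFun e y]
  field_simp

end IsLagSol

namespace IsLagData

variable {M : ℝ} {τ₀ τ₁ F₁ F₂ F₃ U₀ U₁ U₂ : ℝ → ℝ}

lemma periodic_F₁ (D : IsLagData M τ₀ τ₁ F₁ F₂ U₀ U₁ U₂) : Function.Periodic F₁ M :=
  periodic_of_hasDerivAt (f := fun y => 1 / (2 * τ₀ y ^ 2))
    (fun y => by simp only [D.periodic_τ y]) D.dF

lemma continuous_F₁ (D : IsLagData M τ₀ τ₁ F₁ F₂ U₀ U₁ U₂) : Continuous F₁ :=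
  continuous_iff_continuousAt.2 fun y => (D.dF₁ y).continuousAt

lemma field_effective (D : IsLagData M τ₀ τ₁ F₁ F₂ U₀ U₁ U₂) :
    IsField M (fun _ y => U₀ y + F₁ y) fun _ y => U₁ y + F₂ y :=
  .add D.mass_pos
    (.of_stationary D.periodic_U (.of_hasDerivAt D.dU D.cU)
      (.of_continuous (periodic_of_hasDerivAt D.periodic_U D.dU) D.cU))
    (.of_stationary D.periodic_F₁ (.of_hasDerivAt D.dF₁ D.cF₂)
      (.of_continuous (periodic_of_hasDerivAt D.periodic_F₁ D.dF₁) D.cF₂))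

lemma field_effective_deriv (D : IsLagData M τ₀ τ₁ F₁ F₂ U₀ U₁ U₂) (hF : IsPrim F₂ F₃)
    (pF : PerL2 M F₃) : IsField M (fun _ y => U₁ y + F₂ y) fun _ y => U₂ y + F₃ y :=
  .add D.mass_pos (.of_stationary (periodic_of_hasDerivAt D.periodic_U D.dU) D.dU₁ D.sqU)
    (.of_stationary (periodic_of_hasDerivAt D.periodic_F₁ D.dF₁) hF pF)

end IsLagData

/-! ### Differentiation in time -/

/-- The weak form of an evolution equation in `L²` with continuous right-hand side implies the
strong form. -/
lemma hasDerivWithinAt_of_forall_test {m R : ℝ → L2} (hR : Continuous R)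
    (h : ∀ t, 0 ≤ t → ∀ φ φ' : Torus → ℝ, IsTestPair φ φ' →
      (∫ x, m t x * φ x) - ∫ x, m 0 x * φ x = ∫ s in (0 : ℝ)..t, ∫ x, R s x * φ x)
    {t : ℝ} (ht : 0 ≤ t) : HasDerivWithinAt m (R t) (Ici 0) t := by
  have key : ∀ t, 0 ≤ t → m t = m 0 + ∫ s in (0 : ℝ)..t, R s := by
    intro t ht
    rw [← sub_eq_zero]
    refine eq_zero_of_forall_test fun φ φ' hφ => ?_
    have hm : MemLp φ 2 (volume : Measure Torus) := hφ.continuous.1.memLp_of_hasCompactSupport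
      (HasCompactSupport.of_compactSpace φ)
    have e : ∀ f : L2, ∫ x, f x * φ x = innerSL ℝ (hm.toLp φ) f := by
      intro f
      rw [innerSL_apply_apply, L2.inner_def]
      refine integral_congr_ae ?_
      filter_upwards [hm.coeFn_toLp] with x hx
      rw [hx]
      simp
    have h1 := h t ht φ φ' hφ
    simp only [e] at h1 ⊢
    rw [ContinuousLinearMap.intervalIntegral_comp_comm _ (hR.intervalIntegrable _ _)] at h1
    rw [map_sub, map_add, ← h1]
    ring
  have h2 := ((hR.integral_hasStrictDerivAt 0 t).hasDerivAt.const_add (m 0)).hasDerivWithinAt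
    (s := Ici 0)
  exact h2.congr (fun s hs => key s hs) (key t ht)

lemma IsCoord.integral_ofFun_mul {M : ℝ} {X Y τ : ℝ → ℝ} (H : IsCoord M (2 * Real.pi) X Y τ)
    {f : ℝ → ℝ} (hf : PerL2 M f) (φ : Torus → ℝ) :
    ∫ x, ofFun (fun x => f (Y x)) x * φ x = ∫ y in (0 : ℝ)..M, f y * φ (X y : Torus) * τ y := by
  have h1 := H.symm.perL2_comp hf
  rw [PressurelessNS.integral_ofFun_mul h1]
  have hp : Function.Periodic (fun x => f (Y x) * φ (x : Torus)) (2 * Real.pi) := fun x => by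
    have e : ((x + 2 * Real.pi : ℝ) : Torus) = x := AddCircle.coe_add_period _ x
    simp only [h1.periodic x, e]
  rw [← H.integral_period hp]
  simp only [H.left]

lemma integral_sub_eq_integral_deriv {M : ℝ} {G G' : ℝ → ℝ → ℝ}
    (hG : Continuous (Function.uncurry G)) (hG' : Continuous (Function.uncurry G'))
    (hd : ∀ t, 0 < t → ∀ y, HasDerivAt (fun s => G s y) (G' t y) t) {t : ℝ} (ht : 0 ≤ t) :
    (∫ y in (0 : ℝ)..M, G t y) - ∫ y in (0 : ℝ)..M, G 0 y =
      ∫ s in (0 : ℝ)..t, ∫ y in (0 : ℝ)..M, G' s y := by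
  have cs : ∀ s, Continuous (G s) := fun s => hG.comp (Continuous.prodMk_right s)
  rw [integral_swap hG', ← intervalIntegral.integral_sub ((cs t).intervalIntegrable _ _)
    ((cs 0).intervalIntegrable _ _)]
  refine intervalIntegral.integral_congr fun y _ => ?_
  have c1 : Continuous fun s => G s y := hG.comp (Continuous.prodMk_left y)
  have c2 : Continuous fun s => G' s y := hG'.comp (Continuous.prodMk_left y)
  exact (intervalIntegral.integral_eq_sub_of_hasDerivAt_of_le ht c1.continuousOn
    (fun s hs => hd s hs.1 y) (c2.intervalIntegrable _ _)).symm

lemma integral_mul_deriv_eq_neg_of_periodic {M : ℝ} {A A' B B' : ℝ → ℝ}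
    (dA : ∀ y, HasDerivAt A (A' y) y) (cA : Continuous A') (pA : Function.Periodic A M)
    (dB : ∀ y, HasDerivAt B (B' y) y) (cB : Continuous B') (pB : Function.Periodic B M) :
    ∫ y in (0 : ℝ)..M, A y * B' y = -∫ y in (0 : ℝ)..M, A' y * B y := by
  have h1 := intervalIntegral.integral_mul_deriv_eq_deriv_mul (a := 0) (b := M)
    (fun y _ => dA y) (fun y _ => dB y) (cA.intervalIntegrable _ _) (cB.intervalIntegrable _ _)
  have hA := pA 0
  have hB := pB 0
  rw [zero_add] at hA hB
  rw [h1, hA, hB, sub_self, zero_sub]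

lemma IsTestPair.exists_deriv {φ φ' : Torus → ℝ} (h : IsTestPair φ φ') :
    ∃ f : ℝ → ℝ, Continuous f ∧ ∀ x : ℝ, HasDerivAt (fun y : ℝ => φ' (y : Torus)) (f x) x := by
  have e : (fun x : ℝ => φ' (x : Torus)) = deriv (fun y : ℝ => φ (y : Torus)) :=
    funext fun x => (h.2 x).deriv.symm
  have h1 : ContDiff ℝ ∞ (fun x : ℝ => φ' (x : Torus)) := by
    rw [e]
    exact (contDiff_infty_iff_deriv.1 h.1).2
  exact ⟨_, h1.continuous_deriv (by simp), fun x =>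
    (h1.differentiable (by simp) x).hasDerivAt⟩

namespace IsLagSol

variable {M a : ℝ} {τ₀ F₁ U₀ X₀ : ℝ → ℝ} {τ u σ Y : ℝ → ℝ → ℝ} {f f' f'' : ℝ → ℝ}

lemma hasDerivAt_time (H : IsLagSol M a τ₀ F₁ U₀ τ u σ) {t : ℝ} (ht : 0 < t) (y : ℝ) :
    HasDerivAt (fun s => τ s y) (τ t y ^ 3 * σ t y) t := by
  have h1 : Continuous fun s => τ s y ^ 3 * σ s y :=
    H.continuous_strain.comp (Continuous.prodMk_left y)
  refine ((h1.integral_hasStrictDerivAt 0 t).hasDerivAt.const_add (τ₀ y)).congr_of_eventuallyEq ?_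
  filter_upwards [lt_mem_nhds ht] with s hs
  rw [← H.evolτ s hs.le]
  ring

/-- The time integral of the stress is a potential for the change of velocity. -/
lemma hasDerivAt_integral_stress (H : IsLagSol M a τ₀ F₁ U₀ τ u σ) (hM : 0 < M) {t : ℝ}
    (ht : 0 ≤ t) (y : ℝ) : HasDerivAt (fun z => ∫ s in (0 : ℝ)..t, σ s z) (u t y - U₀ y) y := by
  have cs : ∀ z, Continuous fun s => σ s z := fun z => H.cσ.comp (Continuous.prodMk_left z)
  have cu : ∀ s, Continuous (u s) := fun s => H.cu.comp (Continuous.prodMk_right s)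
  refine hasDerivAt_of_periodic_of_integral hM (G := fun z => ∫ s in (0 : ℝ)..t, σ s z)
    (F := fun z => u t z - U₀ z) (fun z => ?_) (fun z => ?_) ?_ (fun z hz => ?_) y
  · simp only [H.perσ _ z]
  · simp only [← H.initu, H.peru _ z]
  · rw [← H.initu]
    exact (cu t).sub (cu 0)
  · rw [H.evolu t ht z hz, intervalIntegral.integral_sub ((cs z).intervalIntegrable _ _)
      ((cs 0).intervalIntegrable _ _)]

lemma mass_balance (H : IsLagSol M a τ₀ F₁ U₀ τ u σ) (cX₀ : Continuous X₀)
    (df : ∀ x, HasDerivAt f (f' x) x) (cf' : Continuous f') (k : ℝ → ℝ) (hk : Continuous k)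
    {t : ℝ} (ht : 0 ≤ t) :
    (∫ y in (0 : ℝ)..M, k y * f (flowMap X₀ u t y)) - ∫ y in (0 : ℝ)..M, k y * f (X₀ y) =
      ∫ s in (0 : ℝ)..t, ∫ y in (0 : ℝ)..M, k y * (f' (flowMap X₀ u s y) * u s y) := by
  have cX := continuous_flowMap cX₀ H.cu
  have cf : Continuous f := continuous_iff_continuousAt.2 fun x => (df x).continuousAt
  have ck : Continuous fun p : ℝ × ℝ => k p.2 := hk.comp continuous_snd
  have h1 := integral_sub_eq_integral_deriv (M := M)
    (G := fun t y => k y * f (flowMap X₀ u t y))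
    (G' := fun t y => k y * (f' (flowMap X₀ u t y) * u t y))
    (ck.mul (cf.comp cX)) (ck.mul ((cf'.comp cX).mul H.cu))
    (fun t ht y => ((df _).comp t (hasDerivAt_flowMap_time H.cu ht y)).const_mul (k y)) ht
  simpa only [flowMap_zero] using h1

theorem momentum_balance (H : IsLagSol M a τ₀ F₁ U₀ τ u σ) (hM : 0 < M)
    (hX : IsFlow M (2 * Real.pi) (flowMap X₀ u) Y τ)
    (df : ∀ x, HasDerivAt f (f' x) x) (df' : ∀ x, HasDerivAt f' (f'' x) x) (cf'' : Continuous f'')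
    (pf : Function.Periodic f (2 * Real.pi)) (pf' : Function.Periodic f' (2 * Real.pi))
    {t : ℝ} (ht : 0 ≤ t) :
    (∫ y in (0 : ℝ)..M, u t y * f (flowMap X₀ u t y)) - ∫ y in (0 : ℝ)..M, U₀ y * f (X₀ y) =
      ∫ s in (0 : ℝ)..t, ∫ y in (0 : ℝ)..M,
        (u s y ^ 2 * f' (flowMap X₀ u s y) - σ s y * f' (flowMap X₀ u s y) * τ s y) := by
  have cX := hX.cX
  have cf' : Continuous f' := continuous_iff_continuousAt.2 fun x => (df' x).continuousAt
  have cf : Continuous f := continuous_iff_continuousAt.2 fun x => (df x).continuousAt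
  have cX₀ : Continuous X₀ := by
    rw [← flowMap_zero X₀ u]
    exact (hX.coord 0).continuous
  have cU₀ : Continuous U₀ := by
    rw [← H.initu]
    exact H.cu.comp (Continuous.prodMk_right 0)
  have cτs : ∀ s, Continuous (τ s) := fun s => H.cτ.comp (Continuous.prodMk_right s)
  have cus : ∀ s, Continuous (u s) := fun s => H.cu.comp (Continuous.prodMk_right s)
  have cσs : ∀ s, Continuous (σ s) := fun s => H.cσ.comp (Continuous.prodMk_right s)
  have cXs : ∀ s, Continuous (flowMap X₀ u s) := fun s => (hX.coord s).continuous
  set Z : ℝ → ℝ → ℝ := fun t y => ∫ s in (0 : ℝ)..t, σ s y with hZ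
  have cZ : Continuous (Function.uncurry Z) := by
    have h : Continuous (Function.uncurry fun (p : ℝ × ℝ) (s : ℝ) => σ s p.2) :=
      H.cσ.comp (continuous_snd.prodMk (continuous_snd.comp continuous_fst))
    exact intervalIntegral.continuous_parametric_intervalIntegral_of_continuous h continuous_fst
  have cZs : ∀ s, Continuous (Z s) := fun s => cZ.comp (Continuous.prodMk_right s)
  have dZt : ∀ t y, HasDerivAt (fun s => Z s y) (σ t y) t := fun t y =>
    ((H.cσ.comp (Continuous.prodMk_left y)).integral_hasStrictDerivAt 0 t).hasDerivAt
  have dZy : ∀ t, 0 ≤ t → ∀ y, HasDerivAt (Z t) (u t y - U₀ y) y := fun t ht y =>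
    H.hasDerivAt_integral_stress hM ht y
  have pZ : ∀ t, Function.Periodic (Z t) M := fun t y => by simp only [hZ, H.perσ _ y]
  have e5 : ∀ y, Z 0 y = 0 := fun y => by simp [hZ]
  clear_value Z
  have dψ : ∀ s y, HasDerivAt (fun z => f (flowMap X₀ u s z)) (f' (flowMap X₀ u s y) * τ s y) y :=
    fun s y => (df _).comp y ((hX.coord s).deriv y)
  have dψ' : ∀ s y, HasDerivAt (fun z => f' (flowMap X₀ u s z) * u s z)
      (f'' (flowMap X₀ u s y) * τ s y * u s y + f' (flowMap X₀ u s y) * (τ s y ^ 3 * σ s y)) y :=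
    fun s y => ((df' _).comp y ((hX.coord s).deriv y)).mul (H.derivu s y)
  have e1 := H.mass_balance (M := M) cX₀ df cf' U₀ cU₀ ht
  have e2 : ∫ y in (0 : ℝ)..M, Z t y * (f' (flowMap X₀ u t y) * τ t y) =
      -∫ y in (0 : ℝ)..M, (u t y - U₀ y) * f (flowMap X₀ u t y) :=
    integral_mul_deriv_eq_neg_of_periodic (dZy t ht) ((cus t).sub cU₀) (pZ t) (dψ t)
      ((cf'.comp (cXs t)).mul (cτs t)) ((hX.coord t).periodic pf)
  have e3 : ∀ s, 0 ≤ s → ∫ y in (0 : ℝ)..M, Z s y * (f'' (flowMap X₀ u s y) * τ s y * u s y +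
      f' (flowMap X₀ u s y) * (τ s y ^ 3 * σ s y)) =
      -∫ y in (0 : ℝ)..M, (u s y - U₀ y) * (f' (flowMap X₀ u s y) * u s y) := fun s hs =>
    integral_mul_deriv_eq_neg_of_periodic (dZy s hs) ((cus s).sub cU₀) (pZ s) (dψ' s)
      ((((cf''.comp (cXs s)).mul (cτs s)).mul (cus s)).add
        ((cf'.comp (cXs s)).mul (((cτs s).pow 3).mul (cσs s))))
      (fun y => by simp only [(hX.coord s).shift, pf' _, H.peru s y])
  have cG₁ : Continuous fun p : ℝ × ℝ => σ p.1 p.2 * (f' (flowMap X₀ u p.1 p.2) * τ p.1 p.2) :=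
    H.cσ.mul ((cf'.comp cX).mul H.cτ)
  have cG₂ : Continuous fun p : ℝ × ℝ => f'' (flowMap X₀ u p.1 p.2) * u p.1 p.2 * τ p.1 p.2 :=
    ((cf''.comp cX).mul H.cu).mul H.cτ
  have cG₃ : Continuous fun p : ℝ × ℝ =>
      f' (flowMap X₀ u p.1 p.2) * (τ p.1 p.2 ^ 3 * σ p.1 p.2) :=
    (cf'.comp cX).mul ((H.cτ.pow 3).mul H.cσ)
  have cZ' : Continuous fun p : ℝ × ℝ => Z p.1 p.2 := cZ
  have cG' := cG₁.fun_add (cZ'.fun_mul (cG₂.fun_add cG₃))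
  have e4 := integral_sub_eq_integral_deriv (M := M)
    (G := fun t y => Z t y * (f' (flowMap X₀ u t y) * τ t y))
    (G' := fun s y => σ s y * (f' (flowMap X₀ u s y) * τ s y) +
      Z s y * (f'' (flowMap X₀ u s y) * u s y * τ s y +
        f' (flowMap X₀ u s y) * (τ s y ^ 3 * σ s y)))
    (cZ.mul ((cf'.comp cX).mul H.cτ))
    cG'
    (fun s hs y => (dZt s y).mul
      (((df' _).comp s (hasDerivAt_flowMap_time H.cu hs y)).mul (H.hasDerivAt_time hs y))) ht
  simp only [e5, zero_mul, intervalIntegral.integral_zero, sub_zero, e2] at e4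
  have c1 : Continuous fun y => u t y * f (flowMap X₀ u t y) := (cus t).mul (cf.comp (cXs t))
  have c2 : Continuous fun y => U₀ y * f (flowMap X₀ u t y) := cU₀.mul (cf.comp (cXs t))
  have e6 : ∫ y in (0 : ℝ)..M, (u t y - U₀ y) * f (flowMap X₀ u t y) =
      (∫ y in (0 : ℝ)..M, u t y * f (flowMap X₀ u t y)) -
        ∫ y in (0 : ℝ)..M, U₀ y * f (flowMap X₀ u t y) := by
    rw [← intervalIntegral.integral_sub (c1.intervalIntegrable _ _) (c2.intervalIntegrable _ _)]
    simp only [sub_mul]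
  have e7 : ∀ s, 0 ≤ s → ∫ y in (0 : ℝ)..M, (σ s y * (f' (flowMap X₀ u s y) * τ s y) +
      Z s y * (f'' (flowMap X₀ u s y) * u s y * τ s y +
        f' (flowMap X₀ u s y) * (τ s y ^ 3 * σ s y))) =
      (∫ y in (0 : ℝ)..M, U₀ y * (f' (flowMap X₀ u s y) * u s y)) -
      ∫ y in (0 : ℝ)..M,
        (u s y ^ 2 * f' (flowMap X₀ u s y) - σ s y * f' (flowMap X₀ u s y) * τ s y) := by
    intro s hs
    have c3 : Continuous fun y => σ s y * (f' (flowMap X₀ u s y) * τ s y) :=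
      (cσs s).mul ((cf'.comp (cXs s)).mul (cτs s))
    have c4 : Continuous fun y => Z s y * (f'' (flowMap X₀ u s y) * u s y * τ s y +
        f' (flowMap X₀ u s y) * (τ s y ^ 3 * σ s y)) :=
      (cZs s).mul ((((cf''.comp (cXs s)).mul (cus s)).mul (cτs s)).add
        ((cf'.comp (cXs s)).mul (((cτs s).pow 3).mul (cσs s))))
    have c5 : Continuous fun y => (u s y - U₀ y) * (f' (flowMap X₀ u s y) * u s y) :=
      ((cus s).sub cU₀).mul ((cf'.comp (cXs s)).mul (cus s))
    have c6 : Continuous fun y => U₀ y * (f' (flowMap X₀ u s y) * u s y) :=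
      cU₀.mul ((cf'.comp (cXs s)).mul (cus s))
    have c7 : Continuous fun y =>
        u s y ^ 2 * f' (flowMap X₀ u s y) - σ s y * f' (flowMap X₀ u s y) * τ s y :=
      (((cus s).pow 2).mul (cf'.comp (cXs s))).sub
        (((cσs s).mul (cf'.comp (cXs s))).mul (cτs s))
    rw [intervalIntegral.integral_add (c3.intervalIntegrable _ _) (c4.intervalIntegrable _ _)]
    have e8 := e3 s hs
    simp only [mul_right_comm (f'' _) (τ s _) (u s _)] at e8
    rw [e8, ← sub_eq_add_neg, ← intervalIntegral.integral_sub (c3.intervalIntegrable _ _)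
      (c5.intervalIntegrable _ _), ← intervalIntegral.integral_sub (c6.intervalIntegrable _ _)
      (c7.intervalIntegrable _ _)]
    refine intervalIntegral.integral_congr fun y _ => ?_
    ring
  have c8 : Continuous fun s => ∫ y in (0 : ℝ)..M, U₀ y * (f' (flowMap X₀ u s y) * u s y) :=
    intervalIntegral.continuous_parametric_intervalIntegral_of_continuous'
      ((cU₀.comp continuous_snd).mul ((cf'.comp cX).mul H.cu)) 0 M
  have c9 : Continuous fun s => ∫ y in (0 : ℝ)..M,
        (u s y ^ 2 * f' (flowMap X₀ u s y) - σ s y * f' (flowMap X₀ u s y) * τ s y) :=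
    intervalIntegral.continuous_parametric_intervalIntegral_of_continuous'
      (((H.cu.pow 2).mul (cf'.comp cX)).sub ((H.cσ.mul (cf'.comp cX)).mul H.cτ)) 0 M
  have e9 : ∫ s in (0 : ℝ)..t, ∫ y in (0 : ℝ)..M, (σ s y * (f' (flowMap X₀ u s y) * τ s y) +
      Z s y * (f'' (flowMap X₀ u s y) * u s y * τ s y +
        f' (flowMap X₀ u s y) * (τ s y ^ 3 * σ s y))) =
      (∫ s in (0 : ℝ)..t, ∫ y in (0 : ℝ)..M, U₀ y * (f' (flowMap X₀ u s y) * u s y)) -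
      ∫ s in (0 : ℝ)..t, ∫ y in (0 : ℝ)..M,
        (u s y ^ 2 * f' (flowMap X₀ u s y) - σ s y * f' (flowMap X₀ u s y) * τ s y) := by
    rw [← intervalIntegral.integral_sub (c8.intervalIntegrable _ _) (c9.intervalIntegrable _ _)]
    refine intervalIntegral.integral_congr fun s hs => ?_
    rw [uIcc_of_le ht] at hs
    exact e7 s hs.1
  rw [e9] at e4
  linarith

end IsLagSol

/-! ### The solution in Eulerian coordinates -/

lemma integral_neg_mul (f : L2) (φ : Torus → ℝ) :
    ∫ x, (-f : L2) x * φ x = -∫ x, f x * φ x := by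
  rw [← integral_neg]
  refine integral_congr_ae ?_
  filter_upwards [Lp.coeFn_neg f] with x hx
  rw [hx, Pi.neg_apply, neg_mul]

lemma integral_add_mul (f g : L2) {φ : Torus → ℝ} (hφ : Continuous φ) :
    ∫ x, (f + g : L2) x * φ x = (∫ x, f x * φ x) + ∫ x, g x * φ x := by
  rw [← integral_add (integrable_mul_continuous f hφ) (integrable_mul_continuous g hφ)]
  refine integral_congr_ae ?_
  filter_upwards [Lp.coeFn_add f g] with x hx
  rw [hx, Pi.add_apply, add_mul]

namespace IsLagSol

variable {M a : ℝ} {τ₀ τ₁ F₁ F₂ F₃ U₀ U₁ U₂ X₀ : ℝ → ℝ} {τ u σ g Y : ℝ → ℝ → ℝ}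

lemma field_stress (H : IsLagSol M a τ₀ F₁ U₀ τ u σ) (hM : 0 < M) (hF₁ : Continuous F₁)
    (hw : IsField M (fun t y => τ t y ^ 3 * σ t y) g) : ∃ B, IsField M σ B := by
  have hr := H.field_density hF₁
  have h1 := hw.mul hM (hr.mul hM (hr.mul hM hr))
  have e : (fun t y => τ t y ^ 3 * σ t y * (1 / τ t y * (1 / τ t y * (1 / τ t y)))) = σ := by
    ext t y
    have := (H.pos t y).ne'
    field_simp
  rw [e] at h1
  exact ⟨_, h1⟩

theorem exists_sobolev (H : IsLagSol M a τ₀ F₁ U₀ τ u σ) (D : IsLagData M τ₀ τ₁ F₁ F₂ U₀ U₁ U₂)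
    (hF : IsPrim F₂ F₃) (pF : PerL2 M F₃) (hw : IsField M (fun t y => τ t y ^ 3 * σ t y) g)
    (hX : IsFlow M (2 * Real.pi) (flowMap X₀ u) Y τ) :
    ∃ (v : ℝ → Sobolev 2) (ρ : ℝ → Sobolev 3), Continuous v ∧ Continuous ρ ∧
      (∀ t, der (v t) 0 = ofFun fun x => u t (Y t x)) ∧
      (∀ t, der (v t) 1 = ofFun fun x => τ t (Y t x) ^ 3 * σ t (Y t x) * (1 / τ t (Y t x))) ∧
      ∀ t, der (ρ t) 0 = ofFun fun x => 1 / τ t (Y t x) := by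
  have hM := D.mass_pos
  have hr := H.field_density D.continuous_F₁
  obtain ⟨v, cv, v0, v1⟩ := IsField.exists_sobolev_two (H.field_velocity.comp_flow hX)
    ((hw.mul hM hr).comp_flow hX)
  have h0 := (hr.comp_flow hX).congr_deriv
    (B' := fun t x => U₀ (Y t x) + F₁ (Y t x) - u t (Y t x)) fun t x => by
      have := (H.pos t (Y t x)).ne'
      field_simp
  have h1 := (D.field_effective.sub hM H.field_velocity).comp_flow hX
  have h2 := (((D.field_effective_deriv hF pF).sub hM hw).mul hM hr).comp_flow hX
  obtain ⟨ρ, cρ, ρ0⟩ := IsField.exists_sobolev_three h0 h1 h2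
  exact ⟨v, ρ, cv, cρ, v0, v1, ρ0⟩

theorem isSolution (H : IsLagSol M a τ₀ F₁ U₀ τ u σ) (hM : 0 < M) (hF₁ : Continuous F₁)
    (hw : IsField M (fun t y => τ t y ^ 3 * σ t y) g)
    (hX : IsFlow M (2 * Real.pi) (flowMap X₀ u) Y τ) {v : ℝ → Sobolev 2} {ρ : ℝ → Sobolev 3}
    (hv : ∀ t, der (v t) 0 = ofFun fun x => u t (Y t x))
    (hv' : ∀ t, der (v t) 1 = ofFun fun x => τ t (Y t x) ^ 3 * σ t (Y t x) * (1 / τ t (Y t x)))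
    (hρ : ∀ t, der (ρ t) 0 = ofFun fun x => 1 / τ t (Y t x)) : IsSolution v ρ := by
  have fu := H.field_velocity
  have fr := H.field_density hF₁
  have fm := fr.mul hM fu
  have fp := fr.mul hM (fu.mul hM fu)
  obtain ⟨B, fq⟩ := H.field_stress hM hF₁ hw
  have em := fm.comp_flow hX
  have ep := fp.comp_flow hX
  have eq := fq.comp_flow hX
  have eu := fu.comp_flow hX
  have er := fr.comp_flow hX
  have ew := (hw.mul hM fr).comp_flow hX
  have cX₀ : Continuous X₀ := by
    rw [← flowMap_zero X₀ u]
    exact (hX.coord 0).continuous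
  have hm : ∀ t, ofFun (fun x => 1 / τ t (Y t x) * u t (Y t x)) =ᵐ[volume]
      fun x => der (ρ t) 0 x * der (v t) 0 x := fun t => by
    rw [hv, hρ]
    exact ofFun_comp₂ (er.slice_perL2 t) (eu.slice_perL2 t) (em.slice_perL2 t)
      (F := fun a b => a * b) fun x => rfl
  have im : ∀ t (φ : Torus → ℝ), ∫ x, ofFun (fun x => 1 / τ t (Y t x) * u t (Y t x)) x * φ x =
      ∫ y in (0 : ℝ)..M, u t y * φ (flowMap X₀ u t y : Torus) := fun t φ => by
    rw [(hX.coord t).integral_ofFun_mul (fm.slice_perL2 t) φ]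
    refine intervalIntegral.integral_congr fun y _ => ?_
    have := (H.pos t y).ne'
    field_simp
  refine ⟨⟨_, _, fun t ht => ⟨hm t, em.isWeakDeriv t, ?_⟩⟩,
    ⟨_, _, _, _, _, fun t ht => ⟨hm t, ?_, ?_, ep.isWeakDeriv t, eq.isWeakDeriv t, ?_⟩⟩⟩
  · simp only [hρ]
    refine hasDerivWithinAt_of_forall_test em.continuous_ofFun_deriv.neg (fun t ht φ φ' hφ => ?_) ht
    have ir : ∀ t, ∫ x, ofFun (fun x => 1 / τ t (Y t x)) x * φ x =
        ∫ y in (0 : ℝ)..M, 1 * φ (flowMap X₀ u t y : Torus) := fun t => by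
      rw [(hX.coord t).integral_ofFun_mul (fr.slice_perL2 t) φ]
      refine intervalIntegral.integral_congr fun y _ => ?_
      have := (H.pos t y).ne'
      field_simp
    have cφ' : Continuous fun x : ℝ => φ' (x : Torus) :=
      hφ.continuous.2.comp (AddCircle.continuous_mk' _)
    have h1 := H.mass_balance (M := M) cX₀ hφ.2 cφ' (fun _ => 1) continuous_const ht
    rw [ir, ir, flowMap_zero, h1]
    refine intervalIntegral.integral_congr fun s _ => ?_
    simp only [Pi.neg_apply]
    rw [integral_neg_mul, ← em.isWeakDeriv s φ φ' hφ, im]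
    simp only [one_mul, mul_comm]
  · rw [hv, hρ]
    exact ofFun_comp₂ (er.slice_perL2 t) (eu.slice_perL2 t) (ep.slice_perL2 t)
      (F := fun a b => a * b ^ 2) fun x => by ring
  · rw [hv', hρ]
    refine ofFun_comp₂ (er.slice_perL2 t) (ew.slice_perL2 t) (eq.slice_perL2 t)
      (F := fun a b => a ^ 2 * b) fun x => ?_
    have := (H.pos t (Y t x)).ne'
    field_simp
  · refine hasDerivWithinAt_of_forall_test
      (ep.continuous_ofFun_deriv.neg.add eq.continuous_ofFun_deriv) (fun t ht φ φ' hφ => ?_) ht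
    obtain ⟨f, cf, df⟩ := hφ.exists_deriv
    have per : ∀ ψ : Torus → ℝ, Function.Periodic (fun x : ℝ => ψ (x : Torus)) (2 * Real.pi) :=
      fun ψ x => congrArg ψ (AddCircle.coe_add_period _ x)
    have h1 := H.momentum_balance hM hX hφ.2 df cf (per φ) (per φ') ht
    rw [im, im, flowMap_zero, H.initu, h1]
    refine intervalIntegral.integral_congr fun s _ => ?_
    have cX : Continuous fun y => φ' (flowMap X₀ u s y : Torus) :=
      hφ.continuous.2.comp ((AddCircle.continuous_mk' _).comp (hX.coord s).continuous)
    have c1 : Continuous fun y => u s y ^ 2 * φ' (flowMap X₀ u s y : Torus) :=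
      ((fu.slice s).pow 2).mul cX
    have c2 : Continuous fun y => σ s y * φ' (flowMap X₀ u s y : Torus) * τ s y :=
      ((fq.slice s).mul cX).mul (hX.coord s).cont
    simp only [Pi.add_apply, Pi.neg_apply]
    rw [integral_add_mul _ _ hφ.continuous.1, integral_neg_mul, ← ep.isWeakDeriv s φ φ' hφ,
      ← neg_eq_iff_eq_neg.2 (eq.isWeakDeriv s φ φ' hφ),
      (hX.coord s).integral_ofFun_mul (fp.slice_perL2 s) φ',
      (hX.coord s).integral_ofFun_mul (fq.slice_perL2 s) φ', ← sub_eq_add_neg,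
      intervalIntegral.integral_sub (c1.intervalIntegrable _ _) (c2.intervalIntegrable _ _)]
    congr 1
    refine intervalIntegral.integral_congr fun y _ => ?_
    have := (H.pos s y).ne'
    field_simp

end IsLagSol

theorem exists_global_solution (u₀ : Sobolev 2) (ρ₀ : Sobolev 3) (hρ₀ : IsPositive (der ρ₀ 0)) :
    ∃ (u : ℝ → Sobolev 2) (ρ : ℝ → Sobolev 3), Continuous u ∧ Continuous ρ ∧ u 0 = u₀ ∧ ρ 0 = ρ₀ ∧
      (∀ t, IsPositive (der (ρ t) 0)) ∧ IsSolution u ρ := by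
  obtain ⟨W₀, W₁, W₂, w0, w1, q0, q1, q2, hW⟩ := exists_rep_two u₀
  obtain ⟨c, R₀, R₁, R₂, R₃, hc, hR, r0, r1, r2, p0, -, p2, p3, hRρ⟩ := exists_rep_three ρ₀ hρ₀
  obtain ⟨M, X₀, Y₀, τ₀, τ₁, F₁, F₂, F₃, U₀, U₁, U₂, D, hF, pF, hX₀, hRX, hWX⟩ :=
    exists_isLagData hc hR r0 r1 r2 p0 p2 p3 w0 w1 q0 q1 q2
  obtain ⟨a, τ, u, σ, g, H, pg, hg, cg⟩ := D.exists_isLagSol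
  have hM := D.mass_pos
  obtain ⟨Y, hX⟩ := H.exists_isFlow hM Real.two_pi_pos hX₀
  have hw := H.field_strain pg hg cg
  obtain ⟨v, ρ, cv, cρ, v0, v1, ρ0⟩ := H.exists_sobolev D hF pF hw hX
  have hY : ∀ x, X₀ (Y 0 x) = x := fun x => by
    have := (hX.coord 0).right x
    rwa [flowMap_zero] at this
  refine ⟨v, ρ, cv, cρ, Sobolev.ext_zero ?_, Sobolev.ext_zero ?_, fun t => ?_,
    H.isSolution hM D.continuous_F₁ hw hX v0 v1 ρ0⟩
  · rw [v0, ← hW]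
    congr 1
    ext x
    rw [H.initu, ← hWX, hY]
  · rw [ρ0, ← hRρ]
    congr 1
    ext x
    rw [H.initτ, ← hRX, hY]
  · have er := (H.field_density D.continuous_F₁).comp_flow hX
    obtain ⟨b, -, hb⟩ := exists_abs_le_of_periodic (hX.coord t).cont (H.perτ t) hM
    have hb' : ∀ y, τ t y ≤ b := fun y => (le_abs_self _).trans (hb y)
    rw [ρ0]
    exact isPositive_ofFun (er.slice_perL2 t) (one_div_pos.2 ((H.pos t 0).trans_le (hb' 0)))
      fun x => one_div_le_one_div_of_le (H.pos t _) (hb' _)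

end PressurelessNS

end

theorem theorem1p2 (u₀ : PressurelessNS.Sobolev 2) (ρ₀ : PressurelessNS.Sobolev 3)
    (hρ₀ : PressurelessNS.IsPositive (PressurelessNS.der ρ₀ 0)) :
    ∃ (u : ℝ → PressurelessNS.Sobolev 2) (ρ : ℝ → PressurelessNS.Sobolev 3),
      ContinuousOn u (Set.Ici 0) ∧ ContinuousOn ρ (Set.Ici 0) ∧
      u 0 = u₀ ∧ ρ 0 = ρ₀ ∧
      (∀ t : ℝ, 0 ≤ t → PressurelessNS.IsPositive (PressurelessNS.der (ρ t) 0)) ∧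
      PressurelessNS.IsSolution u ρ := by
  obtain ⟨u, ρ, cu, cρ, hu, hρ, hpos, hsol⟩ :=
    PressurelessNS.exists_global_solution u₀ ρ₀ hρ₀
  exact ⟨u, ρ, cu.continuousOn, cρ.continuousOn, hu, hρ, fun t _ => hpos t, hsol⟩
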